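/- Let $n$ be even. The configuration model of degree $3$ on $[n]=\{1,\dots,n\}$ is the law of the random multigraph $G$ (loops and multiple edges allowed) obtained from a uniformly random perfect matching of the half-edges $[n]\times\{1,2,3\}$, each matched pair $\{(i,j),(i',j')\}$ giving an edge between $i$ and $i'$; $E$ denotes its multiset of edges. A set $V_0\subset[n]$ is 2-independent in $G$ if any two distinct vertices of $V_0$ are at distance at least $3$ in $G$. Let $\alpha_3^*$ be the supremum of the $\alpha\in(0,1/4)$ for which the expected number, in this model, of 2-independent sets of size $\lfloor\alpha n\rfloor$ grows exponentially as $n\to\infty$ through even integers, i.e. is at least $e^{cn}$ for some $c>0$ and all sufficiently large even $n$ (numerically $\alpha_3^*\in(0.235,0.236)$). Label qubits by $[n]$, with Pauli operators $X_v,Z_v$, and let $$C_G=\sum_{\{i,i'\}\in E}\frac{1-Z_iZ_{i'}}2,\qquad |\psi_G\rangle=e^{-\frac i2\beta\sum_v X_v}\,e^{-\frac i2\gamma\sum_{\{i,i'\}\in E}Z_iZ_{i'}}\,|+\rangle^{\otimes n},\qquad \beta=-\frac\pi4,\quad \gamma=\arctan\frac1{\sqrt2},$$ so that $C_G$ counts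 the satisfied edges of a cut and $|\psi_G\rangle$ is the depth-1 QAOA state for MaxCut at the angles that are optimal for 3-regular graphs. For $\sigma\in\{-1,1\}^{V_0}$ put $P_\sigma=\prod_{v\in V_0}\frac{1+\sigma_vZ_v}2$. Then there is an absolute constant $K$ such that for every even $n$ and every $V_0\subset[n]$ with $\alpha:=|V_0|/n\in(0,\alpha_3^*)$, $$\mathbf E_G\left[\max_{\sigma\in\{-1,1\}^{V_0}}\frac{\langle\psi_G|P_\sigma C_GP_\sigma|\psi_G\rangle}{\lVert P_\sigma|\psi_G\rangle\rVert^2}-\langle\psi_G|C_G|\psi_G\rangle\ \middle|\ V_0\text{ is 2-independent in }G\right]\le\frac{\alpha^2(0.18125-0.83875\,\alpha+0.99\,\alpha^2)}{(0.5-\alpha)^3}\,n+K .$$ -/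

import Mathlib

noncomputable section

namespace QAOA

/-! ### The configuration model -/

/-- Perfect matchings of a set, as fixed-point-free involutions: the matched pairs are the
sets `{x, Δ x}`. -/
def PerfectMatching (H : Type) : Type :=
  {f : H → H // Function.Involutive f ∧ ∀ x, f x ≠ x}

instance (H : Type) [Finite H] : Finite (PerfectMatching H) :=
  inferInstanceAs (Finite {f : H → H // Function.Involutive f ∧ ∀ x, f x ≠ x})

instance (H : Type) [Finite H] : Fintype (PerfectMatching H) := Fintype.ofFinite _

/-- The half-edges of a `d`-regular multigraph on `n` vertices: `(i, j)` is attached to `i`. -/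
abbrev HalfEdge (n d : ℕ) : Type := Fin n × Fin d

/-- The sample space of the configuration model on `n` vertices of degree `d`; the model is the
uniform distribution on this finite type. A configuration `Δ` encodes the multigraph with one edge
between `x.1` and `(Δ x).1` for every matched pair `{x, Δ x}` of half-edges, so that loops and
multiple edges may occur. -/
abbrev Configuration (n d : ℕ) : Type := PerfectMatching (HalfEdge n d)

variable {n d : ℕ}

/-- The vertex at the other end of the edge that contains the half-edge `x`. -/
def Configuration.target (Δ : Configuration n d) (x : HalfEdge n d) : Fin n := (Δ.1 x).1

/-- The adjacency relation of the multigraph, for distinct vertices. Paths and distances in the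
multigraph are those of this graph, since loops and multiplicities do not change them. -/
def Configuration.graph (Δ : Configuration n d) : SimpleGraph (Fin n) :=
  SimpleGraph.fromRel fun i i' => ∃ j j' : Fin d, Δ.1 (i, j) = (i', j')

/-- `S` is `k`-independent in `G`: any two of its vertices are at distance at least `k + 1`
(distance `∞` if they lie in different components). -/
def IsKIndependent {V : Type} (G : SimpleGraph V) (k : ℕ) (S : Finset V) : Prop :=
  ∀ v ∈ S, ∀ w ∈ S, v ≠ w → ((k + 1 : ℕ) : ℕ∞) ≤ G.edist v w

open Classical in
/-- Expectation of `f` in the configuration model. -/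
def expectation (f : Configuration n d → ℝ) : ℝ :=
  (∑ Δ, f Δ) / (Fintype.card (Configuration n d) : ℝ)

open Classical in
/-- Expectation of `f` in the configuration model, conditioned on the event `A`. -/
def condExpectation (f : Configuration n d → ℝ) (A : Configuration n d → Prop) : ℝ :=
  (∑ Δ with A Δ, f Δ) / ((Finset.univ.filter A).card : ℝ)

/-! ### The critical density of 2-independent sets -/

open Classical in
/-- The number of 2-independent sets of size `k`. -/
def numTwoIndependent (k : ℕ) (Δ : Configuration n d) : ℕ :=
  ((Finset.univ : Finset (Finset (Fin n))).filter
    fun S => S.card = k ∧ IsKIndependent Δ.graph 2 S).card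

/-- The expected number of 2-independent sets of size `⌊α n⌋` in the configuration model of degree
`d` grows exponentially with `n` (along those `n` for which there are configurations). -/
def GrowsExponentially (d : ℕ) (α : ℝ) : Prop :=
  ∃ c : ℝ, 0 < c ∧ ∀ᶠ n : ℕ in Filter.atTop, Even (n * d) →
    Real.exp (c * n) ≤
      expectation fun Δ : Configuration n d => (numTwoIndependent ⌊α * n⌋₊ Δ : ℝ)

/-- The critical density `α_d^*`: below it the expected number of 2-independent sets of size `α n`
grows exponentially with `n`. -/
def alphaStar (d : ℕ) : ℝ :=
  sSup {α : ℝ | 0 < α ∧ α < 1 / ((d : ℝ) + 1) ∧ GrowsExponentially d α}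

/-! ### Depth-1 QAOA for MaxCut -/

/-- Computational basis of the qubits labelled by the vertices. -/
abbrev Bits (n : ℕ) : Type := Fin n → Bool

/-- Operators on the qubits labelled by the vertices. -/
abbrev Operator (n : ℕ) : Type := Matrix (Bits n) (Bits n) ℂ

/-- The eigenvalue of `Z` on the basis state `|b⟩`. -/
def spin (b : Bool) : ℂ := if b then -1 else 1

/-- The Pauli operator `Z` at the vertex `v`. -/
def pauliZ (v : Fin n) : Operator n := Matrix.diagonal fun z => spin (z v)

/-- The Pauli operator `X` at the vertex `v`: it flips the bit `v`. -/
def pauliX (v : Fin n) : Operator n :=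
  Matrix.of fun y z => if y = Function.update z v (!z v) then 1 else 0

/-- The mixing Hamiltonian `∑ v, X_v`. -/
def mixer (n : ℕ) : Operator n := ∑ v : Fin n, pauliX v

/-- The Ising Hamiltonian `∑ Z_i Z_i'` over the edges `{i, i'}`, counted with multiplicity.
In the sum over half-edges every edge occurs twice. -/
def isingHamiltonian (Δ : Configuration n d) : Operator n :=
  (1 / 2 : ℂ) • ∑ x : HalfEdge n d, pauliZ x.1 * pauliZ (Δ.target x)

/-- The observable `∑ (1 - Z_i Z_i') / 2` over the edges `{i, i'}`, counted with multiplicity: the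
number of satisfied edges of the cut given by a basis state. In the sum over half-edges every edge
occurs twice. -/
def cutOperator (Δ : Configuration n d) : Operator n :=
  (1 / 2 : ℂ) • ∑ x : HalfEdge n d,
    (1 / 2 : ℂ) • (1 - pauliZ x.1 * pauliZ (Δ.target x))

/-- The product state `|+⟩^{⊗ n}`. -/
def plusState (n : ℕ) : Bits n → ℂ := fun _ => (((Real.sqrt 2) ^ n)⁻¹ : ℝ)

/-- The depth-1 QAOA state `exp(-iβB/2) exp(-iγC/2) |+⟩^{⊗ n}`, where `B` is the mixing Hamiltonian
and `C` the Ising Hamiltonian of the multigraph. -/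
def qaoaState (β γ : ℝ) (Δ : Configuration n d) : Bits n → ℂ :=
  (NormedSpace.exp ((-(Complex.I / 2) * (β : ℂ)) • mixer n) *
    NormedSpace.exp ((-(Complex.I / 2) * (γ : ℂ)) • isingHamiltonian Δ)).mulVec (plusState n)

/-- `⟨ψ|A|ψ⟩` (a real number for the Hermitian operators considered here). -/
def braket (A : Operator n) (ψ : Bits n → ℂ) : ℝ := (dotProduct (star ψ) (A.mulVec ψ)).re

/-- The squared Hilbert space norm. -/
def normSquared (ψ : Bits n → ℂ) : ℝ := ∑ z, ‖ψ z‖ ^ 2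

/-- The projector `∏_{v ∈ V₀} (1 + σ_v Z_v) / 2`, a product of diagonal matrices. -/
def projector (V₀ : Finset (Fin n)) (σ : V₀ → ℤˣ) : Operator n :=
  Matrix.diagonal fun z => ∏ v : V₀, (1 + ((σ v : ℤ) : ℂ) * spin (z v)) / 2

/-- The increase in the expected number of satisfied edges when the state `ψ` is postselected on
the outcomes `σ`: `⟨ψ|P C P|ψ⟩ / ‖Pψ‖² - ⟨ψ|C|ψ⟩`, with `P` the projector and `C` the number of
satisfied edges. -/
def gain (Δ : Configuration n d) (ψ : Bits n → ℂ) (V₀ : Finset (Fin n)) (σ : V₀ → ℤˣ) : ℝ :=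
  braket (projector V₀ σ * cutOperator Δ * projector V₀ σ) ψ /
      normSquared ((projector V₀ σ).mulVec ψ) -
    braket (cutOperator Δ) ψ

/-- The improvement of postselected QAOA over QAOA on a 3-regular multigraph: the gain of the
depth-1 QAOA state, maximized over the postselected values `σ ∈ {-1, 1}^{V₀}`, at the angles
`β = -π/4`, `γ = arctan (1/√2)` that are optimal for depth-1 QAOA on 3-regular graphs. -/
def improvement (Δ : Configuration n 3) (V₀ : Finset (Fin n)) : ℝ :=
  Finset.univ.sup' Finset.univ_nonempty fun σ : V₀ → ℤˣ =>
    gain Δ (qaoaState (-(Real.pi / 4)) (Real.arctan (1 / Real.sqrt 2)) Δ) V₀ σ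

end QAOA

end

/-!
The proof has a deterministic half, which computes the gain of postselection on a fixed multigraph,
and a probabilistic half, which averages the result over the configuration model.

*The gain.* At `β = -π/4`, the expectation of a product of one-vertex observables in the depth-1
state is an average over pairs of spin configurations that agree away from the support of the
observable (`sum_prod_mul_normSq`). If `V₀` is 2-independent, the stars of its vertices are
disjoint, so the observable `∏ (1 + σ_v Z_v)` gives one factor per star. A star without further
observables averages to `1`, because the part linear in `Z_v` is odd under a global spin flip
(`expect_starWeight`). Hence all outcomes `σ` have the same probability, and the gain is a sum over
edges of differences of correlations `⟨Z_i Z_i'⟩` (`gain_eq_sum`). Such a correlation involves only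
the stars that meet `i`, `i'` and their neighbours. Unless there is a short cycle nearby, each of
these stars sends an explicit message to its one leaf in question, and the correlation is an
explicit polynomial in the signs (`correlation_pair`, `correlation_singleton`). Every monomial is a
product of two signs, of stars that are joined by a path of one, two or three edges between leaves.
With absolute values, the gain is at most a weighted count `mainTerm` of such paths, plus a multiple
of the number `numDefects` of short cycles and of irregular stars (stars with a loop or a double
edge), see `gain_le`.

*The average.* Conditionally on the edges at `V₀`, the other half-edges are matched uniformly at
random. The bound is therefore averaged over the classes of configurations with the same edges at
`V₀` (`starClass`). Within a class, the expected number of paths is as for independent uniform mates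
and the expected number of short cycles is bounded, which gives `leadingTerm` up to a bounded error
and a multiple of the number of irregular stars (`sum_starClass_le`). Irregular stars are few by a
switching argument: a loop or a double edge at `V₀` can be moved to a vertex outside all stars, and
few switchings lead to the same configuration (`sum_irregular_le`). This gives a bounded expected
number as long as a positive fraction of the vertices lies outside the stars. Otherwise `|V₀| / n`
is close to `1/4`, and the expected number is at most a small multiple of `n`, which is absorbed by
the slack between `leadingTerm` and the claimed polynomial (`leadingTerm_le`). The critical density
enters only through the bound `α_3^* ≤ 1/4` (`alphaStar_le`).
-/

noncomputable section

open Finset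
open scoped BigOperators

namespace QAOA

/-! ### Averages over spin configurations -/

section Averages

variable {V P : Type} [Fintype V] [DecidableEq V] [Fintype P]

/-- The average of `F` may be taken in two steps: over the coordinates in `S`, then over the
others. The proof exchanges the coordinates in `S` of two independent copies. -/
theorem expect_piecewise (S : Finset V) (F : (V → P) → ℂ) [Nonempty P] :
    𝔼 p, F p = 𝔼 l, 𝔼 p, F (S.piecewise l p) := by
  have h1 : 𝔼 p, F p = 𝔼 l, 𝔼 _p : V → P, F l := by simp
  rw [h1, ← Finset.expect_product (s := univ) (t := univ) (f := fun x : (V → P) × (V → P) => F x.1),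
    ← Finset.expect_product (s := univ) (t := univ)
      (f := fun x : (V → P) × (V → P) => F (S.piecewise x.1 x.2)), univ_product_univ]
  have hinv : Function.Involutive (fun x : (V → P) × (V → P) =>
      (S.piecewise x.1 x.2, S.piecewise x.2 x.1)) := by
    rintro ⟨l, p⟩
    ext v <;> by_cases hv : v ∈ S <;> simp [hv]
  symm
  exact Fintype.expect_equiv hinv.toPerm _ _ fun x => rfl

theorem expect_mul_of_dependsOn [Nonempty P] {A B : Set V} (hAB : Disjoint A B)
    {f g : (V → P) → ℂ} (hf : DependsOn f A) (hg : DependsOn g B) :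
    𝔼 p, f p * g p = (𝔼 p, f p) * 𝔼 p, g p := by
  classical
  rw [expect_piecewise (univ.filter (· ∈ A)), Finset.expect_mul]
  refine Finset.expect_congr rfl fun l _ => ?_
  rw [Finset.mul_expect]
  refine Finset.expect_congr rfl fun p _ => ?_
  congr 1
  · exact hf fun v hv => by simp [hv]
  · refine hg fun v hv => ?_
    have : v ∉ A := fun h => Set.disjoint_left.1 hAB h hv
    simp [this]

/-- Functions of pairwise disjoint sets of coordinates are independent. -/
theorem expect_prod_of_dependsOn [Nonempty P] {K : Type} [DecidableEq K] (s : Finset K)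
    (C : K → Set V) (f : K → (V → P) → ℂ)
    (hC : ∀ k ∈ s, ∀ k' ∈ s, k ≠ k' → Disjoint (C k) (C k'))
    (hf : ∀ k ∈ s, DependsOn (f k) (C k)) :
    𝔼 p, ∏ k ∈ s, f k p = ∏ k ∈ s, 𝔼 p, f k p := by
  induction s using Finset.induction_on with
  | empty => simp
  | insert a s ha ih =>
    simp only [Finset.prod_insert ha]
    rw [expect_mul_of_dependsOn (A := C a) (B := ⋃ k ∈ s, C k) _ (hf a (mem_insert_self _ _)) _,
      ih (fun k hk k' hk' => hC k (mem_insert_of_mem hk) k' (mem_insert_of_mem hk'))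
        (fun k hk => hf k (mem_insert_of_mem hk))]
    · simp only [Set.disjoint_iUnion_right]
      intro k hk
      exact hC a (mem_insert_self _ _) k (mem_insert_of_mem hk) (by rintro rfl; exact ha hk)
    · intro p q hpq
      refine Finset.prod_congr rfl fun k hk => hf k (mem_insert_of_mem hk) fun v hv => hpq v ?_
      simp only [Set.mem_iUnion]
      exact ⟨k, hk, hv⟩

theorem expect_single [Nonempty P] (a : V) (g : P → ℂ) : 𝔼 p : V → P, g (p a) = 𝔼 b, g b := by
  have h := Fintype.expect_equiv (Equiv.funSplitAt a P) (fun p : V → P => g (p a))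
    (fun x : P × ({j // j ≠ a} → P) => g x.1) (fun p => by simp [Equiv.funSplitAt])
  rw [h, ← univ_product_univ, Finset.expect_product]
  simp only [Fintype.expect_const]

theorem expect_pair [Nonempty P] {a b : V} (hab : a ≠ b) (g : P → P → ℂ) :
    𝔼 p : V → P, g (p a) (p b) = 𝔼 x, 𝔼 y, g x y := by
  refine (expect_piecewise {a} fun p : V → P => g (p a) (p b)).trans ?_
  refine Eq.trans ?_ (expect_single (V := V) a fun x => 𝔼 y, g x y)
  refine Finset.expect_congr rfl fun l _ => ?_
  refine Eq.trans ?_ (expect_single (V := V) b fun y => g (l a) y)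
  refine Finset.expect_congr rfl fun p _ => ?_
  simp [hab.symm]

end Averages

/-! ### The depth-1 state in the computational basis -/

theorem exp_smul_of_sq_eq_one {m : Type} [Fintype m] [DecidableEq m] (X : Matrix m m ℂ)
    (hX : X * X = 1) (a : ℂ) :
    NormedSpace.exp (a • X) = Complex.cosh a • (1 : Matrix m m ℂ) + Complex.sinh a • X := by
  let _ : NormedRing (Matrix m m ℂ) := Matrix.linftyOpNormedRing
  let _ : NormedAlgebra ℂ (Matrix m m ℂ) := Matrix.linftyOpNormedAlgebra
  -- `X` generates a quotient of the algebra `ℂ × ℂ`, in which exponentials are taken componentwise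
  let φ : (ℂ × ℂ) →+* Matrix m m ℂ :=
    { toFun := fun z => (z.1 / 2) • (1 + X) + (z.2 / 2) • (1 - X)
      map_one' := by
        simp only [Prod.fst_one, Prod.snd_one]
        module
      map_zero' := by simp
      map_add' := by
        intro x y
        simp only [Prod.fst_add, Prod.snd_add]
        module
      map_mul' := by
        intro x y
        simp only [Prod.fst_mul, Prod.snd_mul, add_mul, mul_add, sub_mul, mul_sub, smul_mul_assoc,
          mul_smul_comm, one_mul, mul_one, hX]
        module }
  have hφ : Continuous φ := by
    change Continuous fun z : ℂ × ℂ => (z.1 / 2) • (1 + X) + (z.2 / 2) • (1 - X)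
    fun_prop
  have h := NormedSpace.map_exp φ hφ (a, -a)
  have h2 : φ (a, -a) = a • X := by
    change (a / 2) • (1 + X) + (-a / 2) • (1 - X) = _
    module
  rw [h2] at h
  refine h.symm.trans ?_
  change ((NormedSpace.exp ((a, -a) : ℂ × ℂ)).1 / 2) • (1 + X)
    + ((NormedSpace.exp ((a, -a) : ℂ × ℂ)).2 / 2) • (1 - X) = _
  rw [Prod.fst_exp, Prod.snd_exp, ← Complex.exp_eq_exp_ℂ, Complex.cosh, Complex.sinh]
  module

variable {n : ℕ}

theorem pauliX_mul_apply (v : Fin n) (M : Operator n) (z y : Bits n) :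
    (pauliX v * M) z y = M (Function.update z v (!z v)) y := by
  rw [Matrix.mul_apply, Finset.sum_eq_single (Function.update z v (!z v))]
  · simp [pauliX]
  · intro w _ hw
    have : z ≠ Function.update w v (!w v) := by
      rintro rfl
      simp at hw
    simp [pauliX, this]
  · simp

theorem pauliX_sq (v : Fin n) : pauliX v * pauliX v = 1 := by
  ext z y
  rw [pauliX_mul_apply, pauliX, Matrix.of_apply, Matrix.one_apply]
  congr 1
  refine propext ⟨fun h => ?_, fun h => ?_⟩
  · funext u
    have := congrFun h u
    by_cases hu : u = v
    · subst hu; simpa using this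
    · simpa [hu] using this
  · rw [h]

theorem pauliX_commute (v w : Fin n) : Commute (pauliX v) (pauliX w) := by
  by_cases hvw : v = w
  · subst hvw; exact Commute.refl _
  ext z y
  rw [pauliX_mul_apply, pauliX_mul_apply, pauliX, pauliX, Matrix.of_apply, Matrix.of_apply]
  congr 1
  refine propext ⟨fun h => ?_, fun h => ?_⟩ <;>
  · funext u
    have := congrFun h u
    have h1 := congrFun h v
    have h2 := congrFun h w
    by_cases hu : u = v
    · subst hu; simp_all [Ne.symm hvw]
    · by_cases hu' : u = w
      · subst hu'; simp_all [Ne.symm hvw]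
      · simp_all [Ne.symm hvw]

/-- The matrix of `exp (a X)` for a single qubit. -/
def mixEntry (a : ℂ) (b b' : Bool) : ℂ := if b = b' then Complex.cosh a else Complex.sinh a

theorem exp_sum_pauliX_apply (a : ℂ) (s : Finset (Fin n)) (z y : Bits n) :
    NormedSpace.exp (a • ∑ v ∈ s, pauliX v) z y =
      ∏ v, if v ∈ s then mixEntry a (z v) (y v) else if z v = y v then 1 else 0 := by
  induction s using Finset.induction_on generalizing z with
  | empty =>
    simp only [sum_empty, smul_zero, NormedSpace.exp_zero, notMem_empty, if_false,
      Matrix.one_apply]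
    rw [Finset.prod_ite_zero]
    simp [funext_iff]
  | insert v s hv ih =>
    rw [sum_insert hv, smul_add, Matrix.exp_add_of_commute _ _ ?_,
      exp_smul_of_sq_eq_one _ (pauliX_sq v), add_mul, smul_mul_assoc, smul_mul_assoc, one_mul,
      Matrix.add_apply, Matrix.smul_apply, Matrix.smul_apply, pauliX_mul_apply, ih, ih,
      ← Finset.mul_prod_erase univ _ (mem_univ v), ← Finset.mul_prod_erase univ _ (mem_univ v),
      ← Finset.mul_prod_erase univ _ (mem_univ v)]
    · have h1 : ∏ x ∈ univ.erase v, (if x ∈ insert v s then mixEntry a (z x) (y x) else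
          if z x = y x then 1 else 0) = ∏ x ∈ univ.erase v, (if x ∈ s then
          mixEntry a (z x) (y x) else if z x = y x then 1 else 0) := by
        refine prod_congr rfl fun x hx => ?_
        simp [ne_of_mem_erase hx]
      have h2 : ∏ x ∈ univ.erase v, (if x ∈ s then
          mixEntry a (Function.update z v (!z v) x) (y x) else
          if Function.update z v (!z v) x = y x then 1 else 0) =
          ∏ x ∈ univ.erase v, (if x ∈ s then
          mixEntry a (z x) (y x) else if z x = y x then 1 else 0) := by
        refine prod_congr rfl fun x hx => ?_
        simp [ne_of_mem_erase hx]
      rw [h1, h2]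
      simp only [hv, if_false, mem_insert_self, if_true, Function.update_self, mixEntry,
        smul_eq_mul]
      cases z v <;> cases y v <;> simp
    · refine Commute.smul_left (Commute.smul_right ?_ a) a
      exact Commute.sum_right _ _ _ fun w _ => pauliX_commute v w

variable {d : ℕ}

/-- The diagonal entry of the Ising Hamiltonian. -/
def isingEnergy (Δ : Configuration n d) (y : Bits n) : ℂ :=
  (1 / 2) * ∑ x : HalfEdge n d, spin (y x.1) * spin (y (Δ.target x))

theorem isingHamiltonian_eq_diagonal (Δ : Configuration n d) :
    isingHamiltonian Δ = Matrix.diagonal (isingEnergy Δ) := by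
  unfold isingHamiltonian isingEnergy pauliZ
  simp only [Matrix.diagonal_mul_diagonal]
  ext z y
  rw [Matrix.smul_apply, Matrix.sum_apply]
  by_cases h : z = y
  · subst h; simp
  · simp [Matrix.diagonal_apply_ne _ h]

theorem qaoaState_apply (β γ : ℝ) (Δ : Configuration n d) (z : Bits n) :
    qaoaState β γ Δ z = (((Real.sqrt 2) ^ n)⁻¹ : ℝ) *
      ∑ y, (∏ v, mixEntry (-(Complex.I / 2) * β) (z v) (y v)) *
        Complex.exp (-(Complex.I / 2) * γ * isingEnergy Δ y) := by
  have hexp : NormedSpace.exp ((-(Complex.I / 2) * (γ : ℂ)) • isingHamiltonian Δ) =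
      Matrix.diagonal fun y => Complex.exp (-(Complex.I / 2) * γ * isingEnergy Δ y) := by
    rw [isingHamiltonian_eq_diagonal, ← Matrix.diagonal_smul, Matrix.exp_diagonal]
    congr 1
    funext y
    rw [Pi.coe_exp, ← Complex.exp_eq_exp_ℂ]
    simp
  unfold qaoaState
  rw [hexp, Matrix.mulVec, dotProduct, Finset.mul_sum]
  refine sum_congr rfl fun y _ => ?_
  rw [Matrix.mul_diagonal, mixer, exp_sum_pauliX_apply, plusState]
  simp only [mem_univ, if_true]
  ring

/-! ### Product observables as averages over pairs of spins -/

/-- `1 / √2`, the common value of `cos β` and `- sin β` at `β = - π / 4`. -/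
def invSqrtTwo : ℂ := ((Real.sqrt 2)⁻¹ : ℝ)

theorem invSqrtTwo_sq : invSqrtTwo ^ 2 = 1 / 2 := by
  unfold invSqrtTwo
  rw [← Complex.ofReal_pow, inv_pow, Real.sq_sqrt (by norm_num)]
  norm_num

theorem spin_mul_self (b : Bool) : spin b * spin b = 1 := by cases b <;> simp [spin]

/-- The weight of a vertex that carries the observable `a + b Z`. The pair `p` encodes the spin
`spin p.1` of the ket at the vertex and whether the spin of the bra is opposite to it (`p.2`). -/
def vertexWeight (a b : ℂ) (p : Bool × Bool) : ℂ :=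
  if p.2 then 2 * (b * (Complex.I * spin p.1 * invSqrtTwo)) else 2 * (a + b * spin p.1 * invSqrtTwo)

/-- The second spin at the vertex `v`: it may differ from the first one only at the vertices
of `M`. -/
def secondSpin (M : Finset (Fin n)) (p : Fin n → Bool × Bool) (v : Fin n) : ℂ :=
  if v ∈ M ∧ (p v).2 = true then - spin (p v).1 else spin (p v).1

/-- The difference of the Ising energies of an edge `{u, w}` between the two spin configurations
encoded by `p`. -/
def edgeAction (M : Finset (Fin n)) (p : Fin n → Bool × Bool) (u w : Fin n) : ℂ :=
  spin (p u).1 * spin (p w).1 - secondSpin M p u * secondSpin M p w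

theorem sum_mixEntry (a b : ℂ) (y y' : Bool) :
    ∑ z : Bool, (a + b * spin z) * ((starRingEnd ℂ) (mixEntry (Complex.I * (Real.pi / 8 : ℝ)) z y) *
      mixEntry (Complex.I * (Real.pi / 8 : ℝ)) z y') =
      if y = y' then a + b * spin y * invSqrtTwo else b * (Complex.I * spin y * invSqrtTwo) := by
  have h1 : Complex.cosh (Complex.I * (Real.pi / 8 : ℝ)) = (Real.cos (Real.pi / 8) : ℝ) := by
    rw [mul_comm, Complex.cosh_mul_I, Complex.ofReal_cos]
  have h2 : Complex.sinh (Complex.I * (Real.pi / 8 : ℝ)) =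
      Complex.I * (Real.sin (Real.pi / 8) : ℝ) := by
    rw [mul_comm, Complex.sinh_mul_I, Complex.ofReal_sin, mul_comm]
  have h3 : Real.cos (Real.pi / 8) ^ 2 + Real.sin (Real.pi / 8) ^ 2 = 1 := Real.cos_sq_add_sin_sq _
  have h8 : 2 * (Real.pi / 8) = Real.pi / 4 := by ring
  have hinv : (Real.sqrt 2)⁻¹ = Real.sqrt 2 / 2 := by
    have : Real.sqrt 2 * Real.sqrt 2 = 2 := Real.mul_self_sqrt (by norm_num)
    field_simp
    nlinarith
  have h4 : Real.cos (Real.pi / 8) ^ 2 - Real.sin (Real.pi / 8) ^ 2 = (Real.sqrt 2)⁻¹ := by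
    rw [← Real.cos_two_mul', h8, Real.cos_pi_div_four, hinv]
  have h5 : 2 * Real.sin (Real.pi / 8) * Real.cos (Real.pi / 8) = (Real.sqrt 2)⁻¹ := by
    rw [← Real.sin_two_mul, h8, Real.sin_pi_div_four, hinv]
  unfold mixEntry invSqrtTwo
  rw [h1, h2]
  generalize Real.cos (Real.pi / 8) = C at *
  generalize Real.sin (Real.pi / 8) = S at *
  have e3 : (C : ℂ) ^ 2 + (S : ℂ) ^ 2 = 1 := by exact_mod_cast h3
  have hI : Complex.I ^ 2 = -1 := Complex.I_sq
  rw [← h5]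
  have e5 : 2 * (S : ℂ) * C = C ^ 2 - S ^ 2 := by
    have : 2 * S * C = C ^ 2 - S ^ 2 := by rw [h5, h4]
    exact_mod_cast this
  push_cast
  cases y <;> cases y' <;> simp [spin, Complex.conj_ofReal]
  · linear_combination (-a * S ^ 2 + b * S ^ 2) * hI + a * e3 - b * e5
  · ring
  · ring
  · linear_combination (-a * S ^ 2 - b * S ^ 2) * hI + a * e3 + b * e5

/-- The expectation of a product of one-vertex observables in the depth-1 state as a sum over pairs
of spin configurations: `y` stems from the ket, `y'` from the bra. -/
theorem sum_prod_mul_normSq_eq (γ : ℝ) (Δ : Configuration n d) (a b : Fin n → ℂ) :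
    ∑ z, (∏ v, (a v + b v * spin (z v))) *
        ((‖qaoaState (-(Real.pi / 4)) γ Δ z‖ ^ 2 : ℝ) : ℂ) =
      (2 ^ n : ℂ)⁻¹ * ∑ y, ∑ y', (∏ v, (if y v = y' v then a v + b v * spin (y v) * invSqrtTwo
          else b v * (Complex.I * spin (y v) * invSqrtTwo))) *
        Complex.exp (Complex.I / 2 * γ * (isingEnergy Δ y - isingEnergy Δ y')) := by
  have hβ : -(Complex.I / 2) * ((-(Real.pi / 4) : ℝ) : ℂ) = Complex.I * (Real.pi / 8 : ℝ) := by
    push_cast; ring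
  have hconj : ∀ y, (starRingEnd ℂ) (isingEnergy Δ y) = isingEnergy Δ y := by
    intro y
    have : ∀ c : Bool, (starRingEnd ℂ) (spin c) = spin c := by
      intro c; cases c <;> simp [spin]
    have h2 : (starRingEnd ℂ) (2 : ℂ) = 2 := map_ofNat _ 2
    simp [isingEnergy, this, h2]
  have hnorm : ∀ z, ((‖qaoaState (-(Real.pi / 4)) γ Δ z‖ ^ 2 : ℝ) : ℂ) =
      (2 ^ n : ℂ)⁻¹ * ∑ y, ∑ y', (∏ v, (starRingEnd ℂ) (mixEntry (Complex.I * (Real.pi / 8 : ℝ))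
        (z v) (y v)) * mixEntry (Complex.I * (Real.pi / 8 : ℝ)) (z v) (y' v)) *
        Complex.exp (Complex.I / 2 * γ * (isingEnergy Δ y - isingEnergy Δ y')) := by
    intro z
    rw [← Complex.normSq_eq_norm_sq, Complex.normSq_eq_conj_mul_self, qaoaState_apply, hβ,
      map_mul, map_sum, Complex.conj_ofReal]
    have h2 : ((((Real.sqrt 2) ^ n)⁻¹ : ℝ) : ℂ) * ((((Real.sqrt 2) ^ n)⁻¹ : ℝ) : ℂ) =
        (2 ^ n : ℂ)⁻¹ := by
      rw [← Complex.ofReal_mul, ← mul_inv, ← mul_pow, Real.mul_self_sqrt (by norm_num)]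
      push_cast; rfl
    rw [mul_mul_mul_comm, h2, Finset.sum_mul_sum]
    congr 1
    refine sum_congr rfl fun y _ => sum_congr rfl fun y' _ => ?_
    rw [map_mul, map_prod, mul_mul_mul_comm, ← Finset.prod_mul_distrib, ← Complex.exp_conj,
      ← Complex.exp_add]
    congr 2
    simp only [map_mul, map_neg, map_div₀, Complex.conj_I, Complex.conj_ofReal, hconj, map_ofNat]
    ring
  simp only [hnorm]
  have : ∀ z : Bits n, (∏ v, (a v + b v * spin (z v))) * ((2 ^ n : ℂ)⁻¹ * ∑ y : Bits n,
      ∑ y' : Bits n,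
      (∏ v, (starRingEnd ℂ) (mixEntry (Complex.I * (Real.pi / 8 : ℝ))
        (z v) (y v)) * mixEntry (Complex.I * (Real.pi / 8 : ℝ)) (z v) (y' v)) *
        Complex.exp (Complex.I / 2 * γ * (isingEnergy Δ y - isingEnergy Δ y'))) =
      (2 ^ n : ℂ)⁻¹ * ∑ y : Bits n, ∑ y' : Bits n,
      (∏ v, ((a v + b v * spin (z v)) * ((starRingEnd ℂ) (mixEntry (Complex.I * (Real.pi / 8 : ℝ))
        (z v) (y v)) * mixEntry (Complex.I * (Real.pi / 8 : ℝ)) (z v) (y' v)))) *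
        Complex.exp (Complex.I / 2 * γ * (isingEnergy Δ y - isingEnergy Δ y')) := by
    intro z
    rw [mul_left_comm, Finset.mul_sum]
    congr 1
    refine sum_congr rfl fun y _ => ?_
    rw [Finset.mul_sum]
    refine sum_congr rfl fun y' _ => ?_
    rw [← mul_assoc, ← Finset.prod_mul_distrib]
  simp only [this]
  rw [← Finset.mul_sum, Finset.sum_comm]
  congr 1
  refine sum_congr rfl fun y _ => ?_
  rw [Finset.sum_comm]
  refine sum_congr rfl fun y' _ => ?_
  rw [← Finset.sum_mul]
  congr 1
  have h := Finset.prod_univ_sum (fun _ : Fin n => (univ : Finset Bool)) (fun v z =>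
    (a v + b v * spin z) * ((starRingEnd ℂ) (mixEntry (Complex.I * (Real.pi / 8 : ℝ))
        z (y v)) * mixEntry (Complex.I * (Real.pi / 8 : ℝ)) z (y' v)))
  rw [Fintype.piFinset_univ] at h
  rw [← h]
  exact prod_congr rfl fun v _ => sum_mixEntry _ _ _ _

/-- The expectation of a product of one-vertex observables that are trivial outside `M` is an
average over pairs of spin configurations that agree outside `M`. -/
theorem sum_prod_mul_normSq (γ : ℝ) (Δ : Configuration n d) (a b : Fin n → ℂ) (M : Finset (Fin n))
    (ha : ∀ v ∉ M, a v = 1) (hb : ∀ v ∉ M, b v = 0) :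
    ∑ z, (∏ v, (a v + b v * spin (z v))) *
        ((‖qaoaState (-(Real.pi / 4)) γ Δ z‖ ^ 2 : ℝ) : ℂ) =
      𝔼 p : Fin n → Bool × Bool, (∏ v ∈ M, vertexWeight (a v) (b v) (p v)) *
        Complex.exp (Complex.I / 4 * γ *
          ∑ x : HalfEdge n d, edgeAction M p x.1 (Δ.target x)) := by
  rw [sum_prod_mul_normSq_eq]
  -- pass from the second configuration to the set of vertices at which it differs
  have h1 : ∀ y : Bits n, ∑ y', (∏ v, (if y v = y' v then a v + b v * spin (y v) * invSqrtTwo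
          else b v * (Complex.I * spin (y v) * invSqrtTwo))) *
        Complex.exp (Complex.I / 2 * γ * (isingEnergy Δ y - isingEnergy Δ y')) =
      𝔼 f : Fin n → Bool, ((∏ v ∈ M, vertexWeight (a v) (b v) (y v, f v)) *
        Complex.exp (Complex.I / 4 * γ * ∑ x : HalfEdge n d,
          edgeAction M (fun v => (y v, f v)) x.1 (Δ.target x))) := by
    intro y
    have hdep : 𝔼 f : Fin n → Bool, ((∏ v ∈ M, vertexWeight (a v) (b v) (y v, f v)) *
        Complex.exp (Complex.I / 4 * γ * ∑ x : HalfEdge n d,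
          edgeAction M (fun v => (y v, f v)) x.1 (Δ.target x))) *
          ∏ v ∈ Mᶜ, (if f v then (0 : ℂ) else 2) =
        𝔼 f : Fin n → Bool, ((∏ v ∈ M, vertexWeight (a v) (b v) (y v, f v)) *
        Complex.exp (Complex.I / 4 * γ * ∑ x : HalfEdge n d,
          edgeAction M (fun v => (y v, f v)) x.1 (Δ.target x))) := by
      rw [expect_mul_of_dependsOn (A := (M : Set (Fin n))) (B := (M : Set (Fin n))ᶜ)
        disjoint_compl_right]
      · rw [expect_prod_of_dependsOn Mᶜ (fun v => {v})
          (fun v (f : Fin n → Bool) => if f v then (0 : ℂ) else 2)]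
        · have : ∀ v ∈ Mᶜ, 𝔼 f : Fin n → Bool, (if f v then (0 : ℂ) else 2) = 1 := by
            intro v _
            rw [expect_single v (fun c : Bool => if c then (0 : ℂ) else 2),
              Fintype.expect_eq_sum_div_card]
            simp
          rw [prod_congr rfl this]
          simp
        · intro k _ k' _ hkk
          simpa using hkk
        · intro k _ f g hfg
          simp [hfg k rfl]
      · intro f g hfg
        have h1 : ∀ v, secondSpin M (fun v => (y v, f v)) v =
            secondSpin M (fun v => (y v, g v)) v := by
          intro v
          unfold secondSpin
          by_cases hv : v ∈ M
          · simp [hfg v hv]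
          · simp [hv]
        simp only [edgeAction, h1]
        congr 1
        refine prod_congr rfl fun v hv => ?_
        rw [hfg v hv]
      · intro f g hfg
        refine prod_congr rfl fun v hv => ?_
        rw [hfg v (by simpa using hv)]
    rw [← hdep, Fintype.expect_eq_sum_div_card]
    have hcard : (Fintype.card (Fin n → Bool) : ℂ) = 2 ^ n := by simp
    rw [hcard, eq_div_iff (pow_ne_zero _ two_ne_zero), Finset.sum_mul]
    have hinv : Function.Involutive (fun y' : Bits n => fun v => xor (y v) (y' v)) := by
      intro y'; funext v; simp
    refine Fintype.sum_equiv hinv.toPerm _ _ fun y' => ?_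
    change _ = (∏ v ∈ M, vertexWeight (a v) (b v) (y v, xor (y v) (y' v))) *
        Complex.exp (Complex.I / 4 * γ * ∑ x : HalfEdge n d,
          edgeAction M (fun v => (y v, xor (y v) (y' v))) x.1 (Δ.target x)) *
          ∏ v ∈ Mᶜ, (if (xor (y v) (y' v)) then (0 : ℂ) else 2)
    by_cases hy : ∀ v ∉ M, y v = y' v
    · have hs : ∀ v, secondSpin M (fun v => (y v, xor (y v) (y' v))) v = spin (y' v) := by
        intro v
        unfold secondSpin
        by_cases hv : v ∈ M
        · cases h1 : y v <;> cases h2 : y' v <;> simp [hv, spin, h1, h2]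
        · simp [hv, hy v hv]
      have hE : Complex.I / 4 * γ * ∑ x : HalfEdge n d,
          edgeAction M (fun v => (y v, xor (y v) (y' v))) x.1 (Δ.target x) =
          Complex.I / 2 * γ * (isingEnergy Δ y - isingEnergy Δ y') := by
        simp only [edgeAction, hs, isingEnergy, Finset.sum_sub_distrib]
        ring
      rw [hE, mul_right_comm, mul_right_comm _ (Complex.exp _)]
      congr 1
      have h2 : (2 : ℂ) ^ n = ∏ _v : Fin n, 2 := by simp
      rw [h2, ← Finset.prod_mul_distrib, ← Finset.prod_mul_prod_compl M]
      congr 1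
      · refine prod_congr rfl fun v _ => ?_
        unfold vertexWeight
        cases h1 : y v <;> cases h2 : y' v <;> simp <;> ring
      · refine prod_congr rfl fun v hv => ?_
        have hv : v ∉ M := by simpa using hv
        simp [hy v hv, ha v hv, hb v hv]
    · push Not at hy
      obtain ⟨v, hv, hvy⟩ := hy
      rw [Finset.prod_eq_zero (mem_univ v), Finset.prod_eq_zero (i := v) (s := Mᶜ)]
      · simp
      · simpa using hv
      · cases h1 : y v <;> cases h2 : y' v <;> simp_all
      · simp [hvy, hb v hv]
  simp only [h1]
  have hcard : (Fintype.card (Bits n) : ℂ) = 2 ^ n := by simp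
  rw [← hcard, inv_mul_eq_div, ← Fintype.expect_eq_sum_div_card, ← Finset.expect_product
    (f := fun q : Bits n × (Fin n → Bool) => (∏ v ∈ M, vertexWeight (a v) (b v) (q.1 v, q.2 v)) *
        Complex.exp (Complex.I / 4 * γ * ∑ x : HalfEdge n d,
          edgeAction M (fun v => (q.1 v, q.2 v)) x.1 (Δ.target x))), univ_product_univ]
  exact Fintype.expect_equiv (Equiv.arrowProdEquivProdArrow _ _ _).symm _ _ fun q => rfl

/-! ### Stars of a 2-independent set -/

theorem Configuration.target_apply (Δ : Configuration n d) (x : HalfEdge n d) :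
    Δ.target (Δ.1 x) = x.1 := by
  unfold Configuration.target
  rw [Δ.2.1 x]

/-- A set is separated if the stars of its vertices (a vertex with its neighbours) are pairwise
disjoint, stated in terms of half-edges. -/
def IsSeparated (Δ : Configuration n d) (V₀ : Finset (Fin n)) : Prop :=
  (∀ x : HalfEdge n d, x.1 ∈ V₀ → Δ.target x ∈ V₀ → Δ.target x = x.1) ∧
    ∀ x y : HalfEdge n d, x.1 ∈ V₀ → y.1 ∈ V₀ → Δ.target x = Δ.target y → x.1 = y.1

theorem graph_adj_iff (Δ : Configuration n d) (u w : Fin n) :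
    Δ.graph.Adj u w ↔ u ≠ w ∧ ∃ j, Δ.target (u, j) = w := by
  unfold Configuration.graph Configuration.target
  rw [SimpleGraph.fromRel_adj]
  refine and_congr_right fun _ => ⟨?_, ?_⟩
  · rintro (⟨j, j', h⟩ | ⟨j, j', h⟩)
    · exact ⟨j, by rw [h]⟩
    · exact ⟨j', by rw [← h, Δ.2.1]⟩
  · rintro ⟨j, h⟩
    exact Or.inl ⟨j, (Δ.1 (u, j)).2, by rw [← h]⟩

theorem isKIndependent_two_iff (Δ : Configuration n d) (V₀ : Finset (Fin n)) :
    IsKIndependent Δ.graph 2 V₀ ↔ IsSeparated Δ V₀ := by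
  have hadj : ∀ x : HalfEdge n d, x.1 ≠ Δ.target x → Δ.graph.Adj x.1 (Δ.target x) :=
    fun x hx => (graph_adj_iff _ _ _).2 ⟨hx, x.2, rfl⟩
  constructor
  · intro h
    have h1 : ∀ x : HalfEdge n d, x.1 ∈ V₀ → Δ.target x ∈ V₀ → Δ.target x = x.1 := by
      intro x hx hx'
      by_contra hne
      have h2 := h _ hx _ hx' (Ne.symm hne)
      have h3 := (SimpleGraph.Walk.cons (hadj x (Ne.symm hne)) SimpleGraph.Walk.nil).edist_le
      have := h2.trans h3
      simp at this
    refine ⟨h1, fun x y hx hy hxy => ?_⟩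
    by_contra hne
    by_cases hx' : x.1 = Δ.target x
    · exact hne (by rw [← h1 y hy (by rw [← hxy, ← hx']; exact hx), ← hxy, ← hx'])
    by_cases hy' : y.1 = Δ.target y
    · exact hne (by rw [← h1 x hx (by rw [hxy, ← hy']; exact hy), hxy, ← hy'])
    have h2 := h _ hx _ hy hne
    have h3 := (SimpleGraph.Walk.cons (hadj x hx') (SimpleGraph.Walk.cons
      (hxy ▸ (hadj y hy').symm) SimpleGraph.Walk.nil)).edist_le
    have := h2.trans h3
    simp at this
    exact absurd this (by decide)
  · intro h v hv w hw hvw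
    by_contra hlt
    rw [not_le] at hlt
    have hr : Δ.graph.Reachable v w := by
      rw [← SimpleGraph.edist_ne_top_iff_reachable]
      exact ne_top_of_lt hlt
    obtain ⟨p, hp⟩ := hr.exists_walk_length_eq_edist
    rw [← hp] at hlt
    have hlt : p.length < 3 := by exact_mod_cast hlt
    match p, hlt with
    | .nil, _ => exact hvw rfl
    | .cons hab .nil, _ =>
      obtain ⟨_, j, hj⟩ := (graph_adj_iff _ _ _).1 hab
      exact hvw ((h.1 (v, j) hv (hj.symm ▸ hw)).symm.trans hj)
    | .cons hab (.cons hbc .nil), _ =>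
      obtain ⟨_, j, hj⟩ := (graph_adj_iff _ _ _).1 hab
      obtain ⟨_, j', hj'⟩ := (graph_adj_iff _ _ _).1 hbc.symm
      exact hvw (h.2 (v, j) (w, j') hv hw (hj.trans hj'.symm))
    | .cons _ (.cons _ (.cons _ q)), hlt =>
      simp only [SimpleGraph.Walk.length_cons] at hlt
      omega

/-! ### The weight of an edge -/

theorem secondSpin_mul_self (M : Finset (Fin n)) (p : Fin n → Bool × Bool) (v : Fin n) :
    secondSpin M p v * secondSpin M p v = 1 := by
  unfold secondSpin
  split_ifs <;> simp [spin_mul_self]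

theorem edgeAction_comm (M : Finset (Fin n)) (p : Fin n → Bool × Bool) (u w : Fin n) :
    edgeAction M p u w = edgeAction M p w u := by
  unfold edgeAction; ring

theorem edgeAction_self (M : Finset (Fin n)) (p : Fin n → Bool × Bool) (u : Fin n) :
    edgeAction M p u u = 0 := by
  rw [edgeAction, secondSpin_mul_self, spin_mul_self, sub_self]

/-- The phase of an edge whose ends carry the spins `y` and `y'`, exactly one of which is
flipped. -/
def edgePhase (γ : ℝ) (y y' : Bool) : ℂ :=
  (Real.cos γ : ℂ) + Complex.I * (Real.sin γ : ℂ) * (spin y * spin y')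

theorem exp_edgeAction (γ : ℝ) (M : Finset (Fin n)) (p : Fin n → Bool × Bool) (u w : Fin n) :
    Complex.exp (Complex.I / 2 * γ * edgeAction M p u w) =
      if (u ∈ M ∧ (p u).2 = true) ↔ (w ∈ M ∧ (p w).2 = true) then 1
      else edgePhase γ (p u).1 (p w).1 := by
  have key : ∀ y y' : Bool, Complex.exp (Complex.I / 2 * γ * (2 * (spin y * spin y'))) =
      edgePhase γ y y' := by
    intro y y'
    have h1 : Complex.exp (Complex.I * γ) = Real.cos γ + Complex.I * Real.sin γ := by
      rw [mul_comm, Complex.exp_mul_I, Complex.ofReal_cos, Complex.ofReal_sin]; ring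
    have h2 : Complex.exp (-(Complex.I * γ)) = Real.cos γ - Complex.I * Real.sin γ := by
      rw [mul_comm, ← neg_mul, Complex.exp_mul_I, Complex.ofReal_cos, Complex.ofReal_sin,
        Complex.cos_neg, Complex.sin_neg]; ring
    have h3 : ∀ e : ℂ, Complex.I / 2 * γ * (2 * e) = Complex.I * γ * e := by intro e; ring
    rw [h3, edgePhase]
    cases y <;> cases y' <;> simp [spin, h1, h2] <;> ring
  unfold edgeAction secondSpin
  by_cases hu : u ∈ M ∧ (p u).2 = true <;> by_cases hw : w ∈ M ∧ (p w).2 = true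
  · simp only [hu, hw, and_self, if_true]
    rw [neg_mul_neg, sub_self]; simp
  · rw [if_pos hu, if_neg hw, if_neg (by tauto), ← key]
    congr 1; ring
  · rw [if_neg hu, if_pos hw, if_neg (by tauto), ← key]
    congr 1; ring
  · rw [if_neg hu, if_neg hw, if_pos (by tauto), sub_self]; simp

/-- The edges at a separated set are told from the other ones: every edge at a star is counted
once at its centre. -/
theorem sum_edgeAction_eq (Δ : Configuration n d) {V₀ : Finset (Fin n)} (hS : IsSeparated Δ V₀)
    (M : Finset (Fin n)) (p : Fin n → Bool × Bool) :
    ∑ x : HalfEdge n d, edgeAction M p x.1 (Δ.target x) =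
      2 * (∑ x : HalfEdge n d with x.1 ∈ V₀, edgeAction M p x.1 (Δ.target x)) +
        ∑ x : HalfEdge n d with x.1 ∉ V₀ ∧ Δ.target x ∉ V₀,
          edgeAction M p x.1 (Δ.target x) := by
  rw [← Finset.sum_filter_add_sum_filter_not univ (fun x : HalfEdge n d => x.1 ∈ V₀),
    ← Finset.sum_filter_add_sum_filter_not (univ.filter fun x : HalfEdge n d => x.1 ∉ V₀)
      (fun x : HalfEdge n d => Δ.target x ∈ V₀), Finset.filter_filter, Finset.filter_filter,
      two_mul, add_assoc]
  congr 2
  have h1 : ∑ x : HalfEdge n d with x.1 ∈ V₀, edgeAction M p x.1 (Δ.target x) =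
      ∑ x : HalfEdge n d with x.1 ∈ V₀ ∧ Δ.target x ∉ V₀, edgeAction M p x.1 (Δ.target x) := by
    rw [← Finset.filter_filter]
    symm
    apply Finset.sum_filter_of_ne
    intro x hx hne hx'
    refine hne ?_
    rw [hS.1 x (by simpa using hx) hx', edgeAction_self]
  rw [h1]
  refine Finset.sum_nbij' (fun x => Δ.1 x) (fun x => Δ.1 x) ?_ ?_ ?_ ?_ ?_
  · intro x hx
    simp only [mem_filter, mem_univ, true_and, Δ.target_apply] at hx ⊢
    exact ⟨hx.2, hx.1⟩
  · intro x hx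
    simp only [mem_filter, mem_univ, true_and, Δ.target_apply] at hx ⊢
    exact ⟨hx.2, hx.1⟩
  · intro x _; exact Δ.2.1 x
  · intro x _; exact Δ.2.1 x
  · intro x _
    rw [Δ.target_apply, edgeAction_comm]
    rfl

/-! ### Messages of the stars -/

/-- The joint weight of a vertex `v` that carries the observable `1 + a Z` and of the edges
at it. -/
def starWeight (γ : ℝ) (Δ : Configuration n d) (M : Finset (Fin n)) (a : ℂ) (v : Fin n)
    (p : Fin n → Bool × Bool) : ℂ :=
  vertexWeight 1 a (p v) *
    ∏ j : Fin d, Complex.exp (Complex.I / 2 * γ * edgeAction M p v (Δ.target (v, j)))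

theorem secondSpin_congr {M : Finset (Fin n)} {p q : Fin n → Bool × Bool} {v : Fin n}
    (h : p v = q v) : secondSpin M p v = secondSpin M q v := by
  unfold secondSpin; rw [h]

theorem edgeAction_congr {M : Finset (Fin n)} {p q : Fin n → Bool × Bool} {u w : Fin n}
    (hu : p u = q u) (hw : p w = q w) : edgeAction M p u w = edgeAction M q u w := by
  unfold edgeAction; rw [secondSpin_congr hu, secondSpin_congr hw, hu, hw]

/-- The star of `v` as a set of vertices. -/
def star (Δ : Configuration n d) (v : Fin n) : Set (Fin n) :=
  {u | u = v ∨ ∃ j, Δ.target (v, j) = u}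

theorem dependsOn_starWeight (γ : ℝ) (Δ : Configuration n d) (M : Finset (Fin n)) (a : ℂ)
    (v : Fin n) : DependsOn (starWeight γ Δ M a v) (star Δ v) := by
  intro p q h
  have hv : p v = q v := h v (Or.inl rfl)
  unfold starWeight
  rw [hv]
  congr 1
  refine prod_congr rfl fun j _ => ?_
  rw [edgeAction_congr hv (h _ (Or.inr ⟨j, rfl⟩))]

theorem expect_vertexWeight_one_zero : 𝔼 b, vertexWeight 1 0 b = 1 := by
  rw [Fintype.expect_eq_sum_div_card, Fintype.sum_prod_type]
  simp [vertexWeight]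
  norm_num

/-- A star that is only observed at its centre has weight `1`: its part that is linear in the
observable is odd under a global spin flip. -/
theorem expect_starWeight (γ : ℝ) (Δ : Configuration n d) (M : Finset (Fin n)) (a : ℂ)
    (v : Fin n) (hM : ∀ j, Δ.target (v, j) ∈ M → Δ.target (v, j) = v) :
    𝔼 p, starWeight γ Δ M a v p = 1 := by
  have hsplit : ∀ p, starWeight γ Δ M a v p = vertexWeight 1 0 (p v) +
      a * (vertexWeight 0 1 (p v) *
        ∏ j : Fin d, Complex.exp (Complex.I / 2 * γ * edgeAction M p v (Δ.target (v, j)))) := by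
    intro p
    unfold starWeight
    by_cases hf : (p v).2 = true
    · simp only [vertexWeight, hf, if_true]; ring
    · have : ∀ j, Complex.exp (Complex.I / 2 * γ * edgeAction M p v (Δ.target (v, j))) = 1 := by
        intro j
        rw [exp_edgeAction, if_pos]
        refine ⟨fun h => absurd h.2 hf, fun h => absurd h.2 ?_⟩
        rwa [hM j h.1]
      simp only [this, prod_const_one, vertexWeight, hf]
      simp; ring
  simp only [hsplit, Finset.expect_add_distrib]
  rw [expect_single v, expect_vertexWeight_one_zero, ← Finset.mul_expect]
  have hodd : 𝔼 p : Fin n → Bool × Bool, (vertexWeight 0 1 (p v) *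
        ∏ j : Fin d, Complex.exp (Complex.I / 2 * γ * edgeAction M p v (Δ.target (v, j)))) =
      𝔼 p : Fin n → Bool × Bool, -(vertexWeight 0 1 (p v) *
        ∏ j : Fin d, Complex.exp (Complex.I / 2 * γ * edgeAction M p v (Δ.target (v, j)))) := by
    have hinv : Function.Involutive
        (fun p : Fin n → Bool × Bool => fun u => (!(p u).1, (p u).2)) := by
      intro p; funext u; simp
    refine Fintype.expect_equiv hinv.toPerm _ _ fun p => ?_
    change _ = -(vertexWeight 0 1 (!(p v).1, (p v).2) *
      ∏ j : Fin d, Complex.exp (Complex.I / 2 * γ *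
      edgeAction M (fun u => (!(p u).1, (p u).2)) v (Δ.target (v, j))))
    have hs : ∀ b, spin (!b) = - spin b := by intro b; cases b <;> simp [spin]
    have h1 : ∀ u w, edgeAction M (fun u => (!(p u).1, (p u).2)) u w = edgeAction M p u w := by
      intro u w
      have h2 : ∀ u, secondSpin M (fun u => (!(p u).1, (p u).2)) u = - secondSpin M p u := by
        intro u; unfold secondSpin; simp only [hs]; split_ifs <;> ring
      simp only [edgeAction, h2, hs]; ring
    simp only [h1, vertexWeight, hs]
    split_ifs <;> ring
  rw [Finset.expect_neg_distrib, eq_neg_iff_add_eq_zero, ← two_mul] at hodd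
  rw [(mul_eq_zero.1 hodd).resolve_left two_ne_zero, mul_zero, add_zero]

/-- The bias that a star of degree 3 whose centre is measured gives to one of its leaves. -/
def starBias (γ : ℝ) : ℂ := -((Real.sin γ : ℂ) * (Real.cos γ : ℂ) ^ 2 * invSqrtTwo)

/-- The message sent to a leaf by the centre of its star, if the centre carries the observable
`1 + a Z`; `q` tells whether the leaf is observed, and `b` is its pair of spins. -/
def message (γ : ℝ) (a : ℂ) (q : Prop) [Decidable q] (b : Bool × Bool) : ℂ :=
  if q ∧ b.2 = true then
    (Real.cos γ : ℂ) + Complex.I * ((Real.sin γ : ℂ) * a * invSqrtTwo) * spin b.1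
  else 1 + starBias γ * a * spin b.1

theorem expect_edgePhase (γ : ℝ) (y : Bool) :
    𝔼 q : Bool × Bool, edgePhase γ y q.1 = Real.cos γ := by
  rw [Fintype.expect_eq_sum_div_card, Fintype.sum_prod_type]
  simp [edgePhase, spin]
  ring

theorem prod_fin_three {R : Type} [CommMonoid R] (f : Fin 3 → R) (j : Fin 3) :
    ∏ i, f i = f j * (f (j + 1) * f (j + 2)) := by
  rw [Fin.prod_univ_three, mul_assoc]
  fin_cases j
  · rfl
  · exact mul_rotate' _ _ _
  · exact (mul_rotate' _ _ _).trans (mul_rotate' _ _ _)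

/-- Summation over the centre and the other leaves of a regular star of which the leaf `j` is kept
fixed. -/
theorem expect_starWeight_leaf (γ : ℝ) (Δ : Configuration n 3) (M L : Finset (Fin n)) (a : ℂ)
    (v : Fin n) (j : Fin 3) (hv : v ∈ M) (hvL : v ∉ L)
    (hinj : Function.Injective fun i => Δ.target (v, i))
    (hne : ∀ i, Δ.target (v, i) ≠ v) (hj : Δ.target (v, j) ∈ L)
    (hM : ∀ i, i ≠ j → Δ.target (v, i) ∉ M) (hL : ∀ i, i ≠ j → Δ.target (v, i) ∉ L)
    (l : Fin n → Bool × Bool) :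
    𝔼 p, starWeight γ Δ M a v (L.piecewise l p) =
      message γ a (Δ.target (v, j) ∈ M) (l (Δ.target (v, j))) := by
  have hj1 : j + 1 ≠ j := by fin_cases j <;> decide
  have hj2 : j + 2 ≠ j := by fin_cases j <;> decide
  have hj12 : j + 1 ≠ j + 2 := by fin_cases j <;> decide
  set E : Fin 3 → (Bool × Bool) → (Bool × Bool) → ℂ := fun i b q =>
    if b.2 = true then edgePhase γ b.1 q.1 else 1 with hE
  set H : Bool × Bool → ℂ := fun b => vertexWeight 1 a b *
    (if b.2 = true ↔ (Δ.target (v, j) ∈ M ∧ (l (Δ.target (v, j))).2 = true) then 1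
      else edgePhase γ b.1 (l (Δ.target (v, j))).1) with hH
  have hexp : ∀ p, starWeight γ Δ M a v (L.piecewise l p) =
      H (p v) * (E (j + 1) (p v) (p (Δ.target (v, j + 1))) *
        E (j + 2) (p v) (p (Δ.target (v, j + 2)))) := by
    intro p
    unfold starWeight
    rw [prod_fin_three _ j]
    simp only [exp_edgeAction, hv, true_and, Finset.piecewise_eq_of_notMem _ _ _ hvL,
      Finset.piecewise_eq_of_mem _ _ _ hj, Finset.piecewise_eq_of_notMem _ _ _ (hL _ hj1),
      Finset.piecewise_eq_of_notMem _ _ _ (hL _ hj2), hM _ hj1, hM _ hj2, false_and, iff_false, hE,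
      hH]
    split_ifs <;> simp_all [mul_assoc]
  simp only [hexp]
  rw [expect_piecewise {v}]
  have hin : ∀ m : Fin n → Bool × Bool, (𝔼 p : Fin n → Bool × Bool,
      H (({v} : Finset (Fin n)).piecewise m p v) *
        (E (j + 1) (({v} : Finset (Fin n)).piecewise m p v)
          (({v} : Finset (Fin n)).piecewise m p (Δ.target (v, j + 1))) *
        E (j + 2) (({v} : Finset (Fin n)).piecewise m p v)
          (({v} : Finset (Fin n)).piecewise m p (Δ.target (v, j + 2))))) =
      H (m v) * (if (m v).2 = true then (Real.cos γ : ℂ) ^ 2 else 1) := by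
    intro m
    simp only [Finset.piecewise_singleton, Function.update_self, Function.update_of_ne (hne _)]
    rw [← Finset.mul_expect]
    congr 1
    rw [expect_pair (fun h => hj12 (hinj h)) (fun x y => E (j + 1) (m v) x * E (j + 2) (m v) y)]
    simp only [← Finset.mul_expect, ← Finset.expect_mul]
    by_cases hf : (m v).2 = true
    · simp only [hE, hf, if_true, expect_edgePhase]; ring
    · simp [hE, hf]
  simp only [hin]
  rw [expect_single v (fun b => H b * (if b.2 = true then (Real.cos γ : ℂ) ^ 2 else 1)),
    Fintype.expect_eq_sum_div_card, Fintype.sum_prod_type]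
  simp only [hH, message, vertexWeight, edgePhase, starBias, Fintype.sum_bool]
  have hI : Complex.I ^ 2 = -1 := Complex.I_sq
  by_cases hq : Δ.target (v, j) ∈ M ∧ (l (Δ.target (v, j))).2 = true
  · simp [hq, spin]
    cases (l (Δ.target (v, j))).1 <;> simp <;> ring
  · simp [hq, spin]
    cases (l (Δ.target (v, j))).1 <;> simp
    · ring_nf
      rw [hI]; ring
    · ring_nf
      rw [hI]; ring

/-- Summation over the states of all stars, with the vertices of `L` fixed: what remains of a star
that meets `L` is its message. -/
theorem expect_mul_prod_starWeight (γ : ℝ) (Δ : Configuration n 3) {V₀ : Finset (Fin n)}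
    (hS : IsSeparated Δ V₀) (Q L : Finset (Fin n)) (hQL : Q ⊆ L) (hLV : Disjoint L V₀)
    (ς : Fin n → ℂ)
    (hone : ∀ x y : HalfEdge n 3, x.1 ∈ V₀ → x.1 = y.1 → Δ.target x ∈ L → Δ.target y ∈ L → x = y)
    (hreg : ∀ x : HalfEdge n 3, x.1 ∈ V₀ → Δ.target x ∈ L →
      (Function.Injective fun i => Δ.target (x.1, i)) ∧ ∀ i, Δ.target (x.1, i) ≠ x.1)
    (A : (Fin n → Bool × Bool) → ℂ) (hA : DependsOn A (L : Set (Fin n))) :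
    𝔼 p, A p * ∏ v ∈ V₀, starWeight γ Δ (V₀ ∪ Q) (ς v) v p =
      𝔼 l, A l * ∏ x : HalfEdge n 3 with x.1 ∈ V₀ ∧ Δ.target x ∈ L,
        message γ (ς x.1) (Δ.target x ∈ Q) (l (Δ.target x)) := by
  have hleaf : ∀ x : HalfEdge n 3, x.1 ∈ V₀ → Δ.target x ∈ V₀ ∪ Q → Δ.target x ∉ Q →
      Δ.target x = x.1 := by
    intro x hx h1 h2
    exact hS.1 x hx ((mem_union.1 h1).resolve_right h2)
  rw [expect_piecewise L]
  refine Finset.expect_congr rfl fun l _ => ?_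
  have h1 : ∀ p, A (L.piecewise l p) = A l := fun p => hA fun v hv => by
    simp [Finset.mem_coe.1 hv]
  simp only [h1]
  rw [← Finset.mul_expect]
  congr 1
  rw [expect_prod_of_dependsOn V₀ (fun v => star Δ v \ L)
    (fun v p => starWeight γ Δ (V₀ ∪ Q) (ς v) v (L.piecewise l p))]
  · have hprod : ∏ x : HalfEdge n 3 with x.1 ∈ V₀ ∧ Δ.target x ∈ L,
        message γ (ς x.1) (Δ.target x ∈ Q) (l (Δ.target x)) =
        ∏ v ∈ V₀, ∏ j : Fin 3, if Δ.target (v, j) ∈ L then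
          message γ (ς v) (Δ.target (v, j) ∈ Q) (l (Δ.target (v, j))) else 1 := by
      rw [← Finset.filter_filter, Finset.prod_filter]
      have : (univ.filter fun x : HalfEdge n 3 => x.1 ∈ V₀) = V₀ ×ˢ univ := by
        ext x; simp
      rw [this, Finset.prod_product]
    rw [hprod]
    refine prod_congr rfl fun v hv => ?_
    by_cases hex : ∃ j, Δ.target (v, j) ∈ L
    · obtain ⟨j, hj⟩ := hex
      have hij : ∀ i, i ≠ j → Δ.target (v, i) ∉ L := fun i hi h =>
        hi (Prod.ext_iff.1 (hone (v, i) (v, j) hv rfl h hj)).2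
      obtain ⟨hinj, hne⟩ := hreg (v, j) hv hj
      rw [expect_starWeight_leaf γ Δ _ L (ς v) v j (mem_union_left _ hv)
        (fun h => Finset.disjoint_left.1 hLV h hv) hinj hne hj
        (fun i hi h => hne i (hleaf (v, i) hv h fun h' => hij i hi (hQL h'))) hij l,
        Finset.prod_eq_single j (fun i _ hi => if_neg (hij i hi)) (by simp), if_pos hj]
      unfold message
      have : Δ.target (v, j) ∈ V₀ ∪ Q ↔ Δ.target (v, j) ∈ Q := by
        rw [mem_union]
        exact ⟨fun h => h.resolve_left fun h' => Finset.disjoint_left.1 hLV hj h', Or.inr⟩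
      simp only [this]
    · push Not at hex
      have h2 : ∀ p, starWeight γ Δ (V₀ ∪ Q) (ς v) v (L.piecewise l p) =
          starWeight γ Δ (V₀ ∪ Q) (ς v) v p := by
        intro p
        refine dependsOn_starWeight _ _ _ _ _ fun u hu => ?_
        rcases hu with rfl | ⟨j, rfl⟩
        · exact Finset.piecewise_eq_of_notMem _ _ _ fun h => Finset.disjoint_left.1 hLV h hv
        · exact Finset.piecewise_eq_of_notMem _ _ _ (hex j)
      simp only [h2]
      rw [expect_starWeight _ _ _ _ _ fun j h => hleaf (v, j) hv h fun h' => hex j (hQL h')]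
      simp [hex]
  · intro v hv w hw hvw
    refine Set.disjoint_left.2 fun u hu hu' => hvw ?_
    rcases hu.1 with rfl | ⟨j, rfl⟩ <;> rcases hu'.1 with h | ⟨j', h⟩
    · exact h
    · exact h.symm.trans (hS.1 (w, j') hw (h ▸ hv))
    · exact (hS.1 (v, j) hv (h ▸ hw)).symm.trans h
    · exact (hS.2 (v, j) (w, j') hv hw h.symm)
  · intro v hv p q hpq
    refine dependsOn_starWeight _ _ _ _ _ fun u hu => ?_
    by_cases huL : u ∈ L
    · simp [huL]
    · simp [huL, hpq u ⟨hu, huL⟩]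

/-! ### Correlations at treelike vertices -/

/-- The expectation of `∏_{u ∈ Q} Z_u ∏_{v ∈ V₀} (1 + ς_v Z_v)`. For `ς = 0` this is the correlation
of the spins in `Q`, and for a sign vector `ς` it is this correlation after postselection on `ς`. -/
def correlation (γ : ℝ) (Δ : Configuration n d) (V₀ Q : Finset (Fin n)) (ς : Fin n → ℂ) : ℂ :=
  ∑ z, (∏ u ∈ Q, spin (z u)) * (∏ v ∈ V₀, (1 + ς v * spin (z v))) *
    ((‖qaoaState (-(Real.pi / 4)) γ Δ z‖ ^ 2 : ℝ) : ℂ)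

/-- The stars of a separated set are disjoint, so a correlation is an average of a product over the
stars, up to the factors of `Q` and of the edges that do not meet `V₀`. -/
theorem correlation_eq (γ : ℝ) (Δ : Configuration n d) {V₀ Q : Finset (Fin n)}
    (hS : IsSeparated Δ V₀) (hQ : Disjoint Q V₀) (ς : Fin n → ℂ) :
    correlation γ Δ V₀ Q ς = 𝔼 p : Fin n → Bool × Bool,
      ((∏ u ∈ Q, vertexWeight 0 1 (p u)) * Complex.exp (Complex.I / 4 * γ *
        ∑ x : HalfEdge n d with x.1 ∉ V₀ ∧ Δ.target x ∉ V₀,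
          edgeAction (V₀ ∪ Q) p x.1 (Δ.target x))) *
      ∏ v ∈ V₀, starWeight γ Δ (V₀ ∪ Q) (ς v) v p := by
  classical
  have hQ' : ∀ v ∈ Q, v ∉ V₀ := fun v h => Finset.disjoint_left.1 hQ h
  have h := sum_prod_mul_normSq γ Δ (fun v => if v ∈ Q then 0 else 1)
    (fun v => if v ∈ Q then 1 else if v ∈ V₀ then ς v else 0) (V₀ ∪ Q)
    (fun v hv => by rw [mem_union, not_or] at hv; simp [hv.2])
    (fun v hv => by rw [mem_union, not_or] at hv; simp [hv.2, hv.1])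
  have hl : ∀ z : Bits n, (∏ v, ((if v ∈ Q then (0 : ℂ) else 1) +
      (if v ∈ Q then (1 : ℂ) else if v ∈ V₀ then ς v else 0) * spin (z v))) =
      (∏ u ∈ Q, spin (z u)) * (∏ v ∈ V₀, (1 + ς v * spin (z v))) := by
    intro z
    rw [← Finset.prod_subset (subset_univ (Q ∪ V₀)), Finset.prod_union hQ]
    · congr 1
      · exact prod_congr rfl fun v hv => by simp [hv]
      · exact prod_congr rfl fun v hv => by
          have : v ∉ Q := fun h => hQ' v h hv
          simp [hv, this]
    · intro v _ hv
      rw [mem_union, not_or] at hv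
      simp [hv.1, hv.2]
  simp only [hl] at h
  rw [correlation, h]
  refine Finset.expect_congr rfl fun p _ => ?_
  unfold starWeight
  rw [Finset.prod_mul_distrib, Finset.prod_union hQ.symm, sum_edgeAction_eq Δ hS, mul_add,
    Complex.exp_add]
  have h1 : Complex.exp (Complex.I / 4 * γ * (2 * ∑ x : HalfEdge n d with x.1 ∈ V₀,
      edgeAction (V₀ ∪ Q) p x.1 (Δ.target x))) = ∏ v ∈ V₀, ∏ j : Fin d,
        Complex.exp (Complex.I / 2 * γ * edgeAction (V₀ ∪ Q) p v (Δ.target (v, j))) := by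
    have h2 : (univ.filter fun x : HalfEdge n d => x.1 ∈ V₀) = V₀ ×ˢ univ := by
      ext x; simp
    rw [h2, Finset.sum_product]
    simp only [← Complex.exp_sum, ← Finset.mul_sum]
    congr 1
    ring
  rw [h1]
  have h3 : ∏ v ∈ V₀, vertexWeight (if v ∈ Q then 0 else 1)
      (if v ∈ Q then 1 else if v ∈ V₀ then ς v else 0) (p v) =
      ∏ v ∈ V₀, vertexWeight 1 (ς v) (p v) := prod_congr rfl fun v hv => by
    have : v ∉ Q := fun h => hQ' v h hv
    simp [hv, this]
  have h4 : ∏ v ∈ Q, vertexWeight (if v ∈ Q then 0 else 1)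
      (if v ∈ Q then 1 else if v ∈ V₀ then ς v else 0) (p v) =
      ∏ v ∈ Q, vertexWeight 0 1 (p v) := prod_congr rfl fun v hv => by simp [hv]
  rw [h3, h4]
  ring

/-- The half-edges that leave `Q` towards vertices outside `V₀`. -/
def outer (Δ : Configuration n d) (V₀ Q : Finset (Fin n)) : Finset (HalfEdge n d) :=
  univ.filter fun h => h.1 ∈ Q ∧ Δ.target h ∉ V₀ ∧ Δ.target h ∉ Q

/-- The set `Q` together with its neighbours outside `V₀`. -/
def hull (Δ : Configuration n d) (V₀ Q : Finset (Fin n)) : Finset (Fin n) :=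
  Q ∪ (outer Δ V₀ Q).image Δ.target

/-- The surroundings of `Q` carry no short cycle: the neighbours of `Q` outside `V₀` are distinct,
every star with centre in `V₀` meets `Q` and these neighbours at most once, and the stars that do so
have three distinct leaves. -/
structure IsTreelike (Δ : Configuration n d) (V₀ Q : Finset (Fin n)) : Prop where
  disjoint : Disjoint Q V₀
  injOn : Set.InjOn Δ.target (outer Δ V₀ Q : Set (HalfEdge n d))
  unique : ∀ x y : HalfEdge n d, x.1 ∈ V₀ → x.1 = y.1 → Δ.target x ∈ hull Δ V₀ Q →
    Δ.target y ∈ hull Δ V₀ Q → x = y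
  regular : ∀ x : HalfEdge n d, x.1 ∈ V₀ → Δ.target x ∈ hull Δ V₀ Q →
    (Function.Injective fun i => Δ.target (x.1, i)) ∧ ∀ i, Δ.target (x.1, i) ≠ x.1

/-- The sum of the weights of the vertices of `V₀` to which the edges at `w` lead. If `w` is a leaf
of a regular star, this is the weight of the centre. -/
def leafSum {R : Type} [AddCommMonoid R] (Δ : Configuration n d) (V₀ : Finset (Fin n))
    (ς : Fin n → R) (w : Fin n) : R :=
  ∑ j : Fin d, if Δ.target (w, j) ∈ V₀ then ς (Δ.target (w, j)) else 0

/-- The odd part of the factor that the half-edge `h` contributes to the weight of a vertex whose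
two spins are opposite. -/
def oddFactor (γ : ℝ) (Δ : Configuration n d) (V₀ : Finset (Fin n)) (ς : Fin n → ℂ)
    (h : HalfEdge n d) : ℂ :=
  if Δ.target h ∈ V₀ then (Real.sin γ : ℂ) * ς (Δ.target h) * invSqrtTwo
  else (Real.sin γ : ℂ) * (starBias γ * leafSum Δ V₀ ς (Δ.target h))

/-- The odd part of the factor that the half-edge `h` contributes to the weight of a vertex whose
two spins agree. -/
def evenFactor (γ : ℝ) (Δ : Configuration n d) (V₀ : Finset (Fin n)) (ς : Fin n → ℂ)
    (h : HalfEdge n d) : ℂ :=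
  if Δ.target h ∈ V₀ then starBias γ * ς (Δ.target h) else 0

/-- The factor of a half-edge with odd parts `o` and `e`. -/
def branchFactor (γ : ℝ) (o e : ℂ) (b : Bool × Bool) : ℂ :=
  if b.2 = true then (Real.cos γ : ℂ) + Complex.I * o * spin b.1 else 1 + e * spin b.1

theorem sum_edgeAction_outside (Δ : Configuration n d) {V₀ Q : Finset (Fin n)}
    (hQ : Disjoint Q V₀) (p : Fin n → Bool × Bool) :
    ∑ x : HalfEdge n d with x.1 ∉ V₀ ∧ Δ.target x ∉ V₀,
          edgeAction (V₀ ∪ Q) p x.1 (Δ.target x) =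
      (∑ x : HalfEdge n d with x.1 ∈ Q ∧ Δ.target x ∈ Q,
          edgeAction (V₀ ∪ Q) p x.1 (Δ.target x)) +
        2 * ∑ x ∈ outer Δ V₀ Q, edgeAction (V₀ ∪ Q) p x.1 (Δ.target x) := by
  classical
  have hQ' : ∀ v ∈ Q, v ∉ V₀ := fun v h => Finset.disjoint_left.1 hQ h
  set f : HalfEdge n d → ℂ := fun x => edgeAction (V₀ ∪ Q) p x.1 (Δ.target x) with hf
  have hsymm : ∑ x ∈ outer Δ V₀ Q, f x =
      ∑ x : HalfEdge n d with x.1 ∉ V₀ ∧ x.1 ∉ Q ∧ Δ.target x ∈ Q, f x := by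
    refine Finset.sum_nbij' (fun x => Δ.1 x) (fun x => Δ.1 x) ?_ ?_ ?_ ?_ ?_
    · intro x hx
      simp only [outer, mem_filter, mem_univ, true_and, Δ.target_apply] at hx ⊢
      exact ⟨hx.2.1, hx.2.2, hx.1⟩
    · intro x hx
      simp only [outer, mem_filter, mem_univ, true_and, Δ.target_apply] at hx ⊢
      exact ⟨hx.2.2, hx.1, hx.2.1⟩
    · intro x _; exact Δ.2.1 x
    · intro x _; exact Δ.2.1 x
    · intro x _
      simp only [hf]
      rw [Δ.target_apply, edgeAction_comm]
      rfl
  rw [two_mul]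
  nth_rewrite 2 [hsymm]
  rw [← add_assoc]
  simp only [outer, Finset.sum_filter, ← Finset.sum_add_distrib]
  refine sum_congr rfl fun x _ => ?_
  by_cases h1 : x.1 ∈ Q <;> by_cases h2 : Δ.target x ∈ Q
  · simp [h1, h2, hQ' _ h1, hQ' _ h2, hf]
  · by_cases h3 : Δ.target x ∈ V₀ <;> simp [h1, h2, h3, hQ' _ h1, hf]
  · by_cases h3 : x.1 ∈ V₀ <;> simp [h1, h2, h3, hQ' _ h2, hf]
  · by_cases h3 : x.1 ∈ V₀
    · simp [h1, h2, h3]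
    · by_cases h4 : Δ.target x ∈ V₀
      · simp [h1, h2, h4]
      · simp [h1, h2, h3, h4, hf, edgeAction, secondSpin]

theorem prod_one_add_mul_of_card_le_one {ι : Type} (s : Finset ι) (f : ι → ℂ)
    (hs : ∀ x ∈ s, ∀ y ∈ s, x = y) : ∏ x ∈ s, (1 + f x) = 1 + ∑ x ∈ s, f x := by
  rcases s.eq_empty_or_nonempty with rfl | ⟨a, ha⟩
  · simp
  · have : s = {a} := by
      ext x; simp only [mem_singleton]
      exact ⟨fun hx => hs x hx a ha, fun h => h ▸ ha⟩
    simp [this]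

theorem leafSum_eq_sum {R : Type} [AddCommMonoid R] (Δ : Configuration n d) (V₀ : Finset (Fin n))
    (ς : Fin n → R) (w : Fin n) :
    leafSum Δ V₀ ς w = ∑ x : HalfEdge n d with x.1 ∈ V₀ ∧ Δ.target x = w, ς x.1 := by
  unfold leafSum
  rw [← Finset.sum_filter]
  refine Finset.sum_nbij' (fun j => Δ.1 (w, j)) (fun x => (Δ.1 x).2) ?_ ?_ ?_ ?_ ?_
  · intro j hj
    simp only [mem_filter, mem_univ, true_and, Δ.target_apply] at hj ⊢
    exact ⟨hj, trivial⟩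
  · intro x hx
    simp only [mem_filter, mem_univ, true_and] at hx ⊢
    have : (w, (Δ.1 x).2) = Δ.1 x := Prod.ext hx.2.symm rfl
    rw [this, Δ.target_apply]
    exact hx.1
  · intro j _; rw [Δ.2.1]
  · intro x hx
    simp only [mem_filter, mem_univ, true_and] at hx
    have : (w, (Δ.1 x).2) = Δ.1 x := Prod.ext hx.2.symm rfl
    rw [this, Δ.2.1]
  · intro j _; rfl

/-- At a treelike set only the vertices of `Q` are left to average over: each half-edge that leaves
`Q` contributes an independent factor, which depends on the star at its other end. -/
theorem correlation_eq_of_isTreelike (γ : ℝ) (Δ : Configuration n 3) {V₀ Q : Finset (Fin n)}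
    (hS : IsSeparated Δ V₀) (hT : IsTreelike Δ V₀ Q) (ς : Fin n → ℂ) :
    correlation γ Δ V₀ Q ς = 𝔼 l : Fin n → Bool × Bool,
      (∏ u ∈ Q, vertexWeight 0 1 (l u)) * Complex.exp (Complex.I / 4 * γ *
        ∑ x : HalfEdge n 3 with x.1 ∈ Q ∧ Δ.target x ∈ Q,
          edgeAction (V₀ ∪ Q) l x.1 (Δ.target x)) *
      ∏ h : HalfEdge n 3 with h.1 ∈ Q ∧ Δ.target h ∉ Q,
        branchFactor γ (oddFactor γ Δ V₀ ς h) (evenFactor γ Δ V₀ ς h) (l h.1) := by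
  classical
  have hQ' : ∀ v ∈ Q, v ∉ V₀ := fun v h => Finset.disjoint_left.1 hT.disjoint h
  have hLV : Disjoint (hull Δ V₀ Q) V₀ := by
    rw [Finset.disjoint_left]
    intro u hu
    rcases mem_union.1 hu with h | h
    · exact hQ' u h
    · obtain ⟨x, hx, rfl⟩ := mem_image.1 h
      exact (mem_filter.1 hx).2.2.1
  have hQL : Q ⊆ hull Δ V₀ Q := subset_union_left
  have hEL : ∀ h ∈ outer Δ V₀ Q, Δ.target h ∈ hull Δ V₀ Q := fun h hh =>
    mem_union_right _ (mem_image_of_mem _ hh)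
  rw [correlation_eq γ Δ hS hT.disjoint ς]
  have hexp : ∀ p : Fin n → Bool × Bool, Complex.exp (Complex.I / 4 * γ *
        ∑ x : HalfEdge n 3 with x.1 ∉ V₀ ∧ Δ.target x ∉ V₀,
          edgeAction (V₀ ∪ Q) p x.1 (Δ.target x)) = Complex.exp (Complex.I / 4 * γ *
        ∑ x : HalfEdge n 3 with x.1 ∈ Q ∧ Δ.target x ∈ Q,
          edgeAction (V₀ ∪ Q) p x.1 (Δ.target x)) * ∏ h ∈ outer Δ V₀ Q,
            Complex.exp (Complex.I / 2 * γ * edgeAction (V₀ ∪ Q) p h.1 (Δ.target h)) := by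
    intro p
    rw [sum_edgeAction_outside Δ hT.disjoint, mul_add, Complex.exp_add]
    simp only [← Complex.exp_sum, ← Finset.mul_sum]
    congr 2
    ring
  simp only [hexp]
  rw [expect_mul_prod_starWeight γ Δ hS Q (hull Δ V₀ Q) hQL hLV ς hT.unique hT.regular]
  swap
  · intro p q hpq
    have h1 : ∀ u ∈ Q, p u = q u := fun u hu => hpq u (hQL hu)
    have e1 : ∏ u ∈ Q, vertexWeight 0 1 (p u) = ∏ u ∈ Q, vertexWeight 0 1 (q u) :=
      prod_congr rfl fun u hu => by rw [h1 u hu]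
    have e2 : ∑ x : HalfEdge n 3 with x.1 ∈ Q ∧ Δ.target x ∈ Q,
          edgeAction (V₀ ∪ Q) p x.1 (Δ.target x) =
        ∑ x : HalfEdge n 3 with x.1 ∈ Q ∧ Δ.target x ∈ Q,
          edgeAction (V₀ ∪ Q) q x.1 (Δ.target x) := sum_congr rfl fun x hx =>
      edgeAction_congr (h1 _ (mem_filter.1 hx).2.1) (h1 _ (mem_filter.1 hx).2.2)
    have e3 : ∏ h ∈ outer Δ V₀ Q,
            Complex.exp (Complex.I / 2 * γ * edgeAction (V₀ ∪ Q) p h.1 (Δ.target h)) =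
        ∏ h ∈ outer Δ V₀ Q,
            Complex.exp (Complex.I / 2 * γ * edgeAction (V₀ ∪ Q) q h.1 (Δ.target h)) :=
      prod_congr rfl fun h hh => by
        rw [edgeAction_congr (h1 _ (mem_filter.1 hh).2.1) (hpq _ (hEL h hh))]
    beta_reduce
    rw [e1, e2, e3]
  -- the messages to `Q` and those to its neighbours
  have hmsg : ∀ l : Fin n → Bool × Bool,
      ∏ x : HalfEdge n 3 with x.1 ∈ V₀ ∧ Δ.target x ∈ hull Δ V₀ Q,
        message γ (ς x.1) (Δ.target x ∈ Q) (l (Δ.target x)) =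
      (∏ x : HalfEdge n 3 with x.1 ∈ V₀ ∧ Δ.target x ∈ Q, message γ (ς x.1) True (l (Δ.target x))) *
        ∏ h ∈ outer Δ V₀ Q,
          (1 + starBias γ * leafSum Δ V₀ ς (Δ.target h) * spin (l (Δ.target h)).1) := by
    intro l
    rw [← Finset.prod_filter_mul_prod_filter_not _ (fun x : HalfEdge n 3 => Δ.target x ∈ Q),
      Finset.filter_filter, Finset.filter_filter]
    congr 1
    · have : (univ.filter fun x : HalfEdge n 3 => (x.1 ∈ V₀ ∧ Δ.target x ∈ hull Δ V₀ Q) ∧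
          Δ.target x ∈ Q) = univ.filter fun x => x.1 ∈ V₀ ∧ Δ.target x ∈ Q := by
        ext x
        simp only [mem_filter, mem_univ, true_and]
        exact ⟨fun h => ⟨h.1.1, h.2⟩, fun h => ⟨⟨h.1, hQL h.2⟩, h.2⟩⟩
      rw [this]
      refine prod_congr rfl fun x hx => ?_
      simp [message, (mem_filter.1 hx).2.2]
    · rw [← Finset.prod_image (s := outer Δ V₀ Q) (g := Δ.target)
        (f := fun w => 1 + starBias γ * leafSum Δ V₀ ς w * spin (l w).1) hT.injOn,
        ← Finset.prod_fiberwise_of_maps_to (t := (outer Δ V₀ Q).image Δ.target) (g := Δ.target)]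
      · refine prod_congr rfl fun w hw => ?_
        obtain ⟨h, hh, rfl⟩ := mem_image.1 hw
        have hnQ : Δ.target h ∉ Q := (mem_filter.1 hh).2.2.2
        have hset : ((univ.filter fun x : HalfEdge n 3 => (x.1 ∈ V₀ ∧ Δ.target x ∈ hull Δ V₀ Q) ∧
          Δ.target x ∉ Q).filter fun x => Δ.target x = Δ.target h) =
            univ.filter fun x => x.1 ∈ V₀ ∧ Δ.target x = Δ.target h := by
          ext x
          simp only [mem_filter, mem_univ, true_and]
          exact ⟨fun h => ⟨h.1.1.1, h.2⟩, fun h' => ⟨⟨⟨h'.1, h'.2 ▸ hEL h hh⟩, h'.2 ▸ hnQ⟩, h'.2⟩⟩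
        rw [hset, leafSum_eq_sum]
        have h2 : ∏ x : HalfEdge n 3 with x.1 ∈ V₀ ∧ Δ.target x = Δ.target h,
            message γ (ς x.1) (Δ.target x ∈ Q) (l (Δ.target x)) =
            ∏ x : HalfEdge n 3 with x.1 ∈ V₀ ∧ Δ.target x = Δ.target h,
              (1 + starBias γ * ς x.1 * spin (l (Δ.target h)).1) :=
          prod_congr rfl fun x hx => by
            have hx := (mem_filter.1 hx).2.2
            simp [message, hx, hnQ]
        rw [h2, prod_one_add_mul_of_card_le_one, Finset.mul_sum, Finset.sum_mul]
        intro x hx y hy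
        have hx := (mem_filter.1 hx).2
        have hy := (mem_filter.1 hy).2
        exact hT.unique x y hx.1 (hS.2 x y hx.1 hy.1 (hx.2.trans hy.2.symm)) (hx.2 ▸ hEL h hh)
          (hy.2 ▸ hEL h hh)
      · intro x hx
        have hx := (mem_filter.1 hx).2
        exact (mem_union.1 hx.1.2).resolve_left hx.2
  simp only [hmsg]
  -- summation over the spins of the neighbours, for fixed spins in `Q`
  rw [expect_piecewise Q]
  refine Finset.expect_congr rfl fun l _ => ?_
  have hpQ : ∀ p : Fin n → Bool × Bool, ∀ u ∈ Q, Q.piecewise l p u = l u := fun p u hu =>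
    Finset.piecewise_eq_of_mem _ _ _ hu
  have hre : ∀ p : Fin n → Bool × Bool,
      (∏ u ∈ Q, vertexWeight 0 1 (Q.piecewise l p u)) * (Complex.exp (Complex.I / 4 * γ *
        ∑ x : HalfEdge n 3 with x.1 ∈ Q ∧ Δ.target x ∈ Q,
          edgeAction (V₀ ∪ Q) (Q.piecewise l p) x.1 (Δ.target x)) * ∏ h ∈ outer Δ V₀ Q,
            Complex.exp (Complex.I / 2 * γ *
              edgeAction (V₀ ∪ Q) (Q.piecewise l p) h.1 (Δ.target h))) *
        ((∏ x : HalfEdge n 3 with x.1 ∈ V₀ ∧ Δ.target x ∈ Q,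
          message γ (ς x.1) True (Q.piecewise l p (Δ.target x))) *
        ∏ h ∈ outer Δ V₀ Q, (1 + starBias γ * leafSum Δ V₀ ς (Δ.target h) *
          spin (Q.piecewise l p (Δ.target h)).1)) =
      ((∏ u ∈ Q, vertexWeight 0 1 (l u)) * Complex.exp (Complex.I / 4 * γ *
        ∑ x : HalfEdge n 3 with x.1 ∈ Q ∧ Δ.target x ∈ Q,
          edgeAction (V₀ ∪ Q) l x.1 (Δ.target x)) *
        ∏ x : HalfEdge n 3 with x.1 ∈ V₀ ∧ Δ.target x ∈ Q,
          message γ (ς x.1) True (l (Δ.target x))) *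
        ∏ h ∈ outer Δ V₀ Q, ((if (l h.1).2 = true then edgePhase γ (l h.1).1 (p (Δ.target h)).1
          else 1) *
          (1 + starBias γ * leafSum Δ V₀ ς (Δ.target h) * spin (p (Δ.target h)).1)) := by
    intro p
    have e1 : ∏ u ∈ Q, vertexWeight 0 1 (Q.piecewise l p u) = ∏ u ∈ Q, vertexWeight 0 1 (l u) :=
      prod_congr rfl fun u hu => by rw [hpQ p u hu]
    have e2 : ∑ x : HalfEdge n 3 with x.1 ∈ Q ∧ Δ.target x ∈ Q,
          edgeAction (V₀ ∪ Q) (Q.piecewise l p) x.1 (Δ.target x) =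
        ∑ x : HalfEdge n 3 with x.1 ∈ Q ∧ Δ.target x ∈ Q,
          edgeAction (V₀ ∪ Q) l x.1 (Δ.target x) := sum_congr rfl fun x hx =>
      edgeAction_congr (hpQ p _ (mem_filter.1 hx).2.1) (hpQ p _ (mem_filter.1 hx).2.2)
    have e3 : ∏ x : HalfEdge n 3 with x.1 ∈ V₀ ∧ Δ.target x ∈ Q,
          message γ (ς x.1) True (Q.piecewise l p (Δ.target x)) =
        ∏ x : HalfEdge n 3 with x.1 ∈ V₀ ∧ Δ.target x ∈ Q,
          message γ (ς x.1) True (l (Δ.target x)) :=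
      prod_congr rfl fun x hx => by rw [hpQ p _ (mem_filter.1 hx).2.2]
    have e4 : ∀ h ∈ outer Δ V₀ Q, Complex.exp (Complex.I / 2 * γ *
              edgeAction (V₀ ∪ Q) (Q.piecewise l p) h.1 (Δ.target h)) =
        if (l h.1).2 = true then edgePhase γ (l h.1).1 (p (Δ.target h)).1 else 1 := by
      intro h hh
      obtain ⟨h1, h2, h3⟩ := (mem_filter.1 hh).2
      rw [exp_edgeAction, hpQ p _ h1, Finset.piecewise_eq_of_notMem _ _ _ h3]
      simp only [mem_union, h1, h2, h3, or_true, or_false, true_and, false_and, iff_false]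
      split_ifs <;> simp_all
    have e5 : ∏ h ∈ outer Δ V₀ Q, (1 + starBias γ * leafSum Δ V₀ ς (Δ.target h) *
          spin (Q.piecewise l p (Δ.target h)).1) =
        ∏ h ∈ outer Δ V₀ Q, (1 + starBias γ * leafSum Δ V₀ ς (Δ.target h) *
          spin (p (Δ.target h)).1) := prod_congr rfl fun h hh => by
      rw [Finset.piecewise_eq_of_notMem _ _ _ (mem_filter.1 hh).2.2.2]
    rw [e1, e2, e3, e5, prod_congr rfl e4, Finset.prod_mul_distrib]
    ring
  simp only [hre]
  rw [← Finset.mul_expect, expect_prod_of_dependsOn (outer Δ V₀ Q) (fun h => {Δ.target h})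
    (fun h (p : Fin n → Bool × Bool) =>
      ((if (l h.1).2 = true then edgePhase γ (l h.1).1 (p (Δ.target h)).1
          else 1) *
          (1 + starBias γ * leafSum Δ V₀ ς (Δ.target h) * spin (p (Δ.target h)).1)))]
  · have hbranch : ∀ h ∈ outer Δ V₀ Q, (𝔼 p : Fin n → Bool × Bool,
        ((if (l h.1).2 = true then edgePhase γ (l h.1).1 (p (Δ.target h)).1
          else 1) *
          (1 + starBias γ * leafSum Δ V₀ ς (Δ.target h) * spin (p (Δ.target h)).1))) =
        branchFactor γ (oddFactor γ Δ V₀ ς h) (evenFactor γ Δ V₀ ς h) (l h.1) := by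
      intro h hh
      obtain ⟨h1, h2, h3⟩ := (mem_filter.1 hh).2
      rw [expect_single (Δ.target h) (fun b : Bool × Bool =>
          ((if (l h.1).2 = true then edgePhase γ (l h.1).1 b.1 else 1) *
          (1 + starBias γ * leafSum Δ V₀ ς (Δ.target h) * spin b.1))),
        Fintype.expect_eq_sum_div_card, Fintype.sum_prod_type]
      by_cases hf : (l h.1).2 = true
      · simp [branchFactor, oddFactor, h2, hf, edgePhase, spin]
        cases (l h.1).1 <;> simp <;> ring
      · simp [branchFactor, evenFactor, h2, hf, spin]
        ring
    rw [prod_congr rfl hbranch]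
    have hdir : ∏ x : HalfEdge n 3 with x.1 ∈ V₀ ∧ Δ.target x ∈ Q,
          message γ (ς x.1) True (l (Δ.target x)) =
        ∏ h : HalfEdge n 3 with h.1 ∈ Q ∧ Δ.target h ∈ V₀,
          branchFactor γ (oddFactor γ Δ V₀ ς h) (evenFactor γ Δ V₀ ς h) (l h.1) := by
      refine Finset.prod_nbij' (fun x => Δ.1 x) (fun x => Δ.1 x) ?_ ?_ ?_ ?_ ?_
      · intro x hx
        simp only [mem_filter, mem_univ, true_and, Δ.target_apply] at hx ⊢
        exact ⟨hx.2, hx.1⟩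
      · intro x hx
        simp only [mem_filter, mem_univ, true_and, Δ.target_apply] at hx ⊢
        exact ⟨hx.2, hx.1⟩
      · intro x _; exact Δ.2.1 x
      · intro x _; exact Δ.2.1 x
      · intro x hx
        have hx := (mem_filter.1 hx).2
        simp only [message, branchFactor, oddFactor, evenFactor, Δ.target_apply, hx.1, if_true,
          true_and]
        rfl
    rw [hdir, mul_assoc]
    congr 1
    rw [← Finset.prod_filter_mul_prod_filter_not
      (univ.filter fun h : HalfEdge n 3 => h.1 ∈ Q ∧ Δ.target h ∉ Q) (fun h => Δ.target h ∈ V₀),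
      Finset.filter_filter, Finset.filter_filter]
    congr 1
    · refine prod_congr ?_ fun _ _ => rfl
      ext h
      simp only [mem_filter, mem_univ, true_and]
      exact ⟨fun h => ⟨⟨h.1, fun h' => hQ' _ h' h.2⟩, h.2⟩, fun h => ⟨h.1.1, h.2⟩⟩
    · refine prod_congr ?_ fun _ _ => rfl
      ext h
      simp only [outer, mem_filter, mem_univ, true_and]
      tauto
  · intro h hh h' hh' hne
    rw [Set.disjoint_singleton]
    exact fun e => hne (hT.injOn hh hh' e)
  · intro h _ p q hpq
    simp only [hpq _ (Set.mem_singleton _)]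

theorem expect_bool_pair (f : Bool × Bool → ℂ) :
    𝔼 b, f b = (f (true, true) + f (true, false) + (f (false, true) + f (false, false))) / 4 := by
  rw [Fintype.expect_eq_sum_div_card, Fintype.sum_prod_type]
  simp only [Fintype.sum_bool, Fintype.card_prod, Fintype.card_bool]
  norm_num

/-- The average over a vertex with three branches. The product `e₁ e₂` vanishes in the application,
because a leaf has only one edge to `V₀`. -/
theorem expect_single_vertex (γ : ℝ) (o₁ o₂ o₃ e₁ e₂ e₃ : ℂ) (h₁₂ : e₁ * e₂ = 0) :
    𝔼 b, vertexWeight 0 1 b * (branchFactor γ o₁ e₁ b * (branchFactor γ o₂ e₂ b *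
      branchFactor γ o₃ e₃ b)) =
      invSqrtTwo * (e₁ + e₂ + e₃ - (Real.cos γ : ℂ) ^ 2 * (o₁ + o₂ + o₃) + o₁ * o₂ * o₃) := by
  rw [expect_bool_pair]
  simp only [vertexWeight, branchFactor, spin, if_true]
  have hI : Complex.I ^ 2 = -1 := Complex.I_sq
  generalize ((Real.cos γ : ℝ) : ℂ) = c
  simp
  linear_combination (invSqrtTwo * c ^ 2 * (o₁ + o₂ + o₃)
    + invSqrtTwo * (Complex.I ^ 2 - 1) * o₁ * o₂ * o₃) * hI + invSqrtTwo * e₃ * h₁₂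

theorem expect_two_vertices (γ : ℝ) (o₁ o₂ e₁ e₂ o₁' o₂' e₁' e₂' : ℂ) (h : e₁ * e₂ = 0)
    (h' : e₁' * e₂' = 0) :
    𝔼 b : Bool × Bool, 𝔼 b' : Bool × Bool, vertexWeight 0 1 b * vertexWeight 0 1 b' *
      (if b.2 = b'.2 then 1 else edgePhase γ b.1 b'.1) *
      ((branchFactor γ o₁ e₁ b * branchFactor γ o₂ e₂ b) *
        (branchFactor γ o₁' e₁' b' * branchFactor γ o₂' e₂' b')) =
      1 / 2 * ((Real.cos γ : ℂ) ^ 2 * (o₁ + o₂) * (o₁' + o₂') -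
        2 * (Real.sin γ : ℂ) * (Real.cos γ : ℂ) ^ 2 +
        (Real.sin γ : ℂ) * (o₁ * o₂ + o₁' * o₂') -
        (Real.cos γ : ℂ) ^ 2 * ((e₁' + e₂') * (o₁ + o₂) + (e₁ + e₂) * (o₁' + o₂')) +
        (e₁ + e₂) * (e₁' + e₂')) := by
  have hI : Complex.I ^ 2 = -1 := Complex.I_sq
  have hI3 : Complex.I ^ 3 = -Complex.I := by rw [pow_succ, hI]; ring
  have hI4 : Complex.I ^ 4 = 1 := by rw [pow_succ, hI3]; ring_nf; rw [hI]; ring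
  have hf : ∀ b : Bool × Bool, branchFactor γ o₁ e₁ b * branchFactor γ o₂ e₂ b =
      if b.2 = true then (Real.cos γ : ℂ) ^ 2 - o₁ * o₂ +
        Complex.I * (Real.cos γ : ℂ) * (o₁ + o₂) * spin b.1 else 1 + (e₁ + e₂) * spin b.1 := by
    rintro ⟨b, f⟩
    have hs := spin_mul_self b
    cases f
    · simp only [branchFactor]; simp; linear_combination e₁ * e₂ * hs + h
    · simp only [branchFactor, if_true]
      linear_combination o₁ * o₂ * Complex.I ^ 2 * hs + o₁ * o₂ * hI
  have hf' : ∀ b : Bool × Bool, branchFactor γ o₁' e₁' b * branchFactor γ o₂' e₂' b =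
      if b.2 = true then (Real.cos γ : ℂ) ^ 2 - o₁' * o₂' +
        Complex.I * (Real.cos γ : ℂ) * (o₁' + o₂') * spin b.1 else 1 + (e₁' + e₂') * spin b.1 := by
    rintro ⟨b, f⟩
    have hs := spin_mul_self b
    cases f
    · simp only [branchFactor]; simp; linear_combination e₁' * e₂' * hs + h'
    · simp only [branchFactor, if_true]
      linear_combination o₁' * o₂' * Complex.I ^ 2 * hs + o₁' * o₂' * hI
  simp only [hf, hf']
  generalize hO : o₁ + o₂ = O
  generalize hO' : o₁' + o₂' = O'
  generalize hE : e₁ + e₂ = E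
  generalize hE' : e₁' + e₂' = E'
  generalize o₁ * o₂ = P
  generalize o₁' * o₂' = P'
  simp only [expect_bool_pair, vertexWeight, edgePhase, spin, if_true]
  have hr := invSqrtTwo_sq
  simp
  ring_nf
  rw [hI, hI4, hr]
  ring

/-- A leaf in treelike surroundings has only one edge to `V₀`. -/
theorem evenFactor_mul_eq_zero (γ : ℝ) (Δ : Configuration n d) {V₀ Q : Finset (Fin n)}
    (hS : IsSeparated Δ V₀) (hT : IsTreelike Δ V₀ Q) (ς : Fin n → ℂ) {w : Fin n} (hw : w ∈ Q)
    {j k : Fin d} (hjk : j ≠ k) :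
    evenFactor γ Δ V₀ ς (w, j) * evenFactor γ Δ V₀ ς (w, k) = 0 := by
  unfold evenFactor
  by_cases hj : Δ.target (w, j) ∈ V₀
  · by_cases hk : Δ.target (w, k) ∈ V₀
    · exfalso
      have hl : w ∈ hull Δ V₀ Q := mem_union_left _ hw
      have h1 := Δ.target_apply (w, j)
      have h2 := Δ.target_apply (w, k)
      have := hT.unique (Δ.1 (w, j)) (Δ.1 (w, k)) hj (hS.2 _ _ hj hk (h1.trans h2.symm))
        (h1.symm ▸ hl) (h2.symm ▸ hl)
      have := Δ.2.1.injective this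
      exact hjk (Prod.ext_iff.1 this).2
    · simp [hk]
  · simp [hj]

theorem starBias_mul_leafSum (γ : ℝ) (Δ : Configuration n d) (V₀ : Finset (Fin n)) (ς : Fin n → ℂ)
    (w : Fin n) :
    starBias γ * leafSum Δ V₀ ς w = ∑ j, evenFactor γ Δ V₀ ς (w, j) := by
  unfold leafSum evenFactor
  rw [Finset.mul_sum]
  exact sum_congr rfl fun j _ => by split_ifs <;> simp

/-- The magnetization of a vertex outside `V₀`. -/
theorem correlation_singleton (γ : ℝ) (Δ : Configuration n 3) {V₀ : Finset (Fin n)}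
    (hS : IsSeparated Δ V₀) (w : Fin n) (hT : IsTreelike Δ V₀ {w}) (ς : Fin n → ℂ)
    (hw : ∀ j, Δ.target (w, j) ≠ w) (j : Fin 3) :
    correlation γ Δ V₀ {w} ς = invSqrtTwo * (starBias γ * leafSum Δ V₀ ς w -
      (Real.cos γ : ℂ) ^ 2 * (oddFactor γ Δ V₀ ς (w, j) + oddFactor γ Δ V₀ ς (w, j + 1) +
        oddFactor γ Δ V₀ ς (w, j + 2)) + oddFactor γ Δ V₀ ς (w, j) * oddFactor γ Δ V₀ ς (w, j + 1) *
        oddFactor γ Δ V₀ ς (w, j + 2)) := by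
  have hj1 : j ≠ j + 1 := by fin_cases j <;> decide
  rw [correlation_eq_of_isTreelike γ Δ hS hT, starBias_mul_leafSum]
  have h0 : (univ.filter fun x : HalfEdge n 3 => x.1 ∈ ({w} : Finset (Fin n)) ∧
      Δ.target x ∈ ({w} : Finset (Fin n))) = ∅ := by
    ext ⟨u, j⟩
    simp only [mem_filter, mem_univ, true_and, mem_singleton, notMem_empty, iff_false, not_and]
    rintro rfl
    exact hw j
  have h1 : (univ.filter fun x : HalfEdge n 3 => x.1 ∈ ({w} : Finset (Fin n)) ∧
      Δ.target x ∉ ({w} : Finset (Fin n))) = {w} ×ˢ univ := by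
    ext ⟨u, j⟩
    simp only [mem_filter, mem_univ, true_and, mem_singleton, mem_product, and_true,
      and_iff_left_iff_imp]
    rintro rfl
    exact hw j
  have hs : ∑ k, evenFactor γ Δ V₀ ς (w, k) = evenFactor γ Δ V₀ ς (w, j) +
      evenFactor γ Δ V₀ ς (w, j + 1) + evenFactor γ Δ V₀ ς (w, j + 2) := by
    rw [Fin.sum_univ_three]
    fin_cases j <;> simp <;> ring
  rw [h0, h1, hs]
  simp only [prod_singleton, sum_empty, mul_zero, Complex.exp_zero, mul_one, Finset.prod_product,
    prod_fin_three _ j]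
  rw [expect_single w (fun b => vertexWeight 0 1 b * (branchFactor γ (oddFactor γ Δ V₀ ς (w, j))
    (evenFactor γ Δ V₀ ς (w, j)) b * (branchFactor γ (oddFactor γ Δ V₀ ς (w, j + 1))
    (evenFactor γ Δ V₀ ς (w, j + 1)) b * branchFactor γ (oddFactor γ Δ V₀ ς (w, j + 2))
    (evenFactor γ Δ V₀ ς (w, j + 2)) b))), expect_single_vertex]
  exact evenFactor_mul_eq_zero γ Δ hS hT ς (mem_singleton_self w) hj1

/-- The correlation of the ends of an edge outside `V₀`. -/
theorem correlation_pair (γ : ℝ) (Δ : Configuration n 3) {V₀ : Finset (Fin n)}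
    (hS : IsSeparated Δ V₀) (x y : HalfEdge n 3) (hxy : Δ.1 x = y)
    (hT : IsTreelike Δ V₀ {x.1, y.1}) (ς : Fin n → ℂ) (hne : x.1 ≠ y.1)
    (hint : ∀ h : HalfEdge n 3, h.1 ∈ ({x.1, y.1} : Finset (Fin n)) →
      Δ.target h ∈ ({x.1, y.1} : Finset (Fin n)) → h = x ∨ h = y)
    (o : HalfEdge n 3 → ℂ) (ho : o = oddFactor γ Δ V₀ ς) :
    correlation γ Δ V₀ {x.1, y.1} ς = 1 / 2 * (
      (Real.cos γ : ℂ) ^ 2 * (o (x.1, x.2 + 1) + o (x.1, x.2 + 2)) *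
          (o (y.1, y.2 + 1) + o (y.1, y.2 + 2)) -
        2 * (Real.sin γ : ℂ) * (Real.cos γ : ℂ) ^ 2 +
        (Real.sin γ : ℂ) * (o (x.1, x.2 + 1) * o (x.1, x.2 + 2) +
          o (y.1, y.2 + 1) * o (y.1, y.2 + 2)) -
        (Real.cos γ : ℂ) ^ 2 * (starBias γ * leafSum Δ V₀ ς y.1 *
            (o (x.1, x.2 + 1) + o (x.1, x.2 + 2)) +
          starBias γ * leafSum Δ V₀ ς x.1 * (o (y.1, y.2 + 1) + o (y.1, y.2 + 2))) +
        starBias γ * leafSum Δ V₀ ς x.1 * (starBias γ * leafSum Δ V₀ ς y.1)) := by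
  obtain ⟨i, j⟩ := x
  obtain ⟨i', j'⟩ := y
  simp only at *
  have hyx : Δ.1 (i', j') = (i, j) := by rw [← hxy, Δ.2.1]
  have htx : Δ.target (i, j) = i' := by unfold Configuration.target; rw [hxy]
  have hty : Δ.target (i', j') = i := by unfold Configuration.target; rw [hyx]
  have hj : ∀ j : Fin 3, j ≠ j + 1 ∧ j ≠ j + 2 ∧ j + 1 ≠ j + 2 := by decide
  have hi : i ∈ ({i, i'} : Finset (Fin n)) := by simp
  have hi' : i' ∈ ({i, i'} : Finset (Fin n)) := by simp
  have hV : ∀ u ∈ ({i, i'} : Finset (Fin n)), u ∉ V₀ := fun u hu =>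
    Finset.disjoint_left.1 hT.disjoint hu
  have hs : ∀ (w : Fin n) (k : Fin 3), Δ.target (w, k) ∉ V₀ →
      ∑ k, evenFactor γ Δ V₀ ς (w, k) =
      evenFactor γ Δ V₀ ς (w, k + 1) + evenFactor γ Δ V₀ ς (w, k + 2) := by
    intro w k hk
    have h0 : evenFactor γ Δ V₀ ς (w, k) = 0 := by simp [evenFactor, hk]
    have h3 : ∑ k, evenFactor γ Δ V₀ ς (w, k) = evenFactor γ Δ V₀ ς (w, k) +
      evenFactor γ Δ V₀ ς (w, k + 1) + evenFactor γ Δ V₀ ς (w, k + 2) := by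
      rw [Fin.sum_univ_three]
      fin_cases k <;> simp <;> ring
    rw [h3, h0, zero_add]
  have h0 : (univ.filter fun h : HalfEdge n 3 => h.1 ∈ ({i, i'} : Finset (Fin n)) ∧
      Δ.target h ∈ ({i, i'} : Finset (Fin n))) = {(i, j), (i', j')} := by
    ext h
    simp only [mem_filter, mem_univ, true_and]
    rw [mem_insert (b := (i, j)), mem_singleton]
    refine ⟨fun h' => hint h h'.1 h'.2, ?_⟩
    rintro (rfl | rfl)
    · exact ⟨hi, htx ▸ hi'⟩
    · exact ⟨hi', hty ▸ hi⟩
  have h1 : (univ.filter fun h : HalfEdge n 3 => h.1 ∈ ({i, i'} : Finset (Fin n)) ∧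
      Δ.target h ∉ ({i, i'} : Finset (Fin n))) =
      {(i, j + 1), (i, j + 2), (i', j' + 1), (i', j' + 2)} := by
    have h2 : (univ.filter fun h : HalfEdge n 3 => h.1 ∈ ({i, i'} : Finset (Fin n)) ∧
      Δ.target h ∉ ({i, i'} : Finset (Fin n))) =
      (univ.filter fun h : HalfEdge n 3 => h.1 ∈ ({i, i'} : Finset (Fin n))) \
        {(i, j), (i', j')} := by
      rw [← h0]
      ext h
      simp only [mem_filter, mem_univ, true_and, mem_sdiff]
      tauto
    rw [h2]
    have hfin : ∀ j k : Fin 3, k = j ∨ k = j + 1 ∨ k = j + 2 := by decide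
    ext ⟨u, k⟩
    simp only [mem_filter, mem_univ, true_and, mem_sdiff, mem_insert, mem_singleton, Prod.mk.injEq]
    have hj1 := hj j
    have hj2 := hj j'
    rcases hfin j k with h | h | h <;> rcases hfin j' k with h' | h' | h' <;> grind
  have hprod : ∀ g : HalfEdge n 3 → ℂ, ∏ h ∈ ({(i, j + 1), (i, j + 2), (i', j' + 1),
      (i', j' + 2)} : Finset (HalfEdge n 3)), g h =
      (g (i, j + 1) * g (i, j + 2)) * (g (i', j' + 1) * g (i', j' + 2)) := by
    intro g
    have hj1 := hj j
    have hj2 := hj j'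
    rw [prod_insert, prod_insert, prod_insert, prod_singleton]
    · ring
    all_goals simp [hne, hj1, hj2]
  have hsum : ∀ g : HalfEdge n 3 → ℂ, ∑ h ∈ ({(i, j), (i', j')} : Finset (HalfEdge n 3)), g h =
      g (i, j) + g (i', j') := by
    intro g
    rw [sum_insert, sum_singleton]
    simp [hne]
  rw [correlation_eq_of_isTreelike γ Δ hS hT, starBias_mul_leafSum, starBias_mul_leafSum,
    hs i j (htx ▸ hV _ hi'), hs i' j' (hty ▸ hV _ hi), h0, h1]
  have hedge : ∀ l : Fin n → Bool × Bool, Complex.exp (Complex.I / 4 * γ *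
      (edgeAction (V₀ ∪ {i, i'}) l i (Δ.target (i, j)) +
        edgeAction (V₀ ∪ {i, i'}) l i' (Δ.target (i', j')))) =
      if (l i).2 = (l i').2 then 1 else edgePhase γ (l i).1 (l i').1 := by
    intro l
    rw [htx, hty, edgeAction_comm _ _ i' i]
    have : Complex.I / 4 * γ * (edgeAction (V₀ ∪ {i, i'}) l i i' +
        edgeAction (V₀ ∪ {i, i'}) l i i') =
        Complex.I / 2 * γ * edgeAction (V₀ ∪ {i, i'}) l i i' := by ring
    rw [this, exp_edgeAction]
    have m1 : i ∈ V₀ ∪ {i, i'} := mem_union_right _ hi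
    have m2 : i' ∈ V₀ ∪ {i, i'} := mem_union_right _ hi'
    simp only [m1, m2, true_and]
    congr 1
    cases (l i).2 <;> cases (l i').2 <;> simp
  simp only [hprod, hsum, hedge, Finset.prod_pair hne]
  rw [expect_pair hne (fun b b' => vertexWeight 0 1 b * vertexWeight 0 1 b' *
      (if b.2 = b'.2 then 1 else edgePhase γ b.1 b'.1) *
      ((branchFactor γ (oddFactor γ Δ V₀ ς (i, j + 1)) (evenFactor γ Δ V₀ ς (i, j + 1)) b *
        branchFactor γ (oddFactor γ Δ V₀ ς (i, j + 2)) (evenFactor γ Δ V₀ ς (i, j + 2)) b) *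
        (branchFactor γ (oddFactor γ Δ V₀ ς (i', j' + 1)) (evenFactor γ Δ V₀ ς (i', j' + 1)) b' *
        branchFactor γ (oddFactor γ Δ V₀ ς (i', j' + 2)) (evenFactor γ Δ V₀ ς (i', j' + 2)) b'))),
    expect_two_vertices, ho]
  · exact evenFactor_mul_eq_zero γ Δ hS hT ς hi (hj j).2.2
  · exact evenFactor_mul_eq_zero γ Δ hS hT ς hi' (hj j').2.2

/-! ### The gain as a sum over the edges -/

/-- A star without further observables has weight `1`. For a sign vector `ς`, this says that the
outcome `ς` has probability `1 / 2 ^ #V₀`. -/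
theorem correlation_empty (γ : ℝ) (Δ : Configuration n 3) {V₀ : Finset (Fin n)}
    (hS : IsSeparated Δ V₀) (ς : Fin n → ℂ) : correlation γ Δ V₀ ∅ ς = 1 := by
  have ho : outer Δ V₀ ∅ = ∅ := by simp [outer]
  have hT : IsTreelike Δ V₀ ∅ := by
    refine ⟨by simp, by simp [ho], ?_, ?_⟩ <;> simp [hull, ho]
  rw [correlation_eq_of_isTreelike γ Δ hS hT]
  simp

/-- The correlation of the ends of the half-edge `x`, weighted with `∏_{v ∈ V₀} (1 + ς_v Z_v)`. -/
def edgeCorrelation (γ : ℝ) (Δ : Configuration n d) (V₀ : Finset (Fin n)) (ς : Fin n → ℝ)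
    (x : HalfEdge n d) : ℂ :=
  ∑ z, (spin (z x.1) * spin (z (Δ.target x))) * (∏ v ∈ V₀, (1 + (ς v : ℂ) * spin (z v))) *
    ((‖qaoaState (-(Real.pi / 4)) γ Δ z‖ ^ 2 : ℝ) : ℂ)

theorem edgeCorrelation_symm (γ : ℝ) (Δ : Configuration n d) (V₀ : Finset (Fin n)) (ς : Fin n → ℝ)
    (x : HalfEdge n d) :
    edgeCorrelation γ Δ V₀ ς (Δ.1 x) = edgeCorrelation γ Δ V₀ ς x := by
  unfold edgeCorrelation
  rw [Δ.target_apply]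
  refine sum_congr rfl fun z _ => ?_
  rw [mul_comm (spin _)]
  rfl

theorem edgeCorrelation_eq_correlation (γ : ℝ) (Δ : Configuration n d) (V₀ : Finset (Fin n))
    (ς : Fin n → ℝ) (x : HalfEdge n d) (hx : x.1 ≠ Δ.target x) :
    edgeCorrelation γ Δ V₀ ς x = correlation γ Δ V₀ {x.1, Δ.target x} fun v => (ς v : ℂ) := by
  unfold edgeCorrelation correlation
  simp only [Finset.prod_pair hx]

/-- Half the decrease of the correlation of the ends of `x` by postselection. -/
def edgeGain (γ : ℝ) (Δ : Configuration n d) (V₀ : Finset (Fin n)) (ς : Fin n → ℝ)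
    (x : HalfEdge n d) : ℝ :=
  -(1 / 2) * (edgeCorrelation γ Δ V₀ ς x - edgeCorrelation γ Δ V₀ 0 x).re

/-- A sign vector on `V₀`, extended by zero. -/
def signExtend (V₀ : Finset (Fin n)) (σ : V₀ → ℤˣ) (v : Fin n) : ℝ :=
  if h : v ∈ V₀ then ((σ ⟨v, h⟩ : ℤ) : ℝ) else 0

theorem signExtend_sq (V₀ : Finset (Fin n)) (σ : V₀ → ℤˣ) {v : Fin n} (hv : v ∈ V₀) :
    signExtend V₀ σ v * signExtend V₀ σ v = 1 := by
  simp only [signExtend, hv, dif_pos]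
  rcases Int.units_eq_one_or (σ ⟨v, hv⟩) with h | h <;> simp [h]

theorem spin_real (b : Bool) : ∃ r : ℝ, spin b = r ∧ (r = 1 ∨ r = -1) := by
  cases b
  · exact ⟨1, by simp [spin], Or.inl rfl⟩
  · exact ⟨-1, by simp [spin], Or.inr rfl⟩

theorem cutOperator_eq_diagonal (Δ : Configuration n d) :
    cutOperator Δ = Matrix.diagonal fun z =>
      (1 / 4 : ℂ) * ∑ x : HalfEdge n d, (1 - spin (z x.1) * spin (z (Δ.target x))) := by
  unfold cutOperator pauliZ
  simp only [Matrix.diagonal_mul_diagonal]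
  ext z y
  rw [Matrix.smul_apply, Matrix.sum_apply]
  by_cases h : z = y
  · subst h
    simp [← Finset.mul_sum]
    ring
  · simp [Matrix.diagonal_apply_ne _ h, Matrix.one_apply_ne h]

theorem braket_diagonal (f : Bits n → ℂ) (ψ : Bits n → ℂ) :
    braket (Matrix.diagonal f) ψ = (∑ z, f z * ((‖ψ z‖ ^ 2 : ℝ) : ℂ)).re := by
  unfold braket dotProduct
  congr 1
  refine sum_congr rfl fun z _ => ?_
  rw [Matrix.mulVec_diagonal, ← Complex.normSq_eq_norm_sq, Complex.normSq_eq_conj_mul_self,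
    Pi.star_apply]
  simp only [RCLike.star_def]
  ring

theorem projector_eq (V₀ : Finset (Fin n)) (σ : V₀ → ℤˣ) :
    projector V₀ σ = Matrix.diagonal fun z =>
      (2 ^ V₀.card : ℂ)⁻¹ * ∏ v ∈ V₀, (1 + (signExtend V₀ σ v : ℂ) * spin (z v)) := by
  unfold projector
  congr 1
  funext z
  have h : ∏ v ∈ V₀, (1 + (signExtend V₀ σ v : ℂ) * spin (z v)) =
      ∏ v : V₀, (1 + ((σ v : ℤ) : ℂ) * spin (z v)) := by
    rw [← Finset.prod_coe_sort]
    refine prod_congr rfl fun v _ => ?_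
    simp [signExtend]
  rw [h, Finset.prod_div_distrib]
  simp [div_eq_inv_mul]

theorem prod_one_add_sq (V₀ : Finset (Fin n)) (σ : V₀ → ℤˣ) (z : Bits n) :
    (∏ v ∈ V₀, (1 + (signExtend V₀ σ v : ℂ) * spin (z v))) *
      (∏ v ∈ V₀, (1 + (signExtend V₀ σ v : ℂ) * spin (z v))) =
      2 ^ V₀.card * ∏ v ∈ V₀, (1 + (signExtend V₀ σ v : ℂ) * spin (z v)) := by
  have : (2 : ℂ) ^ V₀.card = ∏ _v ∈ V₀, 2 := by simp
  rw [this, ← Finset.prod_mul_distrib, ← Finset.prod_mul_distrib]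
  refine prod_congr rfl fun v hv => ?_
  have h1 : (signExtend V₀ σ v : ℂ) * signExtend V₀ σ v = 1 := by
    exact_mod_cast signExtend_sq V₀ σ hv
  have h2 := spin_mul_self (z v)
  linear_combination spin (z v) * spin (z v) * h1 + h2

theorem prod_one_add_real (V₀ : Finset (Fin n)) (σ : V₀ → ℤˣ) (z : Bits n) :
    ∃ r : ℝ, 0 ≤ r ∧ ∏ v ∈ V₀, (1 + (signExtend V₀ σ v : ℂ) * spin (z v)) = r := by
  choose s hs hs' using fun v => spin_real (z v)
  refine ⟨∏ v ∈ V₀, (1 + signExtend V₀ σ v * s v), ?_, ?_⟩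
  · refine prod_nonneg fun v hv => ?_
    have h1 := signExtend_sq V₀ σ hv
    rcases hs' v with h | h <;> rw [h] <;> nlinarith [sq_nonneg (signExtend V₀ σ v)]
  · push_cast
    exact prod_congr rfl fun v _ => by rw [hs]

/-- All outcomes have the same probability, so the gain of postselection is a difference of
correlations, summed over the edges. Every edge occurs twice in the sum over half-edges, and
`edgeGain` is half the decrease of the correlation. -/
theorem gain_eq_sum (γ : ℝ) (Δ : Configuration n 3) {V₀ : Finset (Fin n)}
    (hS : IsSeparated Δ V₀) (σ : V₀ → ℤˣ) :
    gain Δ (qaoaState (-(Real.pi / 4)) γ Δ) V₀ σ =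
      1 / 2 * ∑ x, edgeGain γ Δ V₀ (signExtend V₀ σ) x := by
  set ψ := qaoaState (-(Real.pi / 4)) γ Δ with hψ
  set w : Bits n → ℂ := fun z => ∏ v ∈ V₀, (1 + (signExtend V₀ σ v : ℂ) * spin (z v)) with hw
  have h2k : (2 ^ V₀.card : ℂ) ≠ 0 := pow_ne_zero _ two_ne_zero
  have hnorm1 : ∑ z, w z * ((‖ψ z‖ ^ 2 : ℝ) : ℂ) = 1 := by
    have := correlation_empty γ Δ hS fun v => (signExtend V₀ σ v : ℂ)
    simpa [correlation] using this
  have hnorm0 : ∑ z, ((‖ψ z‖ ^ 2 : ℝ) : ℂ) = 1 := by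
    have := correlation_empty γ Δ hS fun v => 0
    simpa [correlation] using this
  -- the probability of the outcome does not depend on the signs
  have hprob : normSquared ((projector V₀ σ).mulVec ψ) = (2 ^ V₀.card : ℝ)⁻¹ := by
    have : ((normSquared ((projector V₀ σ).mulVec ψ) : ℝ) : ℂ) = (2 ^ V₀.card : ℂ)⁻¹ := by
      unfold normSquared
      rw [← mul_one (2 ^ V₀.card : ℂ)⁻¹, ← hnorm1, Finset.mul_sum, Complex.ofReal_sum]
      refine sum_congr rfl fun z _ => ?_
      rw [projector_eq, Matrix.mulVec_diagonal]
      obtain ⟨r, hr0, hr⟩ := prod_one_add_real V₀ σ z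
      have hsq := prod_one_add_sq V₀ σ z
      simp only [hw]
      rw [hr] at hsq ⊢
      have hn : ‖(2 ^ V₀.card : ℂ)⁻¹ * (r : ℂ) * ψ z‖ ^ 2 =
          (2 ^ V₀.card : ℝ)⁻¹ ^ 2 * (r * r) * ‖ψ z‖ ^ 2 := by
        rw [norm_mul, norm_mul, norm_inv, norm_pow, Complex.norm_real, Real.norm_of_nonneg hr0]
        simp only [Complex.norm_ofNat]
        ring
      rw [hn]
      push_cast
      rw [hsq]
      field_simp
    apply Complex.ofReal_injective
    rw [this]
    push_cast
    rfl
  have hP : projector V₀ σ * cutOperator Δ * projector V₀ σ = Matrix.diagonal fun z =>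
      (2 ^ V₀.card : ℂ)⁻¹ * (w z *
        ((1 / 4 : ℂ) * ∑ x : HalfEdge n 3, (1 - spin (z x.1) * spin (z (Δ.target x))))) := by
    rw [projector_eq, cutOperator_eq_diagonal, Matrix.diagonal_mul_diagonal,
      Matrix.diagonal_mul_diagonal]
    congr 1
    funext z
    have hsq := prod_one_add_sq V₀ σ z
    simp only [hw]
    field_simp
    linear_combination (∑ x : HalfEdge n 3, (1 - spin (z x.1) * spin (z (Δ.target x)))) * hsq
  have hcut : ∀ (f : Bits n → ℂ), ∑ z, f z * ((‖ψ z‖ ^ 2 : ℝ) : ℂ) = 1 →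
      ∑ z, (f z * ((1 / 4 : ℂ) * ∑ x : HalfEdge n 3,
        (1 - spin (z x.1) * spin (z (Δ.target x))))) * ((‖ψ z‖ ^ 2 : ℝ) : ℂ) =
      (1 / 4 : ℂ) * ∑ x : HalfEdge n 3, (1 - ∑ z, (spin (z x.1) * spin (z (Δ.target x))) * f z *
        ((‖ψ z‖ ^ 2 : ℝ) : ℂ)) := by
    intro f hf
    rw [Finset.sum_sub_distrib, Finset.sum_comm (s := univ) (t := univ)]
    have : ∑ _x : HalfEdge n 3, (1 : ℂ) = ∑ _x : HalfEdge n 3,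
        ∑ z, f z * ((‖ψ z‖ ^ 2 : ℝ) : ℂ) := by rw [hf]
    rw [this, Finset.sum_comm, ← Finset.sum_sub_distrib, Finset.mul_sum]
    refine sum_congr rfl fun z _ => ?_
    rw [← Finset.sum_sub_distrib, mul_comm (f z), mul_assoc, mul_assoc, Finset.sum_mul]
    congr 1
    refine sum_congr rfl fun x _ => ?_
    ring
  unfold gain
  rw [hprob, hP, cutOperator_eq_diagonal, braket_diagonal, braket_diagonal]
  have e1 : ∑ z, (2 ^ V₀.card : ℂ)⁻¹ * (w z * ((1 / 4 : ℂ) * ∑ x : HalfEdge n 3,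
      (1 - spin (z x.1) * spin (z (Δ.target x))))) * ((‖ψ z‖ ^ 2 : ℝ) : ℂ) =
      (((2 ^ V₀.card : ℝ)⁻¹ : ℝ) : ℂ) * ((1 / 4 : ℂ) * ∑ x : HalfEdge n 3,
        (1 - edgeCorrelation γ Δ V₀ (signExtend V₀ σ) x)) := by
    have := hcut w hnorm1
    unfold edgeCorrelation
    rw [← this, Finset.mul_sum]
    push_cast
    exact sum_congr rfl fun z _ => by ring
  have e2 : ∑ z, (1 / 4 : ℂ) * (∑ x : HalfEdge n 3,
      (1 - spin (z x.1) * spin (z (Δ.target x)))) * ((‖ψ z‖ ^ 2 : ℝ) : ℂ) =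
      (1 / 4 : ℂ) * ∑ x : HalfEdge n 3, (1 - edgeCorrelation γ Δ V₀ 0 x) := by
    have := hcut (fun _ => 1) (by simpa using hnorm0)
    unfold edgeCorrelation
    simpa using this
  rw [e1, e2, Complex.re_ofReal_mul, mul_div_cancel_left₀ _ (by positivity)]
  unfold edgeGain
  rw [← Complex.sub_re, ← mul_sub, ← Finset.sum_sub_distrib]
  simp only [sub_sub_sub_cancel_left]
  rw [show (1 / 4 : ℂ) = ((1 / 4 : ℝ) : ℂ) by push_cast; rfl, Complex.re_ofReal_mul, Complex.re_sum,
    ← Finset.mul_sum, ← mul_assoc]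
  simp only [Complex.sub_re, Finset.sum_sub_distrib]
  ring

/-- Both correlations lie in `[-1, 1]`. -/
theorem edgeGain_le_one (γ : ℝ) (Δ : Configuration n 3) {V₀ : Finset (Fin n)}
    (hS : IsSeparated Δ V₀) (σ : V₀ → ℤˣ) (x : HalfEdge n 3) :
    edgeGain γ Δ V₀ (signExtend V₀ σ) x ≤ 1 := by
  have key : ∀ (ς : Fin n → ℝ), (∀ z : Bits n, ∃ r : ℝ, 0 ≤ r ∧
      ∏ v ∈ V₀, (1 + (ς v : ℂ) * spin (z v)) = r) →
      |(edgeCorrelation γ Δ V₀ ς x).re| ≤ 1 := by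
    intro ς hς
    choose r hr0 hr using hς
    have h1 := correlation_empty γ Δ hS fun v => (ς v : ℂ)
    unfold correlation at h1
    simp only [prod_empty, one_mul, hr] at h1
    have h1' : ∑ z, r z * ‖qaoaState (-(Real.pi / 4)) γ Δ z‖ ^ 2 = 1 := by exact_mod_cast h1
    rw [← h1']
    unfold edgeCorrelation
    rw [Complex.re_sum]
    refine (Finset.abs_sum_le_sum_abs _ _).trans (sum_le_sum fun z _ => ?_)
    obtain ⟨s, hs, hs'⟩ := spin_real (z x.1)
    obtain ⟨t, ht, ht'⟩ := spin_real (z (Δ.target x))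
    rw [hs, ht, hr, ← Complex.ofReal_mul, ← Complex.ofReal_mul, ← Complex.ofReal_mul,
      Complex.ofReal_re, abs_mul, abs_mul, abs_of_nonneg (hr0 z),
      abs_of_nonneg (sq_nonneg ‖qaoaState (-(Real.pi / 4)) γ Δ z‖)]
    have : |s * t| = 1 := by
      rcases hs' with h | h <;> rcases ht' with h' | h' <;> simp [h, h']
    rw [this, one_mul]
  have h1 := abs_le.1 (key _ (prod_one_add_real V₀ σ))
  have h0 := abs_le.1 (key 0 fun z => ⟨1, zero_le_one, by simp⟩)
  unfold edgeGain
  rw [Complex.sub_re]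
  linarith [h1.1, h0.2]

/-! ### Short cycles -/

/-- Half-edges of the edges that do not meet `V₀`. -/
def IsFree (Δ : Configuration n d) (V₀ : Finset (Fin n)) (x : HalfEdge n d) : Prop :=
  x.1 ∉ V₀ ∧ Δ.target x ∉ V₀

open Classical in
/-- The centre of the star that contains `w`, or `w` itself if `w` lies in no star. -/
def hub (Δ : Configuration n d) (V₀ : Finset (Fin n)) (w : Fin n) : Fin n :=
  if h : ∃ x : HalfEdge n d, x.1 ∈ V₀ ∧ Δ.target x = w then h.choose.1 else w

/-- The vertex `v` has `d` distinct neighbours. -/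
def IsRegularStar (Δ : Configuration n d) (v : Fin n) : Prop :=
  (Function.Injective fun i => Δ.target (v, i)) ∧ ∀ i, Δ.target (v, i) ≠ v

/-- If `w` lies in a star, then this star has `d` distinct leaves. -/
def HasRegularHub (Δ : Configuration n d) (V₀ : Finset (Fin n)) (w : Fin n) : Prop :=
  hub Δ V₀ w ∈ V₀ → IsRegularStar Δ (hub Δ V₀ w)

/-- The edge of `x` joins two vertices with the same hub. -/
def ClosesOne (Δ : Configuration n d) (V₀ : Finset (Fin n)) (x : HalfEdge n d) : Prop :=
  IsFree Δ V₀ x ∧ hub Δ V₀ x.1 = hub Δ V₀ (Δ.target x)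

/-- Two edges at the same vertex lead to vertices with the same hub. -/
def ClosesTwo (Δ : Configuration n d) (V₀ : Finset (Fin n)) (x h : HalfEdge n d) : Prop :=
  IsFree Δ V₀ x ∧ IsFree Δ V₀ h ∧ h.1 = x.1 ∧ h ≠ x ∧
    hub Δ V₀ (Δ.target x) = hub Δ V₀ (Δ.target h)

/-- Edges at the two ends of the edge of `x` lead to vertices with the same hub. -/
def ClosesThree (Δ : Configuration n d) (V₀ : Finset (Fin n)) (x h h' : HalfEdge n d) : Prop :=
  IsFree Δ V₀ x ∧ IsFree Δ V₀ h ∧ IsFree Δ V₀ h' ∧ h.1 = x.1 ∧ h ≠ x ∧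
    h'.1 = Δ.target x ∧ h' ≠ Δ.1 x ∧ hub Δ V₀ x.1 ≠ hub Δ V₀ (Δ.target x) ∧
    hub Δ V₀ (Δ.target h) = hub Δ V₀ (Δ.target h')

/-- There is no short cycle at the vertex `w`, and the stars around it are regular. -/
structure IsGoodVertex (Δ : Configuration n d) (V₀ : Finset (Fin n)) (w : Fin n) : Prop where
  notMem : w ∉ V₀
  not_closesOne : ∀ h : HalfEdge n d, h.1 = w → ¬ ClosesOne Δ V₀ h
  not_closesTwo : ∀ x h : HalfEdge n d, x.1 = w → ¬ ClosesTwo Δ V₀ x h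
  regular : HasRegularHub Δ V₀ w
  regular_target : ∀ h : HalfEdge n d, h.1 = w → IsFree Δ V₀ h →
    HasRegularHub Δ V₀ (Δ.target h)

theorem hub_target {Δ : Configuration n d} {V₀ : Finset (Fin n)} (hS : IsSeparated Δ V₀)
    {x : HalfEdge n d} (hx : x.1 ∈ V₀) : hub Δ V₀ (Δ.target x) = x.1 := by
  have h : ∃ y : HalfEdge n d, y.1 ∈ V₀ ∧ Δ.target y = Δ.target x := ⟨x, hx, rfl⟩
  unfold hub
  rw [dif_pos h]
  exact hS.2 _ _ h.choose_spec.1 hx h.choose_spec.2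

/-- A set whose hull is separated by the hubs is treelike. -/
theorem isTreelike_of_hub {Δ : Configuration n d} {V₀ Q : Finset (Fin n)} (hS : IsSeparated Δ V₀)
    (hQ : Disjoint Q V₀)
    (hQQ : ∀ u ∈ Q, ∀ w ∈ Q, hub Δ V₀ u = hub Δ V₀ w → u = w)
    (hQE : ∀ u ∈ Q, ∀ h ∈ outer Δ V₀ Q, hub Δ V₀ u ≠ hub Δ V₀ (Δ.target h))
    (hEE : ∀ h ∈ outer Δ V₀ Q, ∀ h' ∈ outer Δ V₀ Q,
      hub Δ V₀ (Δ.target h) = hub Δ V₀ (Δ.target h') → h = h')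
    (hreg : ∀ u ∈ hull Δ V₀ Q, HasRegularHub Δ V₀ u) : IsTreelike Δ V₀ Q := by
  have hinj : ∀ u ∈ hull Δ V₀ Q, ∀ w ∈ hull Δ V₀ Q, hub Δ V₀ u = hub Δ V₀ w → u = w := by
    intro u hu w hw huw
    rcases mem_union.1 hu with hu | hu <;> rcases mem_union.1 hw with hw | hw
    · exact hQQ u hu w hw huw
    · obtain ⟨h, hh, rfl⟩ := mem_image.1 hw
      exact absurd huw (hQE u hu h hh)
    · obtain ⟨h, hh, rfl⟩ := mem_image.1 hu
      exact absurd huw.symm (hQE w hw h hh)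
    · obtain ⟨h, hh, rfl⟩ := mem_image.1 hu
      obtain ⟨h', hh', rfl⟩ := mem_image.1 hw
      rw [hEE h hh h' hh' huw]
  have hr : ∀ x : HalfEdge n d, x.1 ∈ V₀ → Δ.target x ∈ hull Δ V₀ Q → IsRegularStar Δ x.1 := by
    intro x hx hxL
    have := hreg _ hxL
    unfold HasRegularHub at this
    rw [hub_target hS hx] at this
    exact this hx
  refine ⟨hQ, fun h hh h' hh' he => hEE h hh h' hh' (by rw [he]), ?_, hr⟩
  intro x y hx hxy hxL hyL
  have h1 : Δ.target x = Δ.target y := hinj _ hxL _ hyL (by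
    rw [hub_target hS hx, hub_target hS (hxy ▸ hx), hxy])
  have hx' : x = (x.1, x.2) := rfl
  have hy' : y = (x.1, y.2) := Prod.ext hxy.symm rfl
  have h2 : x.2 = y.2 := (hr x hx hxL).1 (by
    change Δ.target (x.1, x.2) = Δ.target (x.1, y.2)
    rw [← hy']; exact h1)
  exact Prod.ext hxy h2

theorem IsGoodVertex.isTreelike {Δ : Configuration n d} {V₀ : Finset (Fin n)}
    (hS : IsSeparated Δ V₀) {w : Fin n} (hw : IsGoodVertex Δ V₀ w) : IsTreelike Δ V₀ {w} := by
  have hE : ∀ h ∈ outer Δ V₀ {w}, h.1 = w ∧ IsFree Δ V₀ h := by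
    intro h hh
    obtain ⟨h1, h2, h3⟩ := (mem_filter.1 hh).2
    rw [mem_singleton] at h1
    exact ⟨h1, h1 ▸ hw.notMem, h2⟩
  refine isTreelike_of_hub hS (by simpa using hw.notMem) ?_ ?_ ?_ ?_
  · intro u hu v hv _
    rw [mem_singleton.1 hu, mem_singleton.1 hv]
  · intro u hu h hh he
    rw [mem_singleton.1 hu] at he
    obtain ⟨h1, h2⟩ := hE h hh
    exact hw.not_closesOne h h1 ⟨h2, h1 ▸ he⟩
  · intro h hh h' hh' he
    obtain ⟨h1, h2⟩ := hE h hh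
    obtain ⟨h1', h2'⟩ := hE h' hh'
    by_contra hne
    exact hw.not_closesTwo h h' h1 ⟨h2, h2', h1'.trans h1.symm, Ne.symm hne, he⟩
  · intro u hu
    rcases mem_union.1 hu with hu | hu
    · rw [mem_singleton.1 hu]; exact hw.regular
    · obtain ⟨h, hh, rfl⟩ := mem_image.1 hu
      exact hw.regular_target h (hE h hh).1 (hE h hh).2

theorem IsGoodVertex.target_ne {Δ : Configuration n d} {V₀ : Finset (Fin n)} {w : Fin n}
    (hw : IsGoodVertex Δ V₀ w) (j : Fin d) : Δ.target (w, j) ≠ w := by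
  intro h
  exact hw.not_closesOne (w, j) rfl ⟨⟨hw.notMem, h.symm ▸ hw.notMem⟩, by rw [h]⟩

theorem isFree_symm {Δ : Configuration n d} {V₀ : Finset (Fin n)} {x : HalfEdge n d}
    (hx : IsFree Δ V₀ x) : IsFree Δ V₀ (Δ.1 x) := by
  unfold IsFree
  rw [Δ.target_apply]
  exact ⟨hx.2, hx.1⟩

/-- An edge between good vertices is treelike unless it lies in the middle of a short cycle. -/
theorem isTreelike_pair {Δ : Configuration n d} {V₀ : Finset (Fin n)}
    (hS : IsSeparated Δ V₀) {x y : HalfEdge n d} (hxy : Δ.1 x = y) (hx : IsFree Δ V₀ x)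
    (h1 : IsGoodVertex Δ V₀ x.1) (h2 : IsGoodVertex Δ V₀ y.1)
    (h3 : ∀ h h', ¬ ClosesThree Δ V₀ x h h') :
    IsTreelike Δ V₀ {x.1, y.1} ∧ x.1 ≠ y.1 ∧
    ∀ h : HalfEdge n d, h.1 ∈ ({x.1, y.1} : Finset (Fin n)) →
      Δ.target h ∈ ({x.1, y.1} : Finset (Fin n)) → h = x ∨ h = y := by
  subst hxy
  have hy : IsFree Δ V₀ (Δ.1 x) := isFree_symm hx
  have hty : Δ.target (Δ.1 x) = x.1 := Δ.target_apply x
  have htx : Δ.target x = (Δ.1 x).1 := rfl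
  have hub_ne : hub Δ V₀ x.1 ≠ hub Δ V₀ (Δ.1 x).1 := fun h => h1.not_closesOne x rfl ⟨hx, h⟩
  have hne : x.1 ≠ (Δ.1 x).1 := fun h => hub_ne (by rw [← h])
  have hmem : ∀ u ∈ ({x.1, (Δ.1 x).1} : Finset (Fin n)), u = x.1 ∨ u = (Δ.1 x).1 := by
    intro u hu; simpa using hu
  have hnot : ∀ u ∈ ({x.1, (Δ.1 x).1} : Finset (Fin n)), u ∉ V₀ := by
    intro u hu
    rcases hmem u hu with rfl | rfl
    exacts [h1.notMem, h2.notMem]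
  have hE : ∀ h ∈ outer Δ V₀ {x.1, (Δ.1 x).1}, IsFree Δ V₀ h ∧ h ≠ x ∧ h ≠ Δ.1 x ∧
      (h.1 = x.1 ∨ h.1 = (Δ.1 x).1) := by
    intro h hh
    obtain ⟨e1, e2, e3⟩ := (mem_filter.1 hh).2
    refine ⟨⟨hnot _ e1, e2⟩, ?_, ?_, hmem _ e1⟩
    · rintro rfl; exact e3 (by rw [htx]; simp)
    · rintro rfl; exact e3 (by rw [hty]; simp)
  refine ⟨isTreelike_of_hub hS (Finset.disjoint_left.2 hnot) ?_ ?_ ?_ ?_, hne, ?_⟩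
  · intro u hu w hw he
    rcases hmem u hu with rfl | rfl <;> rcases hmem w hw with rfl | rfl
    · rfl
    · exact absurd he hub_ne
    · exact absurd he.symm hub_ne
    · rfl
  · intro u hu h hh he
    obtain ⟨f, hx', hy', e⟩ := hE h hh
    rcases hmem u hu with rfl | rfl <;> rcases e with e | e
    · exact h1.not_closesOne h e ⟨f, e ▸ he⟩
    · exact h2.not_closesTwo (Δ.1 x) h rfl ⟨hy, f, e, hy', by rw [hty]; exact he⟩
    · exact h1.not_closesTwo x h rfl ⟨hx, f, e, hx', he⟩
    · exact h2.not_closesOne h e ⟨f, e ▸ he⟩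
  · intro h hh h' hh' he
    obtain ⟨f, hx', hy', e⟩ := hE h hh
    obtain ⟨f', hx'', hy'', e'⟩ := hE h' hh'
    by_contra hhne
    rcases e with e | e <;> rcases e' with e' | e'
    · exact h1.not_closesTwo h h' e ⟨f, f', e'.trans e.symm, Ne.symm hhne, he⟩
    · exact h3 h h' ⟨hx, f, f', e, hx', e', hy'', hub_ne, he⟩
    · exact h3 h' h ⟨hx, f', f, e', hx'', e, hy', hub_ne, he.symm⟩
    · exact h2.not_closesTwo h h' e ⟨f, f', e'.trans e.symm, Ne.symm hhne, he⟩
  · intro u hu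
    rcases mem_union.1 hu with hu | hu
    · rcases hmem u hu with rfl | rfl
      exacts [h1.regular, h2.regular]
    · obtain ⟨h, hh, rfl⟩ := mem_image.1 hu
      obtain ⟨f, hx', hy', e | e⟩ := hE h hh
      exacts [h1.regular_target h e f, h2.regular_target h e f]
  · intro h hh hh'
    rcases hmem _ hh with e | e <;> rcases hmem _ hh' with e' | e'
    · exact absurd (show ClosesOne Δ V₀ h from ⟨⟨e ▸ h1.notMem, e' ▸ h1.notMem⟩, by rw [e, e']⟩)
        (h1.not_closesOne h e)
    · left
      by_contra hne
      exact h1.not_closesTwo x h rfl ⟨hx, ⟨e ▸ h1.notMem, e' ▸ h2.notMem⟩, e, hne, by rw [e', htx]⟩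
    · right
      by_contra hne
      exact h2.not_closesTwo (Δ.1 x) h rfl
        ⟨hy, ⟨e ▸ h2.notMem, e' ▸ h1.notMem⟩, e, hne, by rw [e', hty]⟩
    · exact absurd (show ClosesOne Δ V₀ h from ⟨⟨e ▸ h2.notMem, e' ▸ h2.notMem⟩, by rw [e, e']⟩)
        (h2.not_closesOne h e)

/-! ### The gain of a single edge -/

/-- The optimal angle `γ` of depth-1 QAOA on 3-regular graphs. -/
def optimalAngle : ℝ := Real.arctan (1 / Real.sqrt 2)

theorem cos_optimalAngle_sq : Real.cos optimalAngle ^ 2 = 2 / 3 := by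
  unfold optimalAngle
  rw [Real.cos_sq_arctan, div_pow, Real.sq_sqrt (by norm_num)]
  norm_num

theorem sin_optimalAngle_sq : Real.sin optimalAngle ^ 2 = 1 / 3 := by
  rw [Real.sin_sq, cos_optimalAngle_sq]; norm_num

theorem sin_optimalAngle_nonneg : 0 ≤ Real.sin optimalAngle := by
  refine Real.sin_nonneg_of_nonneg_of_le_pi ?_ ?_
  · exact Real.arctan_nonneg.2 (by positivity)
  · exact (Real.arctan_lt_pi_div_two _).le.trans (by linarith [Real.pi_pos])

theorem sin_optimalAngle_le : Real.sin optimalAngle ≤ 0.57736 := by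
  have := sin_optimalAngle_sq
  nlinarith [sin_optimalAngle_nonneg]

instance (Δ : Configuration n d) (V₀ : Finset (Fin n)) (x : HalfEdge n d) :
    Decidable (IsFree Δ V₀ x) := inferInstanceAs (Decidable (_ ∧ _))

/-- The weight of the vertex of `V₀` at the other end of the edge of `h`, if it lies in `V₀`. -/
def directWeight (Δ : Configuration n d) (V₀ : Finset (Fin n)) (ς : Fin n → ℝ)
    (h : HalfEdge n d) : ℝ := if Δ.target h ∈ V₀ then ς (Δ.target h) else 0

/-- The weight of the star at the other end of the edge of `h`, if this edge does not meet `V₀`. -/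
def remoteWeight (Δ : Configuration n d) (V₀ : Finset (Fin n)) (ς : Fin n → ℝ)
    (h : HalfEdge n d) : ℝ := if IsFree Δ V₀ h then leafSum Δ V₀ ς (Δ.target h) else 0

/-- The sum of the remote weights of the two half-edges that share the vertex of `x`. -/
def remoteSum (Δ : Configuration n 3) (V₀ : Finset (Fin n)) (ς : Fin n → ℝ)
    (x : HalfEdge n 3) : ℝ :=
  remoteWeight Δ V₀ ς (x.1, x.2 + 1) + remoteWeight Δ V₀ ς (x.1, x.2 + 2)

/-- The product of the remote weights of the two half-edges that share the vertex of `x`. -/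
def remoteProd (Δ : Configuration n 3) (V₀ : Finset (Fin n)) (ς : Fin n → ℝ)
    (x : HalfEdge n 3) : ℝ :=
  remoteWeight Δ V₀ ς (x.1, x.2 + 1) * remoteWeight Δ V₀ ς (x.1, x.2 + 2)

theorem leafSum_ofReal (Δ : Configuration n d) (V₀ : Finset (Fin n)) (ς : Fin n → ℝ) (w : Fin n) :
    leafSum Δ V₀ (fun v => (ς v : ℂ)) w = ((leafSum Δ V₀ ς w : ℝ) : ℂ) := by
  unfold leafSum
  rw [Complex.ofReal_sum]
  exact sum_congr rfl fun j _ => by split_ifs <;> simp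

theorem sum_fin_three (f : Fin 3 → ℝ) (j : Fin 3) : ∑ i, f i = f j + f (j + 1) + f (j + 2) := by
  rw [Fin.sum_univ_three]
  fin_cases j <;> simp <;> ring

theorem leafSum_eq_directWeight (Δ : Configuration n 3) (V₀ : Finset (Fin n)) (ς : Fin n → ℝ)
    (x : HalfEdge n 3) :
    leafSum Δ V₀ ς x.1 = directWeight Δ V₀ ς x + directWeight Δ V₀ ς (x.1, x.2 + 1) +
      directWeight Δ V₀ ς (x.1, x.2 + 2) :=
  sum_fin_three (fun j => directWeight Δ V₀ ς (x.1, j)) x.2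

theorem starBias_optimalAngle : starBias optimalAngle =
    ((-(2 / 3) * Real.sin optimalAngle * (Real.sqrt 2)⁻¹ : ℝ) : ℂ) := by
  unfold starBias invSqrtTwo
  rw [← Complex.ofReal_pow, cos_optimalAngle_sq]
  push_cast; ring

theorem oddFactor_optimalAngle (Δ : Configuration n d) (V₀ : Finset (Fin n)) (ς : Fin n → ℝ)
    (h : HalfEdge n d) (hh : h.1 ∉ V₀) :
    oddFactor optimalAngle Δ V₀ (fun v => (ς v : ℂ)) h =
      ((Real.sin optimalAngle * (Real.sqrt 2)⁻¹ * directWeight Δ V₀ ς h -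
        2 / 9 * (Real.sqrt 2)⁻¹ * remoteWeight Δ V₀ ς h : ℝ) : ℂ) := by
  unfold oddFactor directWeight remoteWeight
  have hs := sin_optimalAngle_sq
  by_cases ht : Δ.target h ∈ V₀
  · have : ¬ IsFree Δ V₀ h := fun h' => h'.2 ht
    simp [ht, this, invSqrtTwo]
    ring
  · have : IsFree Δ V₀ h := ⟨hh, ht⟩
    simp only [ht, this, if_true, if_false]
    rw [starBias_optimalAngle, leafSum_ofReal, ← Complex.ofReal_mul, ← Complex.ofReal_mul]
    congr 1
    linear_combination (-(2 / 3) * (Real.sqrt 2)⁻¹ * leafSum Δ V₀ ς (Δ.target h)) * hs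

theorem directWeight_mul_eq_zero {Δ : Configuration n d} {V₀ Q : Finset (Fin n)}
    (hS : IsSeparated Δ V₀) (hT : IsTreelike Δ V₀ Q) (ς : Fin n → ℝ) {w : Fin n} (hw : w ∈ Q)
    {j k : Fin d} (hjk : j ≠ k) (hj : Δ.target (w, j) ∈ V₀) :
    directWeight Δ V₀ ς (w, k) = 0 := by
  unfold directWeight
  refine if_neg fun hk => ?_
  have hl : w ∈ hull Δ V₀ Q := mem_union_left _ hw
  have h1 := Δ.target_apply (w, j)
  have h2 := Δ.target_apply (w, k)
  have := hT.unique (Δ.1 (w, j)) (Δ.1 (w, k)) hj (hS.2 _ _ hj hk (h1.trans h2.symm))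
    (h1.symm ▸ hl) (h2.symm ▸ hl)
  have := Δ.2.1.injective this
  exact hjk (Prod.ext_iff.1 this).2

theorem directWeight_mul_directWeight {Δ : Configuration n d} {V₀ Q : Finset (Fin n)}
    (hS : IsSeparated Δ V₀) (hT : IsTreelike Δ V₀ Q) (ς : Fin n → ℝ) {w : Fin n} (hw : w ∈ Q)
    {j k : Fin d} (hjk : j ≠ k) :
    directWeight Δ V₀ ς (w, j) * directWeight Δ V₀ ς (w, k) = 0 := by
  by_cases hj : Δ.target (w, j) ∈ V₀
  · rw [directWeight_mul_eq_zero hS hT ς hw hjk hj, mul_zero]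
  · simp [directWeight, hj]

theorem directWeight_mul_remoteWeight (Δ : Configuration n d) (V₀ : Finset (Fin n)) (ς : Fin n → ℝ)
    (h : HalfEdge n d) : directWeight Δ V₀ ς h * remoteWeight Δ V₀ ς h = 0 := by
  by_cases ht : Δ.target h ∈ V₀
  · have : ¬ IsFree Δ V₀ h := fun h' => h'.2 ht
    simp [remoteWeight, this]
  · simp [directWeight, ht]

theorem leafSum_zero (Δ : Configuration n d) (V₀ : Finset (Fin n)) (w : Fin n) :
    leafSum Δ V₀ (0 : Fin n → ℝ) w = 0 := by simp [leafSum]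

theorem remoteWeight_zero (Δ : Configuration n d) (V₀ : Finset (Fin n)) (h : HalfEdge n d) :
    remoteWeight Δ V₀ 0 h = 0 := by simp [remoteWeight, leafSum_zero]

theorem inv_sqrt_two_sq : (Real.sqrt 2)⁻¹ ^ 2 = 1 / 2 := by
  rw [inv_pow, Real.sq_sqrt (by norm_num)]; norm_num

/-- The contribution to the gain of an edge that does not meet `V₀`, as a polynomial in the
signs of the stars around it. -/
def freeGain (Δ : Configuration n 3) (V₀ : Finset (Fin n)) (ς : Fin n → ℝ)
    (x : HalfEdge n 3) : ℝ :=
  -(1 / 12) * (leafSum Δ V₀ ς x.1 * leafSum Δ V₀ ς (Δ.1 x).1) +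
    5 / 162 * Real.sin optimalAngle * (leafSum Δ V₀ ς x.1 * remoteSum Δ V₀ ς (Δ.1 x) +
      leafSum Δ V₀ ς (Δ.1 x).1 * remoteSum Δ V₀ ς x) -
    1 / 243 * (remoteSum Δ V₀ ς x * remoteSum Δ V₀ ς (Δ.1 x)) +
    1 / 108 * (leafSum Δ V₀ ς x.1 * remoteSum Δ V₀ ς x +
      leafSum Δ V₀ ς (Δ.1 x).1 * remoteSum Δ V₀ ς (Δ.1 x)) -
    Real.sin optimalAngle / 162 * (remoteProd Δ V₀ ς x + remoteProd Δ V₀ ς (Δ.1 x))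

/-- The contribution to the gain of an edge that joins the vertex of `x` to `V₀`. -/
def boundaryGain (Δ : Configuration n 3) (V₀ : Finset (Fin n)) (ς : Fin n → ℝ)
    (x : HalfEdge n 3) : ℝ :=
  -(1 / 27) * (leafSum Δ V₀ ς x.1 * remoteSum Δ V₀ ς x) -
    Real.sin optimalAngle / 162 * remoteProd Δ V₀ ς x

/-- The first summand is the correlation without postselection, the same for all treelike edges. -/
theorem edgeCorrelation_of_isFree {Δ : Configuration n 3} {V₀ : Finset (Fin n)}
    (hS : IsSeparated Δ V₀) (ς : Fin n → ℝ) {x : HalfEdge n 3} (hx : IsFree Δ V₀ x)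
    (h1 : IsGoodVertex Δ V₀ x.1) (h2 : IsGoodVertex Δ V₀ (Δ.target x))
    (h3 : ∀ h h', ¬ ClosesThree Δ V₀ x h h') :
    edgeCorrelation optimalAngle Δ V₀ ς x =
      ((-(2 / 3) * Real.sin optimalAngle - 2 * freeGain Δ V₀ ς x : ℝ) : ℂ) := by
  obtain ⟨hT, hne, hint⟩ := isTreelike_pair hS rfl hx h1 h2 h3
  have hj : ∀ j : Fin 3, j + 1 ≠ j + 2 := by decide
  have hd : ∀ y : HalfEdge n 3, y.1 ∈ ({x.1, (Δ.1 x).1} : Finset (Fin n)) → Δ.target y ∉ V₀ →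
      leafSum Δ V₀ ς y.1 = directWeight Δ V₀ ς (y.1, y.2 + 1) +
        directWeight Δ V₀ ς (y.1, y.2 + 2) ∧
      directWeight Δ V₀ ς (y.1, y.2 + 1) * directWeight Δ V₀ ς (y.1, y.2 + 2) = 0 ∧
      directWeight Δ V₀ ς (y.1, y.2 + 1) * remoteWeight Δ V₀ ς (y.1, y.2 + 1) = 0 ∧
      directWeight Δ V₀ ς (y.1, y.2 + 2) * remoteWeight Δ V₀ ς (y.1, y.2 + 2) = 0 := by
    intro y hy ht
    refine ⟨?_, directWeight_mul_directWeight hS hT ς hy (hj _),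
      directWeight_mul_remoteWeight _ _ _ _, directWeight_mul_remoteWeight _ _ _ _⟩
    rw [leafSum_eq_directWeight]
    simp [directWeight, ht]
  obtain ⟨a1, a2, a3, a4⟩ := hd x (by simp) hx.2
  obtain ⟨b1, b2, b3, b4⟩ := hd (Δ.1 x) (by simp) (by rw [Δ.target_apply]; exact hx.1)
  have hy1 : (Δ.1 x).1 ∉ V₀ := hx.2
  rw [edgeCorrelation_eq_correlation _ _ _ _ _ hne]
  change correlation optimalAngle Δ V₀ {x.1, (Δ.1 x).1} _ = _
  rw [correlation_pair optimalAngle Δ hS x (Δ.1 x) rfl hT _ hne hint _ rfl,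
    oddFactor_optimalAngle Δ V₀ ς (x.1, x.2 + 1) hx.1,
    oddFactor_optimalAngle Δ V₀ ς (x.1, x.2 + 2) hx.1,
    oddFactor_optimalAngle Δ V₀ ς ((Δ.1 x).1, (Δ.1 x).2 + 1) hy1,
    oddFactor_optimalAngle Δ V₀ ς ((Δ.1 x).1, (Δ.1 x).2 + 2) hy1, leafSum_ofReal,
    leafSum_ofReal, starBias_optimalAngle]
  unfold freeGain remoteSum remoteProd
  rw [a1, b1]
  have hs := sin_optimalAngle_sq
  have hc := cos_optimalAngle_sq
  have hr := inv_sqrt_two_sq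
  generalize directWeight Δ V₀ ς (x.1, x.2 + 1) = d1 at *
  generalize directWeight Δ V₀ ς (x.1, x.2 + 2) = d2 at *
  generalize directWeight Δ V₀ ς ((Δ.1 x).1, (Δ.1 x).2 + 1) = d3 at *
  generalize directWeight Δ V₀ ς ((Δ.1 x).1, (Δ.1 x).2 + 2) = d4 at *
  generalize remoteWeight Δ V₀ ς (x.1, x.2 + 1) = m1 at *
  generalize remoteWeight Δ V₀ ς (x.1, x.2 + 2) = m2 at *
  generalize remoteWeight Δ V₀ ς ((Δ.1 x).1, (Δ.1 x).2 + 1) = m3 at *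
  generalize remoteWeight Δ V₀ ς ((Δ.1 x).1, (Δ.1 x).2 + 2) = m4 at *
  generalize Real.sin optimalAngle = s at *
  generalize Real.cos optimalAngle = c at *
  generalize (Real.sqrt 2)⁻¹ = r at *
  -- the products of the odd factors at either end
  have hP : (s * r * d1 - 2 / 9 * r * m1) * (s * r * d2 - 2 / 9 * r * m2) =
      -(1 / 9) * s * ((d1 + d2) * (m1 + m2)) + 2 / 81 * (m1 * m2) := by
    linear_combination (s ^ 2 * (d1 * d2) - 2 / 9 * s * (d1 * m2 + d2 * m1) + 4 / 81 * (m1 * m2)) *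
      hr + 1 / 2 * s ^ 2 * a2 + 1 / 9 * s * (a3 + a4)
  have hP' : (s * r * d3 - 2 / 9 * r * m3) * (s * r * d4 - 2 / 9 * r * m4) =
      -(1 / 9) * s * ((d3 + d4) * (m3 + m4)) + 2 / 81 * (m3 * m4) := by
    linear_combination (s ^ 2 * (d3 * d4) - 2 / 9 * s * (d3 * m4 + d4 * m3) + 4 / 81 * (m3 * m4)) *
      hr + 1 / 2 * s ^ 2 * b2 + 1 / 9 * s * (b3 + b4)
  have hreal : 1 / 2 * (c ^ 2 * ((s * r * d1 - 2 / 9 * r * m1) + (s * r * d2 - 2 / 9 * r * m2)) *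
      ((s * r * d3 - 2 / 9 * r * m3) + (s * r * d4 - 2 / 9 * r * m4)) - 2 * s * c ^ 2 +
      s * ((s * r * d1 - 2 / 9 * r * m1) * (s * r * d2 - 2 / 9 * r * m2) +
        (s * r * d3 - 2 / 9 * r * m3) * (s * r * d4 - 2 / 9 * r * m4)) -
      c ^ 2 * ((-(2 / 3) * s * r) * (d3 + d4) *
        ((s * r * d1 - 2 / 9 * r * m1) + (s * r * d2 - 2 / 9 * r * m2)) +
        (-(2 / 3) * s * r) * (d1 + d2) *
        ((s * r * d3 - 2 / 9 * r * m3) + (s * r * d4 - 2 / 9 * r * m4))) +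
      (-(2 / 3) * s * r) * (d1 + d2) * ((-(2 / 3) * s * r) * (d3 + d4))) =
      -(2 / 3) * s - 2 * (-(1 / 12) * ((d1 + d2) * (d3 + d4)) +
        5 / 162 * s * ((d1 + d2) * (m3 + m4) + (d3 + d4) * (m1 + m2)) -
        1 / 243 * ((m1 + m2) * (m3 + m4)) +
        1 / 108 * ((d1 + d2) * (m1 + m2) + (d3 + d4) * (m3 + m4)) -
        s / 162 * (m1 * m2 + m3 * m4)) := by
    rw [hP, hP', hc]
    linear_combination (1 / 3 * (s * (d1 + d2) - 2 / 9 * (m1 + m2)) *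
        (s * (d3 + d4) - 2 / 9 * (m3 + m4)) +
      2 / 9 * s * ((d3 + d4) * (s * (d1 + d2) - 2 / 9 * (m1 + m2)) +
        (d1 + d2) * (s * (d3 + d4) - 2 / 9 * (m3 + m4))) +
      2 / 9 * s ^ 2 * ((d1 + d2) * (d3 + d4))) * hr +
      (1 / 2 * ((d1 + d2) * (d3 + d4)) -
        1 / 18 * ((d1 + d2) * (m1 + m2) + (d3 + d4) * (m3 + m4))) * hs
  rw [← hreal]
  push_cast
  ring

theorem freeGain_zero (Δ : Configuration n 3) (V₀ : Finset (Fin n)) (x : HalfEdge n 3) :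
    freeGain Δ V₀ 0 x = 0 := by
  simp [freeGain, remoteSum, remoteProd, leafSum_zero, remoteWeight_zero]

theorem edgeGain_of_isFree {Δ : Configuration n 3} {V₀ : Finset (Fin n)}
    (hS : IsSeparated Δ V₀) (ς : Fin n → ℝ) {x : HalfEdge n 3} (hx : IsFree Δ V₀ x)
    (h1 : IsGoodVertex Δ V₀ x.1) (h2 : IsGoodVertex Δ V₀ (Δ.target x))
    (h3 : ∀ h h', ¬ ClosesThree Δ V₀ x h h') :
    edgeGain optimalAngle Δ V₀ ς x = freeGain Δ V₀ ς x := by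
  unfold edgeGain
  rw [edgeCorrelation_of_isFree hS ς hx h1 h2 h3, edgeCorrelation_of_isFree hS 0 hx h1 h2 h3,
    freeGain_zero, ← Complex.ofReal_sub, Complex.ofReal_re]
  ring

/-- The magnetization of a leaf of a star. -/
theorem correlation_leaf {Δ : Configuration n 3} {V₀ : Finset (Fin n)}
    (hS : IsSeparated Δ V₀) (ς : Fin n → ℝ) {x : HalfEdge n 3} (hx : Δ.target x ∈ V₀)
    (h1 : IsGoodVertex Δ V₀ x.1) :
    leafSum Δ V₀ ς x.1 = ς (Δ.target x) ∧
    correlation optimalAngle Δ V₀ {x.1} (fun v => (ς v : ℂ)) =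
      ((-(2 / 3) * Real.sin optimalAngle * ς (Δ.target x) + 2 / 27 * remoteSum Δ V₀ ς x +
        Real.sin optimalAngle / 81 * (ς (Δ.target x) * remoteProd Δ V₀ ς x) : ℝ) : ℂ) := by
  have hT := h1.isTreelike hS
  have hj : ∀ j : Fin 3, j ≠ j + 1 ∧ j ≠ j + 2 := by decide
  have e0 : directWeight Δ V₀ ς x = ς (Δ.target x) := if_pos hx
  have e1 : directWeight Δ V₀ ς (x.1, x.2 + 1) = 0 :=
    directWeight_mul_eq_zero hS hT ς (mem_singleton_self _) (hj x.2).1 hx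
  have e2 : directWeight Δ V₀ ς (x.1, x.2 + 2) = 0 :=
    directWeight_mul_eq_zero hS hT ς (mem_singleton_self _) (hj x.2).2 hx
  have e3 : remoteWeight Δ V₀ ς x = 0 := if_neg fun h => h.2 hx
  have hl : leafSum Δ V₀ ς x.1 = ς (Δ.target x) := by
    rw [leafSum_eq_directWeight, e0, e1, e2, add_zero, add_zero]
  refine ⟨hl, ?_⟩
  rw [correlation_singleton optimalAngle Δ hS x.1 hT _ h1.target_ne x.2,
    oddFactor_optimalAngle Δ V₀ ς (x.1, x.2) h1.notMem,
    oddFactor_optimalAngle Δ V₀ ς (x.1, x.2 + 1) h1.notMem,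
    oddFactor_optimalAngle Δ V₀ ς (x.1, x.2 + 2) h1.notMem, starBias_optimalAngle,
    leafSum_ofReal, Prod.mk.eta, e0, e1, e2, e3, hl]
  unfold remoteSum remoteProd invSqrtTwo
  have hc := cos_optimalAngle_sq
  have hr := inv_sqrt_two_sq
  generalize remoteWeight Δ V₀ ς (x.1, x.2 + 1) = m1 at *
  generalize remoteWeight Δ V₀ ς (x.1, x.2 + 2) = m2 at *
  generalize ς (Δ.target x) = a at *
  generalize Real.sin optimalAngle = s at *
  generalize Real.cos optimalAngle = c at *
  generalize (Real.sqrt 2)⁻¹ = r at *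
  have hreal : -(2 / 3) * s * a + 2 / 27 * (m1 + m2) + s / 81 * (a * (m1 * m2)) =
      r * ((-(2 / 3) * s * r) * a - c ^ 2 * ((s * r * a - 2 / 9 * r * 0) +
        (s * r * 0 - 2 / 9 * r * m1) + (s * r * 0 - 2 / 9 * r * m2)) +
        (s * r * a - 2 / 9 * r * 0) * (s * r * 0 - 2 / 9 * r * m1) *
          (s * r * 0 - 2 / 9 * r * m2)) := by
    rw [hc]
    linear_combination (4 / 3 * s * a - 4 / 27 * (m1 + m2) -
      4 / 81 * s * (a * (m1 * m2)) * (r ^ 2 + 1 / 2)) * hr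
  rw [hreal]
  push_cast
  ring

/-- With postselection, the correlation is the sign of the end in `V₀` times the magnetization of
the other end; powers of this sign are reduced by `hς`. -/
theorem edgeGain_of_target_mem {Δ : Configuration n 3} {V₀ : Finset (Fin n)}
    (hS : IsSeparated Δ V₀) (ς : Fin n → ℝ) (hς : ∀ v ∈ V₀, ς v * ς v = 1) {x : HalfEdge n 3}
    (hx : Δ.target x ∈ V₀) (h1 : IsGoodVertex Δ V₀ x.1) :
    edgeGain optimalAngle Δ V₀ ς x = boundaryGain Δ V₀ ς x := by
  obtain ⟨hl, hc⟩ := correlation_leaf hS ς hx h1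
  obtain ⟨-, hc0⟩ := correlation_leaf hS 0 hx h1
  obtain ⟨-, hc1⟩ := correlation_leaf hS (Pi.single (Δ.target x) 1) hx h1
  have hne : x.1 ≠ Δ.target x := fun h => h1.notMem (h ▸ hx)
  have hm : ∀ h : HalfEdge n 3, h.1 = x.1 →
      remoteWeight Δ V₀ (Pi.single (Δ.target x) 1) h = 0 := by
    intro h hh
    unfold remoteWeight
    split_ifs with hf
    · refine sum_eq_zero fun i _ => ?_
      split_ifs with hi
      · refine Pi.single_eq_of_ne (fun he => h1.not_closesOne h hh ⟨hf, ?_⟩) _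
        have e1 := hub_target hS (x := Δ.1 (Δ.target h, i)) hi
        have e2 := hub_target hS (x := Δ.1 x) hx
        rw [Δ.target_apply] at e1 e2
        rw [hh, e2]
        exact he.symm.trans e1.symm
      · rfl
    · rfl
  have hσ : edgeCorrelation optimalAngle Δ V₀ ς x = (ς (Δ.target x) : ℂ) *
      correlation optimalAngle Δ V₀ {x.1} (fun v => (ς v : ℂ)) := by
    unfold edgeCorrelation correlation
    rw [Finset.mul_sum]
    refine sum_congr rfl fun z _ => ?_
    rw [← Finset.mul_prod_erase V₀ _ hx, prod_singleton]
    have h2 : (ς (Δ.target x) : ℂ) * ς (Δ.target x) = 1 := by exact_mod_cast hς _ hx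
    have h3 := spin_mul_self (z (Δ.target x))
    generalize ∏ v ∈ V₀.erase (Δ.target x), (1 + (ς v : ℂ) * spin (z v)) = P
    generalize ((‖qaoaState (-(Real.pi / 4)) optimalAngle Δ z‖ ^ 2 : ℝ) : ℂ) = q
    linear_combination (spin (z x.1) * ς (Δ.target x) * P * q) * h3 -
      (spin (z x.1) * spin (z (Δ.target x)) * P * q) * h2
  -- without postselection, `Z_v` is the difference of the observables `1 + Z_v` and `1`
  have h0 : edgeCorrelation optimalAngle Δ V₀ 0 x =
      correlation optimalAngle Δ V₀ {x.1}
        (fun v => ((Pi.single (Δ.target x) 1 : Fin n → ℝ) v : ℂ)) -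
      correlation optimalAngle Δ V₀ {x.1} (fun v => ((0 : Fin n → ℝ) v : ℂ)) := by
    unfold edgeCorrelation correlation
    rw [← Finset.sum_sub_distrib]
    refine sum_congr rfl fun z _ => ?_
    have h2 : ∏ v ∈ V₀, (1 + ((Pi.single (Δ.target x) 1 : Fin n → ℝ) v : ℂ) * spin (z v)) =
        1 + spin (z (Δ.target x)) := by
      rw [← Finset.mul_prod_erase V₀ _ hx, Finset.prod_eq_one]
      · simp
      · intro v hv
        simp [Pi.single_eq_of_ne (Finset.ne_of_mem_erase hv)]
    rw [h2]
    simp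
    ring
  unfold edgeGain
  rw [hσ, h0, hc, hc0, hc1, ← Complex.ofReal_mul, ← Complex.ofReal_sub, ← Complex.ofReal_sub,
    Complex.ofReal_re]
  unfold boundaryGain
  have hs1 : remoteSum Δ V₀ (Pi.single (Δ.target x) 1) x = 0 := by
    simp [remoteSum, hm]
  have hp1 : remoteProd Δ V₀ (Pi.single (Δ.target x) 1) x = 0 := by
    simp [remoteProd, hm]
  have hs0 : remoteSum Δ V₀ 0 x = 0 := by simp [remoteSum, remoteWeight_zero]
  rw [hs1, hp1, hs0, hl]
  have h2 := hς _ hx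
  simp only [Pi.single_eq_same, Pi.zero_apply]
  linear_combination (1 / 3 * Real.sin optimalAngle -
    Real.sin optimalAngle / 162 * remoteProd Δ V₀ ς x) * h2

/-! ### The gain in terms of the neighbourhoods of the stars -/

theorem sum_half_edges (f : HalfEdge n 3 → ℝ) :
    ∑ x, f x = ∑ w, (f (w, 0) + f (w, 1) + f (w, 2)) := by
  rw [Fintype.sum_prod_type]
  exact sum_congr rfl fun w _ => by rw [Fin.sum_univ_three]

theorem sum_comp_matching (Δ : Configuration n d) (V₀ : Finset (Fin n)) (f : HalfEdge n d → ℝ) :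
    ∑ x with IsFree Δ V₀ x, f (Δ.1 x) = ∑ x with IsFree Δ V₀ x, f x := by
  refine Finset.sum_nbij' (fun x => Δ.1 x) (fun x => Δ.1 x) ?_ ?_ ?_ ?_ ?_
  · intro x hx
    simp only [mem_filter, mem_univ, true_and] at hx ⊢
    exact isFree_symm hx
  · intro x hx
    simp only [mem_filter, mem_univ, true_and] at hx ⊢
    exact isFree_symm hx
  · intro x _; exact Δ.2.1 x
  · intro x _; exact Δ.2.1 x
  · intro x _; rfl

theorem leafSum_one_nonneg (Δ : Configuration n d) (V₀ : Finset (Fin n)) (w : Fin n) :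
    0 ≤ leafSum Δ V₀ (1 : Fin n → ℝ) w :=
  sum_nonneg fun j _ => by split_ifs <;> simp

theorem leafSum_one_le (Δ : Configuration n d) (V₀ : Finset (Fin n)) (w : Fin n) :
    leafSum Δ V₀ (1 : Fin n → ℝ) w ≤ d := by
  refine (sum_le_sum (g := fun _ => (1 : ℝ)) fun j _ => ?_).trans (by simp)
  split_ifs <;> simp

theorem abs_leafSum_le (Δ : Configuration n d) (V₀ : Finset (Fin n)) {ς : Fin n → ℝ}
    (hς : ∀ v, |ς v| ≤ 1) (w : Fin n) : |leafSum Δ V₀ ς w| ≤ leafSum Δ V₀ 1 w := by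
  refine (Finset.abs_sum_le_sum_abs _ _).trans (sum_le_sum fun j _ => ?_)
  split_ifs
  · exact hς _
  · simp

theorem remoteWeight_one_nonneg (Δ : Configuration n d) (V₀ : Finset (Fin n)) (h : HalfEdge n d) :
    0 ≤ remoteWeight Δ V₀ 1 h := by
  unfold remoteWeight
  split_ifs
  exacts [leafSum_one_nonneg _ _ _, le_rfl]

theorem remoteWeight_one_le (Δ : Configuration n d) (V₀ : Finset (Fin n)) (h : HalfEdge n d) :
    remoteWeight Δ V₀ 1 h ≤ d := by
  unfold remoteWeight
  split_ifs
  exacts [leafSum_one_le _ _ _, Nat.cast_nonneg d]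

theorem abs_remoteWeight_le (Δ : Configuration n d) (V₀ : Finset (Fin n)) {ς : Fin n → ℝ}
    (hς : ∀ v, |ς v| ≤ 1) (h : HalfEdge n d) :
    |remoteWeight Δ V₀ ς h| ≤ remoteWeight Δ V₀ 1 h := by
  unfold remoteWeight
  split_ifs
  exacts [abs_leafSum_le Δ V₀ hς _, by simp]

theorem remoteWeight_of_mem (Δ : Configuration n d) (V₀ : Finset (Fin n)) (ς : Fin n → ℝ)
    {h : HalfEdge n d} (hh : h.1 ∈ V₀) : remoteWeight Δ V₀ ς h = 0 := if_neg fun h' => h'.1 hh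

theorem remoteSum_of_mem (Δ : Configuration n 3) (V₀ : Finset (Fin n)) (ς : Fin n → ℝ)
    {x : HalfEdge n 3} (hx : x.1 ∈ V₀) : remoteSum Δ V₀ ς x = 0 := by
  unfold remoteSum
  rw [remoteWeight_of_mem Δ V₀ ς (h := (x.1, x.2 + 1)) hx,
    remoteWeight_of_mem Δ V₀ ς (h := (x.1, x.2 + 2)) hx, add_zero]

theorem remoteProd_of_mem (Δ : Configuration n 3) (V₀ : Finset (Fin n)) (ς : Fin n → ℝ)
    {x : HalfEdge n 3} (hx : x.1 ∈ V₀) : remoteProd Δ V₀ ς x = 0 := by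
  unfold remoteProd
  rw [remoteWeight_of_mem Δ V₀ ς (h := (x.1, x.2 + 1)) hx, zero_mul]

theorem remoteSum_one_nonneg (Δ : Configuration n 3) (V₀ : Finset (Fin n)) (x : HalfEdge n 3) :
    0 ≤ remoteSum Δ V₀ 1 x :=
  add_nonneg (remoteWeight_one_nonneg _ _ _) (remoteWeight_one_nonneg _ _ _)

theorem remoteSum_one_le (Δ : Configuration n 3) (V₀ : Finset (Fin n)) (x : HalfEdge n 3) :
    remoteSum Δ V₀ 1 x ≤ 6 := by
  have h1 := remoteWeight_one_le Δ V₀ (x.1, x.2 + 1)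
  have h2 := remoteWeight_one_le Δ V₀ (x.1, x.2 + 2)
  unfold remoteSum
  push_cast at h1 h2
  linarith

theorem abs_remoteSum_le (Δ : Configuration n 3) (V₀ : Finset (Fin n)) {ς : Fin n → ℝ}
    (hς : ∀ v, |ς v| ≤ 1) (x : HalfEdge n 3) : |remoteSum Δ V₀ ς x| ≤ remoteSum Δ V₀ 1 x :=
  (abs_add_le _ _).trans
    (add_le_add (abs_remoteWeight_le Δ V₀ hς _) (abs_remoteWeight_le Δ V₀ hς _))

theorem abs_remoteProd_le (Δ : Configuration n 3) (V₀ : Finset (Fin n)) {ς : Fin n → ℝ}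
    (hς : ∀ v, |ς v| ≤ 1) (x : HalfEdge n 3) : |remoteProd Δ V₀ ς x| ≤ 9 := by
  unfold remoteProd
  rw [abs_mul]
  have h1 := (abs_remoteWeight_le Δ V₀ hς (x.1, x.2 + 1)).trans (remoteWeight_one_le Δ V₀ _)
  have h2 := (abs_remoteWeight_le Δ V₀ hς (x.1, x.2 + 2)).trans (remoteWeight_one_le Δ V₀ _)
  push_cast at h1 h2
  have := mul_le_mul h1 h2 (abs_nonneg _) (by norm_num)
  linarith

theorem abs_freeGain_le (Δ : Configuration n 3) (V₀ : Finset (Fin n)) {ς : Fin n → ℝ}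
    (hς : ∀ v, |ς v| ≤ 1) (x : HalfEdge n 3) : |freeGain Δ V₀ ς x| ≤ 3 := by
  have hl : ∀ w, |leafSum Δ V₀ ς w| ≤ 3 := fun w => by
    have := (abs_leafSum_le Δ V₀ hς w).trans (leafSum_one_le Δ V₀ w)
    push_cast at this; exact this
  have hr : ∀ y, |remoteSum Δ V₀ ς y| ≤ 6 := fun y =>
    (abs_remoteSum_le Δ V₀ hς y).trans (remoteSum_one_le Δ V₀ y)
  have hp := abs_remoteProd_le Δ V₀ hς
  have hmul : ∀ {a b A B : ℝ}, |a| ≤ A → |b| ≤ B → |a * b| ≤ A * B := by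
    intro a b A B ha hb
    rw [abs_mul]
    exact mul_le_mul ha hb (abs_nonneg _) ((abs_nonneg _).trans ha)
  have hs : |Real.sin optimalAngle| ≤ 0.57736 := by
    rw [abs_of_nonneg sin_optimalAngle_nonneg]; exact sin_optimalAngle_le
  have e1 := abs_le.1 (hmul (hl x.1) (hl (Δ.1 x).1))
  have e2 := abs_le.1 (hmul hs ((abs_add_le _ _).trans
    (add_le_add (hmul (hl x.1) (hr (Δ.1 x))) (hmul (hl (Δ.1 x).1) (hr x)))))
  have e3 := abs_le.1 (hmul (hr x) (hr (Δ.1 x)))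
  have e4 := abs_le.1 ((abs_add_le _ _).trans
    (add_le_add (hmul (hl x.1) (hr x)) (hmul (hl (Δ.1 x).1) (hr (Δ.1 x)))))
  have e5 := abs_le.1 (hmul hs ((abs_add_le _ _).trans (add_le_add (hp x) (hp (Δ.1 x)))))
  unfold freeGain
  rw [abs_le]
  constructor <;> linarith [e1.1, e1.2, e2.1, e2.2, e3.1, e3.2, e4.1, e4.2, e5.1, e5.2]

theorem abs_boundaryGain_le (Δ : Configuration n 3) (V₀ : Finset (Fin n)) {ς : Fin n → ℝ}
    (hς : ∀ v, |ς v| ≤ 1) (x : HalfEdge n 3) : |boundaryGain Δ V₀ ς x| ≤ 3 := by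
  have hl : |leafSum Δ V₀ ς x.1| ≤ 3 := by
    have := (abs_leafSum_le Δ V₀ hς x.1).trans (leafSum_one_le Δ V₀ x.1)
    push_cast at this; exact this
  have hr : |remoteSum Δ V₀ ς x| ≤ 6 :=
    (abs_remoteSum_le Δ V₀ hς x).trans (remoteSum_one_le Δ V₀ x)
  have hmul : ∀ {a b A B : ℝ}, |a| ≤ A → |b| ≤ B → |a * b| ≤ A * B := by
    intro a b A B ha hb
    rw [abs_mul]
    exact mul_le_mul ha hb (abs_nonneg _) ((abs_nonneg _).trans ha)
  have hs : |Real.sin optimalAngle| ≤ 0.57736 := by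
    rw [abs_of_nonneg sin_optimalAngle_nonneg]; exact sin_optimalAngle_le
  have e1 := abs_le.1 (hmul hl hr)
  have e2 := abs_le.1 (hmul hs (abs_remoteProd_le Δ V₀ hς x))
  unfold boundaryGain
  rw [abs_le]
  constructor <;> linarith [e1.1, e1.2, e2.1, e2.2]

/-- The half-edges outside `V₀` whose edge leads to `V₀`. -/
def boundary (Δ : Configuration n d) (V₀ : Finset (Fin n)) : Finset (HalfEdge n d) :=
  univ.filter fun x => x.1 ∉ V₀ ∧ Δ.target x ∈ V₀

theorem sum_free_add_sum_boundary (Δ : Configuration n d) (V₀ : Finset (Fin n))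
    (f : HalfEdge n d → ℝ) (hf : ∀ x : HalfEdge n d, x.1 ∈ V₀ → f x = 0) :
    ∑ x with IsFree Δ V₀ x, f x + ∑ x ∈ boundary Δ V₀, f x = ∑ x, f x := by
  unfold boundary
  rw [Finset.sum_filter, Finset.sum_filter, ← Finset.sum_add_distrib]
  refine sum_congr rfl fun x _ => ?_
  by_cases h1 : x.1 ∈ V₀
  · simp [hf x h1]
  · by_cases h2 : Δ.target x ∈ V₀ <;> simp [IsFree, h1, h2]

theorem sum_remoteProd (Δ : Configuration n 3) (V₀ : Finset (Fin n)) (ς : Fin n → ℝ) :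
    ∑ x, remoteProd Δ V₀ ς x = 1 / 2 * ∑ x, remoteWeight Δ V₀ ς x * remoteSum Δ V₀ ς x := by
  rw [sum_half_edges, sum_half_edges, Finset.mul_sum]
  refine sum_congr rfl fun w _ => ?_
  simp only [remoteProd, remoteSum, zero_add, show (1 : Fin 3) + 1 = 2 from rfl,
    show (1 : Fin 3) + 2 = 0 from rfl, show (2 : Fin 3) + 1 = 0 from rfl,
    show (2 : Fin 3) + 2 = 1 from rfl]
  ring

theorem sum_leafSum_mul_remoteSum (Δ : Configuration n 3) (V₀ : Finset (Fin n)) (ς : Fin n → ℝ) :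
    ∑ x, leafSum Δ V₀ ς x.1 * remoteSum Δ V₀ ς x =
      2 * ∑ x, leafSum Δ V₀ ς x.1 * remoteWeight Δ V₀ ς x := by
  rw [sum_half_edges, sum_half_edges, Finset.mul_sum]
  refine sum_congr rfl fun w _ => ?_
  simp only [remoteSum, zero_add, show (1 : Fin 3) + 1 = 2 from rfl,
    show (1 : Fin 3) + 2 = 0 from rfl, show (2 : Fin 3) + 1 = 0 from rfl,
    show (2 : Fin 3) + 2 = 1 from rfl]
  ring

theorem sum_boundary_leafSum_mul_remoteSum (Δ : Configuration n 3) (V₀ : Finset (Fin n))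
    (ς : Fin n → ℝ) :
    ∑ x ∈ boundary Δ V₀, leafSum Δ V₀ ς x.1 * remoteSum Δ V₀ ς x =
      ∑ x, leafSum Δ V₀ 1 x.1 * (leafSum Δ V₀ ς x.1 * remoteWeight Δ V₀ ς x) := by
  have hv : ∀ x : HalfEdge n 3,
      (if x.1 ∉ V₀ ∧ Δ.target x ∈ V₀ then leafSum Δ V₀ ς x.1 * remoteSum Δ V₀ ς x else 0) =
      (if Δ.target x ∈ V₀ then 1 else 0) * (leafSum Δ V₀ ς x.1 *
        (remoteWeight Δ V₀ ς (x.1, 0) + remoteWeight Δ V₀ ς (x.1, 1) +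
          remoteWeight Δ V₀ ς (x.1, 2))) := by
    intro x
    have hsum := sum_fin_three (fun j => remoteWeight Δ V₀ ς (x.1, j)) x.2
    rw [Fin.sum_univ_three] at hsum
    rw [hsum]
    by_cases h1 : x.1 ∈ V₀
    · rw [remoteWeight_of_mem Δ V₀ ς (h := (x.1, x.2)) h1,
        remoteWeight_of_mem Δ V₀ ς (h := (x.1, x.2 + 1)) h1,
        remoteWeight_of_mem Δ V₀ ς (h := (x.1, x.2 + 2)) h1]
      simp [h1]
    · by_cases h2 : Δ.target x ∈ V₀
      · have : remoteWeight Δ V₀ ς (x.1, x.2) = 0 := if_neg fun h => h.2 h2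
        rw [this]
        simp [h1, h2, remoteSum]
      · simp [h2]
  unfold boundary
  rw [Finset.sum_filter]
  simp only [hv]
  rw [sum_half_edges, sum_half_edges]
  refine sum_congr rfl fun w _ => ?_
  have hl : leafSum Δ V₀ (1 : Fin n → ℝ) w = (if Δ.target (w, 0) ∈ V₀ then 1 else 0) +
      (if Δ.target (w, 1) ∈ V₀ then 1 else 0) + (if Δ.target (w, 2) ∈ V₀ then 1 else 0) := by
    unfold leafSum
    rw [Fin.sum_univ_three]
    rfl
  rw [hl]
  ring

/-- The sum over the edges, rearranged: an edge between two leaves contributes through the product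
of their signs, and so do two edges at a vertex and three consecutive edges that lead to leaves. -/
theorem sum_freeGain_add_sum_boundaryGain (Δ : Configuration n 3) (V₀ : Finset (Fin n))
    (ς : Fin n → ℝ) :
    ∑ x with IsFree Δ V₀ x, freeGain Δ V₀ ς x + 2 * ∑ x ∈ boundary Δ V₀, boundaryGain Δ V₀ ς x =
      ∑ x, (-(5 / 108) - 5 / 54 * leafSum Δ V₀ 1 x.1) *
        (leafSum Δ V₀ ς x.1 * remoteWeight Δ V₀ ς x) +
      Real.sin optimalAngle / 18 * ∑ x, remoteWeight Δ V₀ ς x * remoteSum Δ V₀ ς x -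
      1 / 243 * ∑ x with IsFree Δ V₀ x, remoteSum Δ V₀ ς x * remoteSum Δ V₀ ς (Δ.1 x) := by
  have hm : ∀ f : HalfEdge n 3 → ℝ, ∑ x with IsFree Δ V₀ x, f x * leafSum Δ V₀ ς (Δ.1 x).1 =
      ∑ x, f x * remoteWeight Δ V₀ ς x := by
    intro f
    rw [Finset.sum_filter]
    refine sum_congr rfl fun x _ => ?_
    unfold remoteWeight
    split_ifs
    · rfl
    · rw [mul_zero]
  have h1 := hm fun x => leafSum Δ V₀ ς x.1
  have h2 := hm (remoteSum Δ V₀ ς)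
  simp only [mul_comm (remoteSum Δ V₀ ς _) (remoteWeight Δ V₀ ς _)] at h2
  have h3 := sum_comp_matching Δ V₀ fun x => remoteSum Δ V₀ ς x * leafSum Δ V₀ ς (Δ.1 x).1
  have h4 := sum_comp_matching Δ V₀ fun x => leafSum Δ V₀ ς x.1 * remoteSum Δ V₀ ς x
  have h5 := sum_comp_matching Δ V₀ fun x => remoteProd Δ V₀ ς x
  have h6 := sum_free_add_sum_boundary Δ V₀ (remoteProd Δ V₀ ς) fun x hx =>
    remoteProd_of_mem Δ V₀ ς hx
  have h7 := sum_free_add_sum_boundary Δ V₀ (fun x => leafSum Δ V₀ ς x.1 * remoteSum Δ V₀ ς x)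
    fun x hx => by rw [remoteSum_of_mem Δ V₀ ς hx, mul_zero]
  rw [sum_remoteProd] at h6
  rw [sum_leafSum_mul_remoteSum] at h7
  have h8 := sum_boundary_leafSum_mul_remoteSum Δ V₀ ς
  have hinv : ∀ x, Δ.1 (Δ.1 x) = x := Δ.2.1
  simp only [hinv] at h3
  have e1 : ∑ x with IsFree Δ V₀ x, freeGain Δ V₀ ς x =
      -(1 / 12) * ∑ x with IsFree Δ V₀ x, leafSum Δ V₀ ς x.1 * leafSum Δ V₀ ς (Δ.1 x).1 +
      5 / 162 * Real.sin optimalAngle *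
        (∑ x with IsFree Δ V₀ x, remoteSum Δ V₀ ς (Δ.1 x) * leafSum Δ V₀ ς x.1 +
        ∑ x with IsFree Δ V₀ x, remoteSum Δ V₀ ς x * leafSum Δ V₀ ς (Δ.1 x).1) -
      1 / 243 * ∑ x with IsFree Δ V₀ x, remoteSum Δ V₀ ς x * remoteSum Δ V₀ ς (Δ.1 x) +
      1 / 108 * (∑ x with IsFree Δ V₀ x, leafSum Δ V₀ ς x.1 * remoteSum Δ V₀ ς x +
        ∑ x with IsFree Δ V₀ x, leafSum Δ V₀ ς (Δ.1 x).1 * remoteSum Δ V₀ ς (Δ.1 x)) -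
      Real.sin optimalAngle / 162 * (∑ x with IsFree Δ V₀ x, remoteProd Δ V₀ ς x +
        ∑ x with IsFree Δ V₀ x, remoteProd Δ V₀ ς (Δ.1 x)) := by
    simp only [← Finset.sum_add_distrib, Finset.mul_sum, ← Finset.sum_sub_distrib]
    refine sum_congr rfl fun x _ => ?_
    unfold freeGain
    ring
  have e2 : ∑ x ∈ boundary Δ V₀, boundaryGain Δ V₀ ς x =
      -(1 / 27) * ∑ x ∈ boundary Δ V₀, leafSum Δ V₀ ς x.1 * remoteSum Δ V₀ ς x -
      Real.sin optimalAngle / 162 * ∑ x ∈ boundary Δ V₀, remoteProd Δ V₀ ς x := by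
    simp only [Finset.mul_sum, ← Finset.sum_sub_distrib]
    rfl
  have e3 : ∑ x, (-(5 / 108) - 5 / 54 * leafSum Δ V₀ 1 x.1) *
        (leafSum Δ V₀ ς x.1 * remoteWeight Δ V₀ ς x) =
      -(5 / 108) * ∑ x, leafSum Δ V₀ ς x.1 * remoteWeight Δ V₀ ς x - 5 / 54 *
        ∑ x, leafSum Δ V₀ 1 x.1 * (leafSum Δ V₀ ς x.1 * remoteWeight Δ V₀ ς x) := by
    simp only [Finset.mul_sum, ← Finset.sum_sub_distrib]
    exact sum_congr rfl fun x _ => by ring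
  rw [e1, e2, e3, h1, h3, h4, h5, h2, h8]
  rw [h8] at h7
  linear_combination 1 / 54 * h7 - Real.sin optimalAngle / 81 * h6

/-! ### The number of exceptional edges -/

open Classical in
/-- The number of edges (seen from both sides) that join two vertices with the same hub. -/
def numClosesOne (Δ : Configuration n d) (V₀ : Finset (Fin n)) : ℕ :=
  #{x : HalfEdge n d | ClosesOne Δ V₀ x}

open Classical in
/-- The number of pairs of edges at a vertex that lead to vertices with the same hub. -/
def numClosesTwo (Δ : Configuration n d) (V₀ : Finset (Fin n)) : ℕ :=
  #{p : HalfEdge n d × HalfEdge n d | ClosesTwo Δ V₀ p.1 p.2}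

open Classical in
/-- The number of edges with neighbouring edges at the two ends that lead to vertices with the same
hub. -/
def numClosesThree (Δ : Configuration n d) (V₀ : Finset (Fin n)) : ℕ :=
  #{p : HalfEdge n d × HalfEdge n d × HalfEdge n d | ClosesThree Δ V₀ p.1 p.2.1 p.2.2}

open Classical in
/-- The vertices of `V₀` whose star is not regular. -/
def irregular (Δ : Configuration n d) (V₀ : Finset (Fin n)) : Finset (Fin n) :=
  {v ∈ V₀ | ¬ IsRegularStar Δ v}

theorem mem_irregular {Δ : Configuration n d} {V₀ : Finset (Fin n)} {v : Fin n} :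
    v ∈ irregular Δ V₀ ↔ v ∈ V₀ ∧ ¬ IsRegularStar Δ v := by
  classical
  simp [irregular]

theorem hub_eq_or (Δ : Configuration n d) (V₀ : Finset (Fin n)) (w : Fin n) :
    hub Δ V₀ w = w ∨ ∃ x : HalfEdge n d, x.1 ∈ V₀ ∧ Δ.target x = w ∧ hub Δ V₀ w = x.1 := by
  unfold hub
  split_ifs with h
  · exact Or.inr ⟨h.choose, h.choose_spec.1, h.choose_spec.2, rfl⟩
  · exact Or.inl rfl

/-- A vertex with an irregular hub is an end of one of the edges of an irregular star. -/
theorem mem_of_not_hasRegularHub {Δ : Configuration n d} {V₀ : Finset (Fin n)} {w : Fin n}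
    (hw : w ∉ V₀) (h : ¬ HasRegularHub Δ V₀ w) :
    w ∈ (irregular Δ V₀ ×ˢ (univ : Finset (Fin d))).image Δ.target := by
  unfold HasRegularHub at h
  push Not at h
  rcases hub_eq_or Δ V₀ w with h' | ⟨x, hx, hxw, h'⟩
  · exact absurd (h' ▸ h.1) hw
  · rw [h'] at h
    exact mem_image.2 ⟨x, mem_product.2 ⟨mem_irregular.2 h, mem_univ _⟩, hxw⟩

open Classical in
/-- The vertices outside `V₀` with a short cycle or an irregular star nearby. -/
def badVertices (Δ : Configuration n d) (V₀ : Finset (Fin n)) : Finset (Fin n) :=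
  {w | w ∉ V₀ ∧ ¬ IsGoodVertex Δ V₀ w}

theorem card_badVertices_le (Δ : Configuration n 3) (V₀ : Finset (Fin n)) :
    #(badVertices Δ V₀) ≤
      numClosesOne Δ V₀ + numClosesTwo Δ V₀ + 12 * #(irregular Δ V₀) := by
  classical
  set I := irregular Δ V₀ ×ˢ (univ : Finset (Fin 3)) with hI
  set A : Finset (Fin n) :=
    ({x : HalfEdge n 3 | ClosesOne Δ V₀ x} : Finset (HalfEdge n 3)).image Prod.fst
  set B : Finset (Fin n) := ({p : HalfEdge n 3 × HalfEdge n 3 | ClosesTwo Δ V₀ p.1 p.2} :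
    Finset (HalfEdge n 3 × HalfEdge n 3)).image fun p => p.1.1
  set E := (I.image Δ.target ×ˢ (univ : Finset (Fin 3))).image Δ.target
  have hcI : #(I.image Δ.target) ≤ 3 * #(irregular Δ V₀) := by
    refine card_image_le.trans ?_
    rw [hI, card_product, card_univ, Fintype.card_fin, mul_comm]
  have hsub : badVertices Δ V₀ ⊆ (A ∪ B) ∪ (I.image Δ.target ∪ E) := by
    intro w hw
    obtain ⟨hw1, hw2⟩ := (mem_filter.1 hw).2
    by_contra hcon
    simp only [mem_union, not_or] at hcon
    obtain ⟨⟨hA, hB⟩, hC, hE⟩ := hcon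
    refine hw2 ⟨hw1, fun h hh hc => hA ?_, fun x h hx hc => hB ?_, ?_, fun h hh hf => ?_⟩
    · exact mem_image.2 ⟨h, mem_filter.2 ⟨mem_univ _, hc⟩, hh⟩
    · exact mem_image.2 ⟨(x, h), mem_filter.2 ⟨mem_univ _, hc⟩, hx⟩
    · by_contra hr
      exact hC (mem_of_not_hasRegularHub hw1 hr)
    · by_contra hr
      refine hE (mem_image.2 ⟨Δ.1 h, mem_product.2 ⟨?_, mem_univ _⟩, ?_⟩)
      · exact mem_of_not_hasRegularHub hf.2 hr
      · rw [Δ.target_apply, hh]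
  have h1 : #A ≤ numClosesOne Δ V₀ := card_image_le
  have h2 : #B ≤ numClosesTwo Δ V₀ := card_image_le
  have h3 : #E ≤ 3 * #(I.image Δ.target) := by
    refine card_image_le.trans ?_
    rw [card_product, card_univ, Fintype.card_fin, mul_comm]
  have := (card_le_card hsub).trans ((card_union_le _ _).trans
    (add_le_add (card_union_le _ _) (card_union_le _ _)))
  omega

/-- The edge of `x` has treelike surroundings. -/
def IsGoodEdge (Δ : Configuration n d) (V₀ : Finset (Fin n)) (x : HalfEdge n d) : Prop :=
  (x.1 ∉ V₀ → IsGoodVertex Δ V₀ x.1) ∧ (Δ.target x ∉ V₀ → IsGoodVertex Δ V₀ (Δ.target x)) ∧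
    (∀ h h', ¬ ClosesThree Δ V₀ x h h') ∧ ¬ (x.1 ∈ V₀ ∧ Δ.target x ∈ V₀)

open Classical in
/-- The half-edges whose edges do not have treelike surroundings. -/
def badEdges (Δ : Configuration n d) (V₀ : Finset (Fin n)) : Finset (HalfEdge n d) :=
  {x | ¬ IsGoodEdge Δ V₀ x}

/-- Each short cycle and each irregular star spoils boundedly many edges. -/
theorem card_badEdges_le (Δ : Configuration n 3) {V₀ : Finset (Fin n)} (hS : IsSeparated Δ V₀) :
    #(badEdges Δ V₀) ≤ 6 * numClosesOne Δ V₀ + 6 * numClosesTwo Δ V₀ + numClosesThree Δ V₀ +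
      75 * #(irregular Δ V₀) := by
  classical
  set A := badVertices Δ V₀ ×ˢ (univ : Finset (Fin 3)) with hA
  set B : Finset (HalfEdge n 3) := ({p : HalfEdge n 3 × HalfEdge n 3 × HalfEdge n 3 |
    ClosesThree Δ V₀ p.1 p.2.1 p.2.2} : Finset _).image Prod.fst
  set I := irregular Δ V₀ ×ˢ (univ : Finset (Fin 3)) with hI
  have hsub : badEdges Δ V₀ ⊆ (A ∪ A.image Δ.1) ∪ (B ∪ I) := by
    intro x hx
    have hx1 := (mem_filter.1 hx).2
    by_contra hcon
    simp only [mem_union, not_or] at hcon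
    obtain ⟨⟨h1, h2⟩, h3, h4⟩ := hcon
    refine hx1 ⟨fun h => ?_, fun h => ?_, fun h h' hc => h3 ?_, fun h => h4 ?_⟩
    · by_contra hb
      exact h1 (mem_product.2 ⟨mem_filter.2 ⟨mem_univ _, h, hb⟩, mem_univ _⟩)
    · by_contra hb
      exact h2 (mem_image.2 ⟨Δ.1 x, mem_product.2 ⟨mem_filter.2 ⟨mem_univ _, h, hb⟩, mem_univ _⟩,
        Δ.2.1 x⟩)
    · exact mem_image.2 ⟨(x, h, h'), mem_filter.2 ⟨mem_univ _, hc⟩, rfl⟩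
    · refine mem_product.2 ⟨mem_irregular.2 ⟨h.1, fun hr => ?_⟩, mem_univ _⟩
      exact hr.2 x.2 (hS.1 x h.1 h.2)
  have hcA : #A = #(badVertices Δ V₀) * 3 := by
    rw [hA, card_product, card_univ, Fintype.card_fin]
  have hcA' : #(A.image Δ.1) ≤ #A := card_image_le
  have hcB : #B ≤ numClosesThree Δ V₀ := card_image_le
  have hcI : #I = #(irregular Δ V₀) * 3 := by
    rw [hI, card_product, card_univ, Fintype.card_fin]
  have := card_badVertices_le Δ V₀
  have := (card_le_card hsub).trans ((card_union_le _ _).trans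
    (add_le_add (card_union_le _ _) (card_union_le _ _)))
  omega

/-- The part of the gain that grows linearly, with the products of signs replaced by `1`: a count of
paths of one, two and three edges, disjoint from `V₀`, whose two ends are adjacent to `V₀`. Here
`leafSum` with all weights `1` is the number of half-edges that lead from a vertex to `V₀`. -/
def mainTerm (Δ : Configuration n 3) (V₀ : Finset (Fin n)) : ℝ :=
  5 / 72 * ∑ x, leafSum Δ V₀ 1 x.1 * remoteWeight Δ V₀ 1 x +
    Real.sin optimalAngle / 36 * ∑ x, remoteWeight Δ V₀ 1 x * remoteSum Δ V₀ 1 x +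
    1 / 486 * ∑ x with IsFree Δ V₀ x, remoteSum Δ V₀ 1 x * remoteSum Δ V₀ 1 (Δ.1 x)

theorem leafSum_one_eq_card (Δ : Configuration n d) (V₀ : Finset (Fin n)) (w : Fin n) :
    leafSum Δ V₀ (1 : Fin n → ℝ) w = #{j : Fin d | Δ.target (w, j) ∈ V₀} := by
  unfold leafSum
  simp

/-- A vertex outside `V₀` with several half-edges to `V₀` lies in an irregular star. -/
theorem mem_of_two_le_leafSum {Δ : Configuration n d} {V₀ : Finset (Fin n)}
    (hS : IsSeparated Δ V₀) {w : Fin n} (hw : w ∉ V₀) (h : 1 < leafSum Δ V₀ (1 : Fin n → ℝ) w) :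
    w ∈ (irregular Δ V₀ ×ˢ (univ : Finset (Fin d))).image Δ.target := by
  rw [leafSum_one_eq_card] at h
  obtain ⟨i, hi, j, hj, hij⟩ := Finset.one_lt_card.1 (by exact_mod_cast h)
  simp only [mem_filter, mem_univ, true_and] at hi hj
  refine mem_of_not_hasRegularHub hw fun hr => ?_
  have h1 := hub_target hS (x := Δ.1 (w, i)) hi
  have h2 := hub_target hS (x := Δ.1 (w, j)) hj
  rw [Δ.target_apply] at h1 h2
  unfold HasRegularHub at hr
  rw [h1] at hr
  have e : Δ.1 (w, j) = ((Δ.1 (w, i)).1, (Δ.1 (w, j)).2) := Prod.ext (h2.symm.trans h1) rfl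
  have := (hr hi).1 (a₁ := (Δ.1 (w, i)).2) (a₂ := (Δ.1 (w, j)).2) (by
    change Δ.target (Δ.1 (w, i)) = Δ.target ((Δ.1 (w, i)).1, (Δ.1 (w, j)).2)
    rw [← e, Δ.target_apply, Δ.target_apply])
  have := Δ.2.1.injective (Prod.ext (h1.symm.trans h2) this : Δ.1 (w, i) = Δ.1 (w, j))
  exact hij (Prod.ext_iff.1 this).2

theorem leafSum_lt_of_isFree {Δ : Configuration n 3} {V₀ : Finset (Fin n)} {x : HalfEdge n 3}
    (hx : IsFree Δ V₀ x) : leafSum Δ V₀ (1 : Fin n → ℝ) x.1 ≤ 2 := by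
  rw [leafSum_one_eq_card]
  have : #{j : Fin 3 | Δ.target (x.1, j) ∈ V₀} < #(univ : Finset (Fin 3)) :=
    card_lt_card ((ssubset_univ_iff).2 fun h => hx.2 (by
      exact (mem_filter.1 (h.symm ▸ mem_univ x.2 :
        x.2 ∈ ({j : Fin 3 | Δ.target (x.1, j) ∈ V₀} : Finset (Fin 3)))).2))
  rw [card_univ, Fintype.card_fin] at this
  exact_mod_cast Nat.lt_succ_iff.1 this

/-- The signs enter through products only; replacing these by their absolute values gives
`mainTerm`. A leaf `x.1` of a regular star has `leafSum = 1`, for which the first coefficient is `-5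
/ 36`. -/
theorem sum_freeGain_le (Δ : Configuration n 3) {V₀ : Finset (Fin n)} (hS : IsSeparated Δ V₀)
    {ς : Fin n → ℝ} (hς : ∀ v, |ς v| ≤ 1) :
    ∑ x with IsFree Δ V₀ x, freeGain Δ V₀ ς x + 2 * ∑ x ∈ boundary Δ V₀, boundaryGain Δ V₀ ς x ≤
      2 * mainTerm Δ V₀ + 9 * #(irregular Δ V₀) := by
  classical
  set J := (irregular Δ V₀ ×ˢ (univ : Finset (Fin 3))).image Δ.target ×ˢ (univ : Finset (Fin 3))
    with hJ
  have hcJ : (#J : ℝ) ≤ 9 * #(irregular Δ V₀) := by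
    have : #((irregular Δ V₀ ×ˢ (univ : Finset (Fin 3))).image Δ.target) ≤
        #(irregular Δ V₀) * 3 := by
      refine card_image_le.trans ?_
      rw [card_product, card_univ, Fintype.card_fin]
    have h2 : #J ≤ 9 * #(irregular Δ V₀) := by
      rw [hJ, card_product, card_univ, Fintype.card_fin]
      omega
    exact_mod_cast h2
  rw [sum_freeGain_add_sum_boundaryGain]
  have h1 : ∑ x, (-(5 / 108) - 5 / 54 * leafSum Δ V₀ 1 x.1) *
        (leafSum Δ V₀ ς x.1 * remoteWeight Δ V₀ ς x) ≤
      5 / 36 * ∑ x, leafSum Δ V₀ 1 x.1 * remoteWeight Δ V₀ 1 x + #J := by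
    have : (#J : ℝ) = ∑ x, if x ∈ J then (1 : ℝ) else 0 := by simp
    rw [this, Finset.mul_sum, ← Finset.sum_add_distrib]
    refine sum_le_sum fun x _ => ?_
    by_cases hx : IsFree Δ V₀ x
    swap
    · have : ∀ ς, remoteWeight Δ V₀ ς x = 0 := fun ς => if_neg hx
      rw [this, this]
      simp only [mul_zero, zero_add]
      split_ifs <;> norm_num
    have hm : remoteWeight Δ V₀ 1 x ≤ 2 := by
      unfold remoteWeight
      rw [if_pos hx]
      exact leafSum_lt_of_isFree (isFree_symm hx)
    have hm0 := remoteWeight_one_nonneg Δ V₀ x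
    have ht := leafSum_lt_of_isFree hx
    have ht0 := leafSum_one_nonneg Δ V₀ x.1
    have hprod : |leafSum Δ V₀ ς x.1 * remoteWeight Δ V₀ ς x| ≤
        leafSum Δ V₀ 1 x.1 * remoteWeight Δ V₀ 1 x := by
      rw [abs_mul]
      exact mul_le_mul (abs_leafSum_le Δ V₀ hς _) (abs_remoteWeight_le Δ V₀ hς _) (abs_nonneg _) ht0
    have hle : (-(5 / 108) - 5 / 54 * leafSum Δ V₀ 1 x.1) *
        (leafSum Δ V₀ ς x.1 * remoteWeight Δ V₀ ς x) ≤ (5 / 108 + 5 / 54 * leafSum Δ V₀ 1 x.1) *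
        (leafSum Δ V₀ 1 x.1 * remoteWeight Δ V₀ 1 x) := by
      have := mul_le_mul_of_nonneg_left (abs_le.1 hprod).1
        (show 0 ≤ 5 / 108 + 5 / 54 * leafSum Δ V₀ 1 x.1 by positivity)
      linarith
    refine hle.trans ?_
    have hpn := mul_nonneg ht0 hm0
    by_cases h2 : 1 < leafSum Δ V₀ (1 : Fin n → ℝ) x.1
    · rw [if_pos (mem_product.2 ⟨mem_of_two_le_leafSum hS hx.1 h2, mem_univ _⟩)]
      have hp4 : leafSum Δ V₀ 1 x.1 * remoteWeight Δ V₀ 1 x ≤ 4 := by nlinarith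
      nlinarith
    · have : (0 : ℝ) ≤ if x ∈ J then (1 : ℝ) else 0 := by split_ifs <;> norm_num
      nlinarith
  have h2 : ∑ x, remoteWeight Δ V₀ ς x * remoteSum Δ V₀ ς x ≤
      ∑ x, remoteWeight Δ V₀ 1 x * remoteSum Δ V₀ 1 x := by
    refine sum_le_sum fun x _ => (le_abs_self _).trans ?_
    rw [abs_mul]
    exact mul_le_mul (abs_remoteWeight_le Δ V₀ hς _) (abs_remoteSum_le Δ V₀ hς _) (abs_nonneg _)
      (remoteWeight_one_nonneg _ _ _)
  have h3 : -∑ x with IsFree Δ V₀ x, remoteSum Δ V₀ ς x * remoteSum Δ V₀ ς (Δ.1 x) ≤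
      ∑ x with IsFree Δ V₀ x, remoteSum Δ V₀ 1 x * remoteSum Δ V₀ 1 (Δ.1 x) := by
    rw [← Finset.sum_neg_distrib]
    refine sum_le_sum fun x _ => (neg_le_abs _).trans ?_
    rw [abs_mul]
    exact mul_le_mul (abs_remoteSum_le Δ V₀ hς _) (abs_remoteSum_le Δ V₀ hς _) (abs_nonneg _)
      (remoteSum_one_nonneg _ _ _)
  have h2' := mul_le_mul_of_nonneg_left h2
    (show 0 ≤ Real.sin optimalAngle / 18 by have := sin_optimalAngle_nonneg; positivity)
  unfold mainTerm
  linarith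

theorem abs_signExtend_le (V₀ : Finset (Fin n)) (σ : V₀ → ℤˣ) (v : Fin n) :
    |signExtend V₀ σ v| ≤ 1 := by
  by_cases hv : v ∈ V₀
  · have := signExtend_sq V₀ σ hv
    rw [abs_le]
    constructor <;> nlinarith
  · simp [signExtend, hv]

/-- The number of short cycles and irregular stars. -/
def numDefects (Δ : Configuration n 3) (V₀ : Finset (Fin n)) : ℕ :=
  numClosesOne Δ V₀ + numClosesTwo Δ V₀ + numClosesThree Δ V₀ + #(irregular Δ V₀)

/-- On edges with treelike surroundings the gain is known exactly; the other ones contribute at most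
a constant each. -/
theorem gain_le (Δ : Configuration n 3) {V₀ : Finset (Fin n)} (hS : IsSeparated Δ V₀)
    (σ : V₀ → ℤˣ) :
    gain Δ (qaoaState (-(Real.pi / 4)) optimalAngle Δ) V₀ σ ≤
      mainTerm Δ V₀ + 200 * numDefects Δ V₀ := by
  classical
  set ς := signExtend V₀ σ with hςdef
  have hς : ∀ v, |ς v| ≤ 1 := abs_signExtend_le V₀ σ
  set G : HalfEdge n 3 → ℝ := fun x =>
    (if IsFree Δ V₀ x then freeGain Δ V₀ ς x else 0) +
    (if x ∈ boundary Δ V₀ then boundaryGain Δ V₀ ς x else 0) +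
    (if Δ.1 x ∈ boundary Δ V₀ then boundaryGain Δ V₀ ς (Δ.1 x) else 0) with hG
  have hbd : ∀ x, x ∈ boundary Δ V₀ ↔ x.1 ∉ V₀ ∧ Δ.target x ∈ V₀ := fun x => by simp [boundary]
  have hsymm : ∀ x, edgeGain optimalAngle Δ V₀ ς (Δ.1 x) = edgeGain optimalAngle Δ V₀ ς x := by
    intro x
    unfold edgeGain
    rw [edgeCorrelation_symm, edgeCorrelation_symm]
  have hedge : ∀ x, edgeGain optimalAngle Δ V₀ ς x ≤
      G x + 4 * if x ∈ badEdges Δ V₀ then 1 else 0 := by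
    intro x
    have hf := abs_le.1 (abs_freeGain_le Δ V₀ hς x)
    have hb := abs_le.1 (abs_boundaryGain_le Δ V₀ hς x)
    have hb' := abs_le.1 (abs_boundaryGain_le Δ V₀ hς (Δ.1 x))
    have h1 := edgeGain_le_one optimalAngle Δ hS σ x
    have hx : (Δ.1 x).1 = Δ.target x := rfl
    simp only [hG, hbd, Δ.target_apply, hx]
    by_cases hbad : x ∈ badEdges Δ V₀
    · rw [if_pos hbad]
      by_cases e1 : x.1 ∈ V₀ <;> by_cases e2 : Δ.target x ∈ V₀ <;>
        simp only [IsFree, e1, e2, not_true, not_false_iff, and_true, and_self, if_true,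
          if_false, and_false] <;> linarith [hf.1, hb.1, hb'.1, h1]
    · have hgood : IsGoodEdge Δ V₀ x := by
        by_contra hcon
        exact hbad (mem_filter.2 ⟨mem_univ _, hcon⟩)
      obtain ⟨g1, g2, g3, g4⟩ := hgood
      rw [if_neg hbad]
      by_cases e1 : x.1 ∈ V₀ <;> by_cases e2 : Δ.target x ∈ V₀
      · exact absurd ⟨e1, e2⟩ g4
      · have := edgeGain_of_target_mem hS ς (fun v hv => signExtend_sq V₀ σ hv) (x := Δ.1 x)
          (by rw [Δ.target_apply]; exact e1) (g2 e2)
        rw [hsymm] at this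
        simp [IsFree, e1, e2, this]
      · have := edgeGain_of_target_mem hS ς (fun v hv => signExtend_sq V₀ σ hv) e2 (g1 e1)
        simp [IsFree, e1, e2, this]
      · have := edgeGain_of_isFree hS ς (x := x) ⟨e1, e2⟩ (g1 e1) (g2 e2) g3
        simp [IsFree, e1, e2, this]
  have hsumG : ∑ x, G x = ∑ x with IsFree Δ V₀ x, freeGain Δ V₀ ς x +
      2 * ∑ x ∈ boundary Δ V₀, boundaryGain Δ V₀ ς x := by
    have hperm : ∑ x, (if Δ.1 x ∈ boundary Δ V₀ then boundaryGain Δ V₀ ς (Δ.1 x) else 0) =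
        ∑ x, (if x ∈ boundary Δ V₀ then boundaryGain Δ V₀ ς x else 0) :=
      Equiv.sum_comp (Function.Involutive.toPerm Δ.1 Δ.2.1)
        fun x => if x ∈ boundary Δ V₀ then boundaryGain Δ V₀ ς x else 0
    simp only [hG, Finset.sum_add_distrib]
    rw [hperm, Finset.sum_filter]
    simp only [Finset.sum_ite_mem, univ_inter]
    ring
  have hbadsum : ∑ x : HalfEdge n 3, (if x ∈ badEdges Δ V₀ then (1 : ℝ) else 0) =
      #(badEdges Δ V₀) := by simp
  rw [gain_eq_sum optimalAngle Δ hS σ]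
  have h1 := sum_le_sum (s := univ) fun x _ => hedge x
  rw [Finset.sum_add_distrib, hsumG, ← Finset.mul_sum, hbadsum] at h1
  have h2 := sum_freeGain_le Δ hS hς
  have h3 : (#(badEdges Δ V₀) : ℝ) ≤ 6 * numClosesOne Δ V₀ + 6 * numClosesTwo Δ V₀ +
      numClosesThree Δ V₀ + 75 * #(irregular Δ V₀) := by exact_mod_cast card_badEdges_le Δ hS
  unfold numDefects
  push_cast
  have e1 : (0 : ℝ) ≤ numClosesOne Δ V₀ := Nat.cast_nonneg _
  have e2 : (0 : ℝ) ≤ numClosesTwo Δ V₀ := Nat.cast_nonneg _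
  have e3 : (0 : ℝ) ≤ numClosesThree Δ V₀ := Nat.cast_nonneg _
  have e4 : (0 : ℝ) ≤ #(irregular Δ V₀) := Nat.cast_nonneg _
  linarith

/-! ### Random matchings -/

section Matchings

variable {X : Type} [DecidableEq X]

/-- The matching obtained by exchanging the roles of `y` and `z`. -/
def PerfectMatching.conjSwap (y z : X) (Δ : PerfectMatching X) : PerfectMatching X :=
  ⟨fun x => Equiv.swap y z (Δ.1 (Equiv.swap y z x)), fun x => by simp [Δ.2.1 _], fun x h => by
    have := congrArg (Equiv.swap y z) h
    rw [Equiv.swap_apply_self] at this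
    exact Δ.2.2 _ this⟩

theorem conjSwap_conjSwap (y z : X) (Δ : PerfectMatching X) :
    (Δ.conjSwap y z).conjSwap y z = Δ :=
  Subtype.ext (funext fun x => by simp [PerfectMatching.conjSwap])

theorem card_sdiff_pair {R : Finset X} {x y : X} (hx : x ∈ R) (hy : y ∈ R) (hxy : x ≠ y) :
    #(R \ {x, y}) + 2 = #R := by
  have h : ({x, y} : Finset X) ⊆ R := by
    intro z hz
    rcases mem_insert.1 hz with rfl | hz
    · exact hx
    · rwa [mem_singleton.1 hz]
  have := card_sdiff_add_card_eq_card h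
  rwa [card_pair hxy] at this

variable [Fintype X]

/-- The perfect matchings that agree with `Δ₀` outside `R`. -/
def agreeing (Δ₀ : PerfectMatching X) (R : Finset X) : Finset (PerfectMatching X) :=
  {Δ | ∀ x, x ∉ R → Δ.1 x = Δ₀.1 x}

theorem mem_agreeing {Δ₀ Δ : PerfectMatching X} {R : Finset X} :
    Δ ∈ agreeing Δ₀ R ↔ ∀ x, x ∉ R → Δ.1 x = Δ₀.1 x := by
  simp [agreeing]

theorem apply_mem_of_mem_agreeing {Δ₀ Δ : PerfectMatching X} {R : Finset X}
    (hR : ∀ x ∈ R, Δ₀.1 x ∈ R) (hΔ : Δ ∈ agreeing Δ₀ R) {x : X} (hx : x ∈ R) : Δ.1 x ∈ R := by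
  by_contra h
  have h1 := mem_agreeing.1 hΔ _ h
  rw [Δ.2.1] at h1
  have h2 := hR x hx
  rw [h1, Δ₀.2.1] at h2
  exact h h2

theorem conjSwap_mem_agreeing {Δ₀ Δ : PerfectMatching X} {R : Finset X}
    (hR : ∀ x ∈ R, Δ₀.1 x ∈ R) {y z : X} (hy : y ∈ R) (hz : z ∈ R) (hΔ : Δ ∈ agreeing Δ₀ R) :
    Δ.conjSwap y z ∈ agreeing Δ₀ R := by
  refine mem_agreeing.2 fun x hx => ?_
  have hfix : ∀ u, u ∉ R → Equiv.swap y z u = u := fun u hu =>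
    Equiv.swap_apply_of_ne_of_ne (fun h => hu (h ▸ hy)) (fun h => hu (h ▸ hz))
  change Equiv.swap y z (Δ.1 (Equiv.swap y z x)) = _
  rw [hfix x hx, mem_agreeing.1 hΔ x hx]
  refine hfix _ fun h => hx ?_
  have := hR _ h
  rwa [Δ₀.2.1] at this

theorem card_agreeing_apply_eq_le {Δ₀ : PerfectMatching X} {R : Finset X}
    (hR : ∀ x ∈ R, Δ₀.1 x ∈ R) {x y z : X} (hy : y ∈ R) (hz : z ∈ R) (hxy : x ≠ y)
    (hxz : x ≠ z) :
    #{Δ ∈ agreeing Δ₀ R | Δ.1 x = y} ≤ #{Δ ∈ agreeing Δ₀ R | Δ.1 x = z} := by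
  refine card_le_card_of_injOn (PerfectMatching.conjSwap y z) ?_ ?_
  · intro Δ hΔ
    obtain ⟨h1, h2⟩ := mem_filter.1 hΔ
    refine mem_filter.2 ⟨conjSwap_mem_agreeing hR hy hz h1, ?_⟩
    change Equiv.swap y z (Δ.1 (Equiv.swap y z x)) = _
    rw [Equiv.swap_apply_of_ne_of_ne hxy hxz, h2, Equiv.swap_apply_left]
  · intro Δ _ Δ' _ h
    rw [← conjSwap_conjSwap y z Δ, ← conjSwap_conjSwap y z Δ']
    exact congrArg _ h

/-- The mate of `x ∈ R` is uniformly distributed on the rest of `R`. -/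
theorem card_agreeing_apply_eq {Δ₀ : PerfectMatching X} {R : Finset X}
    (hR : ∀ x ∈ R, Δ₀.1 x ∈ R) {x y : X} (hx : x ∈ R) (hy : y ∈ R) (hxy : x ≠ y) :
    ((#R : ℝ) - 1) * #{Δ ∈ agreeing Δ₀ R | Δ.1 x = y} = #(agreeing Δ₀ R) := by
  have h1 : #(agreeing Δ₀ R) = ∑ z ∈ R.erase x, #{Δ ∈ agreeing Δ₀ R | Δ.1 x = z} :=
    card_eq_sum_card_fiberwise fun Δ hΔ =>
      mem_erase.2 ⟨Δ.2.2 x, apply_mem_of_mem_agreeing hR hΔ hx⟩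
  have h2 : ∀ z ∈ R.erase x, #{Δ ∈ agreeing Δ₀ R | Δ.1 x = z} =
      #{Δ ∈ agreeing Δ₀ R | Δ.1 x = y} := fun z hz =>
    le_antisymm
      (card_agreeing_apply_eq_le hR (mem_of_mem_erase hz) hy (ne_of_mem_erase hz).symm hxy)
      (card_agreeing_apply_eq_le hR hy (mem_of_mem_erase hz) hxy (ne_of_mem_erase hz).symm)
  rw [sum_congr rfl h2, sum_const, smul_eq_mul, card_erase_of_mem hx] at h1
  rw [h1, Nat.cast_mul, Nat.cast_pred (card_pos.2 ⟨x, hx⟩)]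

theorem filter_agreeing_eq {Δ₀ Δ₁ : PerfectMatching X} {R : Finset X} {x y : X}
    (hΔ₁ : Δ₁ ∈ agreeing Δ₀ R) (hx : x ∈ R) (hy : y ∈ R) (h : Δ₁.1 x = y) :
    {Δ ∈ agreeing Δ₀ R | Δ.1 x = y} = agreeing Δ₁ (R \ {x, y}) := by
  have h' : Δ₁.1 y = x := by rw [← h, Δ₁.2.1]
  ext Δ
  simp only [mem_filter, mem_agreeing, mem_sdiff, mem_insert, mem_singleton, not_and, not_not]
  constructor
  · rintro ⟨h1, h2⟩ z hz
    by_cases hzR : z ∈ R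
    · rcases hz hzR with rfl | rfl
      · rw [h, h2]
      · rw [h', ← h2, Δ.2.1]
    · rw [h1 z hzR, mem_agreeing.1 hΔ₁ z hzR]
  · intro h1
    refine ⟨fun z hz => ?_, ?_⟩
    · rw [h1 z fun hz' => absurd hz' hz, mem_agreeing.1 hΔ₁ z hz]
    · rw [h1 x fun _ => Or.inl rfl, h]

theorem apply_mem_sdiff {Δ₀ Δ₁ : PerfectMatching X} {R : Finset X} {x y : X}
    (hR : ∀ x ∈ R, Δ₀.1 x ∈ R) (hΔ₁ : Δ₁ ∈ agreeing Δ₀ R) (h : Δ₁.1 x = y) :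
    ∀ z ∈ R \ {x, y}, Δ₁.1 z ∈ R \ {x, y} := by
  intro z hz
  simp only [mem_sdiff, mem_insert, mem_singleton, not_or] at hz ⊢
  refine ⟨apply_mem_of_mem_agreeing hR hΔ₁ hz.1, fun h1 => hz.2.2 ?_, fun h1 => hz.2.1 ?_⟩
  · rw [← h, ← h1, Δ₁.2.1]
  · rw [← h] at h1
    exact Δ₁.2.1.injective h1

theorem sum_agreeing {Δ₀ : PerfectMatching X} {R : Finset X} (hR : ∀ x ∈ R, Δ₀.1 x ∈ R)
    (G : X → X → PerfectMatching X → ℝ) :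
    ∑ Δ ∈ agreeing Δ₀ R, ∑ x ∈ R, G x (Δ.1 x) Δ =
      ∑ x ∈ R, ∑ y ∈ R.erase x, ∑ Δ ∈ agreeing Δ₀ R with Δ.1 x = y, G x y Δ := by
  rw [Finset.sum_comm]
  refine sum_congr rfl fun x hx => ?_
  rw [← Finset.sum_fiberwise_of_maps_to (g := fun Δ : PerfectMatching X => Δ.1 x) (t := R.erase x)
    fun Δ hΔ => mem_erase.2 ⟨Δ.2.2 x, apply_mem_of_mem_agreeing hR hΔ hx⟩]
  refine sum_congr rfl fun y _ => sum_congr rfl fun Δ hΔ => ?_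
  rw [(mem_filter.1 hΔ).2]

/-- Summation over the edges of a random matching, one edge at a time: a bound `c` for the rest of
the sum, given the first edge, is multiplied by the probability of this edge. -/
theorem sum_agreeing_le {Δ₀ : PerfectMatching X} {R : Finset X} (hR : ∀ x ∈ R, Δ₀.1 x ∈ R)
    (hcard : 1 ≤ #R) (G : X → X → PerfectMatching X → ℝ) (c : ℝ) (W : X → X → ℝ)
    (hW : ∀ x y, 0 ≤ W x y)
    (h : ∀ x ∈ R, ∀ y ∈ R, x ≠ y → ∀ Δ₁ ∈ agreeing Δ₀ R, Δ₁.1 x = y →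
      c * ∑ Δ ∈ agreeing Δ₁ (R \ {x, y}), G x y Δ ≤ #(agreeing Δ₁ (R \ {x, y})) * W x y) :
    ((#R : ℝ) - 1) * c * ∑ Δ ∈ agreeing Δ₀ R, ∑ x ∈ R, G x (Δ.1 x) Δ ≤
      #(agreeing Δ₀ R) * ∑ x ∈ R, ∑ y ∈ R, W x y := by
  have hc : (1 : ℝ) ≤ #R := by exact_mod_cast hcard
  rw [sum_agreeing hR, Finset.mul_sum, Finset.mul_sum]
  refine sum_le_sum fun x hx => ?_
  rw [Finset.mul_sum]
  refine le_trans (b := ∑ y ∈ R.erase x, (#(agreeing Δ₀ R) : ℝ) * W x y) ?_ ?_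
  · refine sum_le_sum fun y hy => ?_
    obtain ⟨hyx, hy⟩ := mem_erase.1 hy
    rw [mul_assoc]
    have hkey : c * ∑ Δ ∈ agreeing Δ₀ R with Δ.1 x = y, G x y Δ ≤
        #{Δ ∈ agreeing Δ₀ R | Δ.1 x = y} * W x y := by
      rcases ({Δ ∈ agreeing Δ₀ R | Δ.1 x = y} : Finset _).eq_empty_or_nonempty with he | ⟨Δ₁, hΔ₁⟩
      · rw [he]; simp
      · obtain ⟨h1, h2⟩ := mem_filter.1 hΔ₁
        rw [filter_agreeing_eq h1 hx hy h2]
        exact h x hx y hy hyx.symm Δ₁ h1 h2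
    refine (mul_le_mul_of_nonneg_left hkey (by linarith)).trans (le_of_eq ?_)
    rw [← mul_assoc, card_agreeing_apply_eq hR hx hy hyx.symm]
  · rw [← Finset.mul_sum]
    refine mul_le_mul_of_nonneg_left ?_ (Nat.cast_nonneg _)
    exact sum_le_sum_of_subset_of_nonneg (erase_subset _ _) fun _ _ _ => hW _ _

theorem sum_one_edge_le {Δ₀ : PerfectMatching X} {R : Finset X} (hR : ∀ x ∈ R, Δ₀.1 x ∈ R)
    (hcard : 1 ≤ #R) (g : X → X → ℝ) (hg : ∀ x y, 0 ≤ g x y) :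
    ((#R : ℝ) - 1) * ∑ Δ ∈ agreeing Δ₀ R, ∑ x ∈ R, g x (Δ.1 x) ≤
      #(agreeing Δ₀ R) * ∑ x ∈ R, ∑ y ∈ R, g x y := by
  have := sum_agreeing_le hR hcard (fun x y _ => g x y) 1 g hg fun x _ y _ _ Δ₁ _ _ => by
    simp
  rwa [mul_one] at this

/-- Two edges of a random matching: `z` and its mate are conditionally uniform on what is left of
`R`. -/
theorem sum_two_edges_le {Δ₀ : PerfectMatching X} {R : Finset X} (hR : ∀ x ∈ R, Δ₀.1 x ∈ R)
    (hcard : 3 ≤ #R) (g : X → X → X → X → ℝ) (hg : ∀ x y z w, 0 ≤ g x y z w) :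
    ((#R : ℝ) - 1) * ((#R : ℝ) - 3) * ∑ Δ ∈ agreeing Δ₀ R, ∑ x ∈ R, ∑ z ∈ R \ {x, Δ.1 x},
        g x (Δ.1 x) z (Δ.1 z) ≤
      #(agreeing Δ₀ R) * ∑ x ∈ R, ∑ y ∈ R, ∑ z ∈ R, ∑ w ∈ R, g x y z w := by
  refine sum_agreeing_le hR (by omega) (fun x y Δ => ∑ z ∈ R \ {x, y}, g x y z (Δ.1 z)) _
    (fun x y => ∑ z ∈ R, ∑ w ∈ R, g x y z w)
    (fun x y => sum_nonneg fun z _ => sum_nonneg fun w _ => hg _ _ _ _)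
    fun x hx y hy hxy Δ₁ hΔ₁ h => ?_
  have hc := card_sdiff_pair hx hy hxy
  have hc' : (#R : ℝ) - 3 = (#(R \ {x, y}) : ℝ) - 1 := by
    rw [← hc]; push_cast; ring
  rw [hc']
  refine (sum_one_edge_le (apply_mem_sdiff hR hΔ₁ h) (by omega) (g x y) (hg x y)).trans ?_
  refine mul_le_mul_of_nonneg_left ?_ (Nat.cast_nonneg _)
  refine (sum_le_sum fun z _ => sum_le_sum_of_subset_of_nonneg sdiff_subset
    fun _ _ _ => hg _ _ _ _).trans ?_
  exact sum_le_sum_of_subset_of_nonneg sdiff_subset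
    fun _ _ _ => sum_nonneg fun _ _ => hg _ _ _ _

theorem sum_three_edges_le {Δ₀ : PerfectMatching X} {R : Finset X} (hR : ∀ x ∈ R, Δ₀.1 x ∈ R)
    (hcard : 5 ≤ #R) (g : X → X → X → X → X → X → ℝ) (hg : ∀ x y z w u v, 0 ≤ g x y z w u v) :
    ((#R : ℝ) - 1) * (((#R : ℝ) - 3) * ((#R : ℝ) - 5)) *
      ∑ Δ ∈ agreeing Δ₀ R, ∑ x ∈ R, ∑ z ∈ R \ {x, Δ.1 x}, ∑ u ∈ (R \ {x, Δ.1 x}) \ {z, Δ.1 z},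
        g x (Δ.1 x) z (Δ.1 z) u (Δ.1 u) ≤
      #(agreeing Δ₀ R) * ∑ x ∈ R, ∑ y ∈ R, ∑ z ∈ R, ∑ w ∈ R, ∑ u ∈ R, ∑ v ∈ R,
        g x y z w u v := by
  refine sum_agreeing_le hR (by omega) (fun x y Δ => ∑ z ∈ R \ {x, y},
      ∑ u ∈ (R \ {x, y}) \ {z, Δ.1 z}, g x y z (Δ.1 z) u (Δ.1 u)) _
    (fun x y => ∑ z ∈ R, ∑ w ∈ R, ∑ u ∈ R, ∑ v ∈ R, g x y z w u v)
    (fun x y => sum_nonneg fun _ _ => sum_nonneg fun _ _ => sum_nonneg fun _ _ =>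
      sum_nonneg fun _ _ => hg _ _ _ _ _ _)
    fun x hx y hy hxy Δ₁ hΔ₁ h => ?_
  have hc := card_sdiff_pair hx hy hxy
  have hc' : ((#R : ℝ) - 3) * ((#R : ℝ) - 5) =
      ((#(R \ {x, y}) : ℝ) - 1) * ((#(R \ {x, y}) : ℝ) - 3) := by
    rw [← hc]; push_cast; ring
  rw [hc']
  refine (sum_two_edges_le (apply_mem_sdiff hR hΔ₁ h) (by omega) (g x y)
    (fun _ _ _ _ => hg _ _ _ _ _ _)).trans ?_
  refine mul_le_mul_of_nonneg_left ?_ (Nat.cast_nonneg _)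
  have hsub : ∀ f : X → ℝ, (∀ z, 0 ≤ f z) → ∑ z ∈ R \ {x, y}, f z ≤ ∑ z ∈ R, f z := fun f hf =>
    sum_le_sum_of_subset_of_nonneg sdiff_subset fun _ _ _ => hf _
  refine (sum_le_sum fun z _ => (sum_le_sum fun w _ => (sum_le_sum fun u _ =>
    hsub _ fun v => hg _ _ _ _ _ _).trans (hsub _ fun u => sum_nonneg fun _ _ =>
      hg _ _ _ _ _ _)).trans (hsub _ fun w => sum_nonneg fun _ _ => sum_nonneg fun _ _ =>
        hg _ _ _ _ _ _)).trans ?_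
  exact hsub _ fun z => sum_nonneg fun _ _ => sum_nonneg fun _ _ => sum_nonneg fun _ _ =>
    hg _ _ _ _ _ _

end Matchings

/-! ### Rematching the free half-edges -/

/-- The half-edges of the edges that do not meet `V₀`, as a finite set. -/
def freeSet (Δ : Configuration n d) (V₀ : Finset (Fin n)) : Finset (HalfEdge n d) :=
  {x | IsFree Δ V₀ x}

theorem mem_freeSet {Δ : Configuration n d} {V₀ : Finset (Fin n)} {x : HalfEdge n d} :
    x ∈ freeSet Δ V₀ ↔ IsFree Δ V₀ x := by simp [freeSet]

theorem apply_mem_freeSet (Δ : Configuration n d) (V₀ : Finset (Fin n)) :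
    ∀ x ∈ freeSet Δ V₀, Δ.1 x ∈ freeSet Δ V₀ := fun _ hx =>
  mem_freeSet.2 (isFree_symm (mem_freeSet.1 hx))

/-- The configurations with the same edges at `V₀` as `Δ₀`. -/
def starClass (Δ₀ : Configuration n d) (V₀ : Finset (Fin n)) : Finset (Configuration n d) :=
  agreeing Δ₀ (freeSet Δ₀ V₀)

section StarClass

variable {Δ₀ Δ : Configuration n d} {V₀ : Finset (Fin n)}

theorem apply_eq_of_not_isFree (h : Δ ∈ starClass Δ₀ V₀) {x : HalfEdge n d}
    (hx : ¬ IsFree Δ₀ V₀ x) : Δ.1 x = Δ₀.1 x :=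
  mem_agreeing.1 h x fun h' => hx (mem_freeSet.1 h')

theorem isFree_iff_of_mem_starClass (h : Δ ∈ starClass Δ₀ V₀) (x : HalfEdge n d) :
    IsFree Δ V₀ x ↔ IsFree Δ₀ V₀ x := by
  by_cases hx : IsFree Δ₀ V₀ x
  · have := apply_mem_of_mem_agreeing (apply_mem_freeSet Δ₀ V₀) h (mem_freeSet.2 hx)
    exact iff_of_true ⟨hx.1, (mem_freeSet.1 this).1⟩ hx
  · refine iff_of_false (fun h' => hx ⟨h'.1, ?_⟩) hx
    have := h'.2
    unfold Configuration.target at this ⊢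
    rwa [apply_eq_of_not_isFree h hx] at this

theorem freeSet_of_mem_starClass (h : Δ ∈ starClass Δ₀ V₀) : freeSet Δ V₀ = freeSet Δ₀ V₀ := by
  ext x
  rw [mem_freeSet, mem_freeSet, isFree_iff_of_mem_starClass h]

theorem target_eq_of_mem (h : Δ ∈ starClass Δ₀ V₀) {x : HalfEdge n d} (hx : x.1 ∈ V₀) :
    Δ.target x = Δ₀.target x := by
  unfold Configuration.target
  rw [apply_eq_of_not_isFree h fun h' => h'.1 hx]

theorem leafSum_of_mem_starClass (h : Δ ∈ starClass Δ₀ V₀) (ς : Fin n → ℝ) (w : Fin n) :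
    leafSum Δ V₀ ς w = leafSum Δ₀ V₀ ς w := by
  refine sum_congr rfl fun j _ => ?_
  by_cases hx : IsFree Δ₀ V₀ (w, j)
  · rw [if_neg hx.2, if_neg ((isFree_iff_of_mem_starClass h _).2 hx).2]
  · unfold Configuration.target
    rw [apply_eq_of_not_isFree h hx]

theorem hub_of_mem_starClass (h : Δ ∈ starClass Δ₀ V₀) (w : Fin n) :
    hub Δ V₀ w = hub Δ₀ V₀ w := by
  have : (fun x : HalfEdge n d => x.1 ∈ V₀ ∧ Δ.target x = w) =
      fun x : HalfEdge n d => x.1 ∈ V₀ ∧ Δ₀.target x = w :=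
    funext fun x => propext (and_congr_right fun hx => by rw [target_eq_of_mem h hx])
  unfold hub
  simp only [this]

theorem irregular_of_mem_starClass (h : Δ ∈ starClass Δ₀ V₀) :
    irregular Δ V₀ = irregular Δ₀ V₀ := by
  ext v
  rw [mem_irregular, mem_irregular]
  refine and_congr_right fun hv => ?_
  unfold IsRegularStar
  have : ∀ i, Δ.target (v, i) = Δ₀.target (v, i) := fun i => target_eq_of_mem h hv
  simp only [this]

theorem isSeparated_of_mem_starClass (h : Δ ∈ starClass Δ₀ V₀) (hS : IsSeparated Δ₀ V₀) :
    IsSeparated Δ V₀ := by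
  refine ⟨fun x hx => ?_, fun x y hx hy => ?_⟩
  · rw [target_eq_of_mem h hx]
    exact hS.1 x hx
  · rw [target_eq_of_mem h hx, target_eq_of_mem h hy]
    exact hS.2 x y hx hy

end StarClass

/-- The part of a configuration that is fixed in its star class: its edges at `V₀`. -/
def starPart (V₀ : Finset (Fin n)) (Δ : Configuration n d) (x : HalfEdge n d) : HalfEdge n d :=
  if IsFree Δ V₀ x then x else Δ.1 x

/-- The star classes are the fibres of `starPart`. -/
theorem starPart_eq_iff (V₀ : Finset (Fin n)) (Δ₀ Δ : Configuration n d) :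
    starPart V₀ Δ = starPart V₀ Δ₀ ↔ Δ ∈ starClass Δ₀ V₀ := by
  have hfree : ∀ (Δ : Configuration n d) x, starPart V₀ Δ x = x ↔ IsFree Δ V₀ x := by
    intro Δ x
    unfold starPart
    split_ifs with h
    · exact iff_of_true rfl h
    · exact iff_of_false (Δ.2.2 x) h
  constructor
  · intro h
    refine mem_agreeing.2 fun x hx => ?_
    have h1 := congrFun h x
    have h0 : ¬ IsFree Δ₀ V₀ x := fun h' => hx (mem_freeSet.2 h')
    have h2 : ¬ IsFree Δ V₀ x := by
      rw [← hfree, h1, hfree]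
      exact h0
    unfold starPart at h1
    rwa [if_neg h0, if_neg h2] at h1
  · intro h
    funext x
    unfold starPart
    by_cases hx : IsFree Δ₀ V₀ x
    · rw [if_pos hx, if_pos ((isFree_iff_of_mem_starClass h x).2 hx)]
    · rw [if_neg hx, if_neg (mt (isFree_iff_of_mem_starClass h x).1 hx),
        apply_eq_of_not_isFree h hx]

/-- An inequality between sums over all star classes holds for the sums over the configurations
in which `V₀` is separated. -/
theorem sum_le_sum_of_starClass (V₀ : Finset (Fin n)) (f g : Configuration n d → ℝ)
    (A : Finset (Configuration n d)) (hA : ∀ Δ, Δ ∈ A ↔ IsSeparated Δ V₀)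
    (h : ∀ Δ₀, IsSeparated Δ₀ V₀ → ∑ Δ ∈ starClass Δ₀ V₀, f Δ ≤ ∑ Δ ∈ starClass Δ₀ V₀, g Δ) :
    ∑ Δ ∈ A, f Δ ≤ ∑ Δ ∈ A, g Δ := by
  classical
  rw [← Finset.sum_fiberwise_of_maps_to (g := starPart V₀) (t := A.image (starPart V₀))
      fun Δ hΔ => mem_image_of_mem _ hΔ,
    ← Finset.sum_fiberwise_of_maps_to (g := starPart V₀) (t := A.image (starPart V₀))
      fun Δ hΔ => mem_image_of_mem _ hΔ]
  refine sum_le_sum fun p hp => ?_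
  obtain ⟨Δ₀, hΔ₀, rfl⟩ := mem_image.1 hp
  have hS := (hA Δ₀).1 hΔ₀
  have : {Δ ∈ A | starPart V₀ Δ = starPart V₀ Δ₀} = starClass Δ₀ V₀ := by
    ext Δ
    rw [mem_filter, starPart_eq_iff]
    exact ⟨fun h => h.2, fun h => ⟨(hA Δ).2 (isSeparated_of_mem_starClass h hS), h⟩⟩
  rw [this]
  exact h Δ₀ hS

/-! ### Counting free half-edges -/

theorem sum_leafSum_notMem (Δ : Configuration n 3) (V₀ : Finset (Fin n)) :
    ∑ w with w ∉ V₀, leafSum Δ V₀ (1 : Fin n → ℝ) w =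
      3 * #V₀ - #{x : HalfEdge n 3 | x.1 ∈ V₀ ∧ Δ.target x ∈ V₀} := by
  have h1 : ∑ w with w ∉ V₀, leafSum Δ V₀ (1 : Fin n → ℝ) w =
      ∑ x : HalfEdge n 3, if x.1 ∉ V₀ ∧ Δ.target x ∈ V₀ then (1 : ℝ) else 0 := by
    rw [Fintype.sum_prod_type, Finset.sum_filter]
    refine sum_congr rfl fun w _ => ?_
    unfold leafSum
    by_cases hw : w ∈ V₀ <;> simp [hw]
  have h2 : ∑ x : HalfEdge n 3, (if x.1 ∉ V₀ ∧ Δ.target x ∈ V₀ then (1 : ℝ) else 0) =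
      ∑ x : HalfEdge n 3, if Δ.target x ∉ V₀ ∧ x.1 ∈ V₀ then (1 : ℝ) else 0 := by
    rw [← Equiv.sum_comp (Function.Involutive.toPerm Δ.1 Δ.2.1)
      fun x : HalfEdge n 3 => if x.1 ∉ V₀ ∧ Δ.target x ∈ V₀ then (1 : ℝ) else 0]
    refine sum_congr rfl fun x _ => ?_
    change (if (Δ.1 x).1 ∉ V₀ ∧ Δ.target (Δ.1 x) ∈ V₀ then (1 : ℝ) else 0) = _
    rw [Δ.target_apply]
    rfl
  have h3 : ∑ x : HalfEdge n 3, (if x.1 ∈ V₀ then (1 : ℝ) else 0) = 3 * #V₀ := by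
    rw [Fintype.sum_prod_type_right]
    simp
  rw [h1, h2, ← h3, Finset.card_filter, Nat.cast_sum, ← Finset.sum_sub_distrib]
  refine sum_congr rfl fun x _ => ?_
  by_cases h : x.1 ∈ V₀ <;> by_cases h' : Δ.target x ∈ V₀ <;> simp [h, h']

theorem card_mem_target_mem_le {Δ : Configuration n 3} {V₀ : Finset (Fin n)}
    (hS : IsSeparated Δ V₀) :
    #{x : HalfEdge n 3 | x.1 ∈ V₀ ∧ Δ.target x ∈ V₀} ≤ 3 * #(irregular Δ V₀) := by
  have : #(irregular Δ V₀ ×ˢ (univ : Finset (Fin 3))) = 3 * #(irregular Δ V₀) := by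
    rw [card_product, card_univ, Fintype.card_fin, mul_comm]
  rw [← this]
  refine card_le_card fun x hx => ?_
  obtain ⟨h1, h2⟩ := (mem_filter.1 hx).2
  exact mem_product.2 ⟨mem_irregular.2 ⟨h1, fun hr => hr.2 x.2 (hS.1 x h1 h2)⟩, mem_univ _⟩

theorem sum_freeSet (Δ : Configuration n 3) (V₀ : Finset (Fin n)) (f : Fin n → ℝ) :
    ∑ x ∈ freeSet Δ V₀, f x.1 = ∑ w with w ∉ V₀, (3 - leafSum Δ V₀ 1 w) * f w := by
  unfold freeSet
  rw [Finset.sum_filter, Finset.sum_filter, Fintype.sum_prod_type]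
  refine sum_congr rfl fun w _ => ?_
  by_cases hw : w ∈ V₀
  · simp [IsFree, hw]
  · simp only [IsFree, hw, not_false_iff, true_and, if_true]
    unfold leafSum
    rw [Fin.sum_univ_three, Fin.sum_univ_three]
    simp only [Pi.one_apply]
    split_ifs <;> ring

theorem card_freeSet (Δ : Configuration n 3) (V₀ : Finset (Fin n)) :
    (#(freeSet Δ V₀) : ℝ) =
      3 * n - 6 * #V₀ + #{x : HalfEdge n 3 | x.1 ∈ V₀ ∧ Δ.target x ∈ V₀} := by
  have h := sum_freeSet Δ V₀ fun _ => 1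
  simp only [mul_one, sum_const, nsmul_eq_mul, Finset.sum_sub_distrib] at h
  have hc : #{w : Fin n | w ∉ V₀} + #V₀ = n := by
    have := card_compl_add_card V₀
    rw [Fintype.card_fin] at this
    rwa [show ({w : Fin n | w ∉ V₀} : Finset (Fin n)) = V₀ᶜ by ext; simp]
  have hc' : (#{w : Fin n | w ∉ V₀} : ℝ) = n - #V₀ := by
    rw [eq_sub_iff_add_eq]; exact_mod_cast hc
  rw [h, sum_leafSum_notMem, hc']
  ring

theorem sum_leafSum_freeSet_le (Δ : Configuration n 3) (V₀ : Finset (Fin n)) :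
    ∑ x ∈ freeSet Δ V₀, leafSum Δ V₀ (1 : Fin n → ℝ) x.1 ≤ 6 * #V₀ := by
  rw [sum_freeSet Δ V₀ fun w => leafSum Δ V₀ 1 w]
  have h := sum_leafSum_notMem Δ V₀
  have hk : ∑ w with w ∉ V₀, (3 - leafSum Δ V₀ (1 : Fin n → ℝ) w) * leafSum Δ V₀ 1 w ≤
      2 * ∑ w with w ∉ V₀, leafSum Δ V₀ (1 : Fin n → ℝ) w := by
    rw [Finset.mul_sum]
    refine sum_le_sum fun w _ => ?_
    rw [leafSum_one_eq_card]
    have hj : ∀ m : ℕ, (3 - (m : ℝ)) * m ≤ 2 * m := by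
      intro m
      rcases Nat.eq_zero_or_pos m with rfl | hm
      · simp
      · have : (1 : ℝ) ≤ m := by exact_mod_cast hm
        nlinarith
    exact hj _
  have : (0 : ℝ) ≤ #{x : HalfEdge n 3 | x.1 ∈ V₀ ∧ Δ.target x ∈ V₀} := Nat.cast_nonneg _
  linarith

theorem le_sum_leafSum_freeSet {Δ : Configuration n 3} {V₀ : Finset (Fin n)}
    (hS : IsSeparated Δ V₀) :
    6 * (#V₀ : ℝ) - 2 * #{x : HalfEdge n 3 | x.1 ∈ V₀ ∧ Δ.target x ∈ V₀} -
      18 * #(irregular Δ V₀) ≤ ∑ x ∈ freeSet Δ V₀, leafSum Δ V₀ (1 : Fin n → ℝ) x.1 := by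
  classical
  set J := (irregular Δ V₀ ×ˢ (univ : Finset (Fin 3))).image Δ.target with hJ
  have hcJ : (#J : ℝ) ≤ 3 * #(irregular Δ V₀) := by
    have : #J ≤ 3 * #(irregular Δ V₀) := by
      refine card_image_le.trans ?_
      rw [card_product, card_univ, Fintype.card_fin, mul_comm]
    exact_mod_cast this
  rw [sum_freeSet Δ V₀ fun w => leafSum Δ V₀ 1 w]
  have h := sum_leafSum_notMem Δ V₀
  have hk : 2 * ∑ w with w ∉ V₀, leafSum Δ V₀ (1 : Fin n → ℝ) w - 6 * #J ≤
      ∑ w with w ∉ V₀, (3 - leafSum Δ V₀ (1 : Fin n → ℝ) w) * leafSum Δ V₀ 1 w := by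
    have hJ' : ∑ w with w ∉ V₀, (if w ∈ J then (1 : ℝ) else 0) ≤ #J := by
      refine (sum_le_sum_of_subset_of_nonneg (subset_univ _) fun _ _ _ => ?_).trans ?_
      · split_ifs <;> norm_num
      · simp
    have : 2 * ∑ w with w ∉ V₀, leafSum Δ V₀ (1 : Fin n → ℝ) w -
        6 * ∑ w with w ∉ V₀, (if w ∈ J then (1 : ℝ) else 0) ≤
        ∑ w with w ∉ V₀, (3 - leafSum Δ V₀ (1 : Fin n → ℝ) w) * leafSum Δ V₀ 1 w := by
      rw [Finset.mul_sum, Finset.mul_sum, ← Finset.sum_sub_distrib]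
      refine sum_le_sum fun w hw => ?_
      have h3 := leafSum_one_le Δ V₀ w
      have h0 := leafSum_one_nonneg Δ V₀ w
      push_cast at h3
      by_cases h1 : 1 < leafSum Δ V₀ (1 : Fin n → ℝ) w
      · rw [if_pos (mem_of_two_le_leafSum hS (mem_filter.1 hw).2 h1)]
        nlinarith
      · have : (0 : ℝ) ≤ if w ∈ J then (1 : ℝ) else 0 := by split_ifs <;> norm_num
        nlinarith
    linarith
  linarith

theorem sum_siblings (Δ : Configuration n 3) (V₀ : Finset (Fin n)) (x : HalfEdge n 3)
    (f : HalfEdge n 3 → ℝ) :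
    ∑ z ∈ freeSet Δ V₀ with z.1 = x.1 ∧ z ≠ x, f z =
      (if IsFree Δ V₀ (x.1, x.2 + 1) then f (x.1, x.2 + 1) else 0) +
      (if IsFree Δ V₀ (x.1, x.2 + 2) then f (x.1, x.2 + 2) else 0) := by
  have hj : ∀ j : Fin 3, j + 1 ≠ j ∧ j + 2 ≠ j := by decide
  unfold freeSet
  rw [Finset.sum_filter, Finset.sum_filter, Fintype.sum_prod_type, Finset.sum_eq_single x.1,
    sum_fin_three _ x.2]
  · obtain ⟨i, j⟩ := x
    simp [hj]
  · intro w _ hw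
    exact sum_eq_zero fun j _ => by simp [hw]
  · simp

theorem remoteSum_eq_sum (Δ : Configuration n 3) (V₀ : Finset (Fin n)) (ς : Fin n → ℝ)
    (x : HalfEdge n 3) :
    remoteSum Δ V₀ ς x =
      ∑ z ∈ freeSet Δ V₀ with z.1 = x.1 ∧ z ≠ x, leafSum Δ V₀ ς (Δ.1 z).1 :=
  (sum_siblings Δ V₀ x fun z => leafSum Δ V₀ ς (Δ.1 z).1).symm

theorem sum_card_siblings (Δ : Configuration n 3) (V₀ : Finset (Fin n)) :
    ∑ x ∈ freeSet Δ V₀, (#{z ∈ freeSet Δ V₀ | z.1 = x.1 ∧ z ≠ x} : ℝ) =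
      2 * #(freeSet Δ V₀) - ∑ x ∈ freeSet Δ V₀, leafSum Δ V₀ (1 : Fin n → ℝ) x.1 := by
  have : ∀ x ∈ freeSet Δ V₀, (#{z ∈ freeSet Δ V₀ | z.1 = x.1 ∧ z ≠ x} : ℝ) =
      2 - leafSum Δ V₀ (1 : Fin n → ℝ) x.1 := by
    intro x hx
    have h := sum_siblings Δ V₀ x fun _ => 1
    rw [sum_const, nsmul_eq_mul, mul_one] at h
    have hx' := mem_freeSet.1 hx
    have h2 : Δ.target x ∉ V₀ := hx'.2
    rw [h, leafSum, sum_fin_three _ x.2]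
    simp only [IsFree, hx'.1, not_false_iff, true_and, Pi.one_apply, Prod.mk.eta, h2, if_false]
    split_ifs <;> norm_num
  rw [sum_congr rfl this, Finset.sum_sub_distrib, sum_const, nsmul_eq_mul, mul_comm]

/-- The half-edges at a star are few: a hub belongs to at most four vertices. -/
theorem card_hub_le (Δ : Configuration n 3) (V₀ : Finset (Fin n)) (c : Fin n)
    (R : Finset (HalfEdge n 3)) : #{y ∈ R | c = hub Δ V₀ y.1} ≤ 12 := by
  classical
  set T : Finset (Fin n) := insert c ((univ : Finset (Fin 3)).image fun j => Δ.target (c, j))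
  have hT : #T ≤ 4 := by
    refine (card_insert_le _ _).trans ?_
    have : #((univ : Finset (Fin 3)).image fun j => Δ.target (c, j)) ≤ 3 := card_image_le
    omega
  have hsub : {y ∈ R | c = hub Δ V₀ y.1} ⊆ T ×ˢ (univ : Finset (Fin 3)) := by
    intro y hy
    have h := (mem_filter.1 hy).2
    refine mem_product.2 ⟨?_, mem_univ _⟩
    rcases hub_eq_or Δ V₀ y.1 with h' | ⟨x, -, hx, h'⟩
    · exact mem_insert.2 (Or.inl (h'.symm.trans h.symm))
    · refine mem_insert_of_mem (mem_image.2 ⟨x.2, mem_univ _, ?_⟩)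
      rw [h, h', ← hx]
  have := card_le_card hsub
  rw [card_product, card_univ, Fintype.card_fin] at this
  omega

/-! ### Expectations over a star class -/

/-- The indicator that `z` is another half-edge at the vertex of `x`. -/
def sibling (x z : HalfEdge n d) : ℝ := if z.1 = x.1 ∧ z ≠ x then 1 else 0

/-- The indicator that the vertices of two half-edges have the same hub. -/
def sameHub (Δ : Configuration n d) (V₀ : Finset (Fin n)) (y w : HalfEdge n d) : ℝ :=
  if hub Δ V₀ y.1 = hub Δ V₀ w.1 then 1 else 0

theorem sibling_nonneg (x z : HalfEdge n d) : 0 ≤ sibling x z := by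
  unfold sibling; split_ifs <;> norm_num

theorem sameHub_nonneg (Δ : Configuration n d) (V₀ : Finset (Fin n)) (y w : HalfEdge n d) :
    0 ≤ sameHub Δ V₀ y w := by
  unfold sameHub; split_ifs <;> norm_num

/-- A sum over `R` exceeds the sum over `B` by at most one term, if all other terms vanish. -/
theorem sum_le_sum_add {X : Type} [DecidableEq X] {R B : Finset X} (hB : B ⊆ R) (f : X → ℝ)
    (hf : ∀ x, 0 ≤ f x) (a : X) (h : ∀ x ∈ R, x ∉ B → x ≠ a → f x = 0) :
    ∑ x ∈ R, f x ≤ ∑ x ∈ B, f x + f a := by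
  have h1 : ∀ x ∈ R, f x ≤ (if x ∈ B then f x else 0) + if x = a then f x else 0 := by
    intro x hx
    by_cases h1 : x ∈ B <;> by_cases h2 : x = a
    · rw [if_pos h1, if_pos h2]
      linarith [hf x]
    · rw [if_pos h1, if_neg h2, add_zero]
    · rw [if_neg h1, if_pos h2, zero_add]
    · rw [if_neg h1, if_neg h2, h x hx h1 h2, add_zero]
  refine (sum_le_sum h1).trans ?_
  rw [Finset.sum_add_distrib, Finset.sum_ite_mem, inter_eq_right.2 hB]
  refine add_le_add le_rfl ?_
  rw [Finset.sum_ite_eq']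
  split_ifs
  exacts [le_rfl, hf a]

theorem sum_siblings_eq (R : Finset (HalfEdge n d)) (x : HalfEdge n d) (f : HalfEdge n d → ℝ) :
    ∑ z ∈ R with z.1 = x.1 ∧ z ≠ x, f z = ∑ z ∈ R, sibling x z * f z := by
  rw [Finset.sum_filter]
  refine sum_congr rfl fun z _ => ?_
  unfold sibling
  split_ifs <;> simp

section StarClass

variable {Δ₀ Δ : Configuration n 3} {V₀ : Finset (Fin n)}

theorem sum_mul_remoteWeight (h : Δ ∈ starClass Δ₀ V₀) (f : HalfEdge n 3 → ℝ) :
    ∑ x, f x * remoteWeight Δ V₀ 1 x =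
      ∑ x ∈ freeSet Δ₀ V₀, f x * leafSum Δ₀ V₀ 1 (Δ.1 x).1 := by
  unfold freeSet
  rw [Finset.sum_filter]
  refine sum_congr rfl fun x _ => ?_
  unfold remoteWeight
  simp only [isFree_iff_of_mem_starClass h, leafSum_of_mem_starClass h]
  split_ifs
  · rfl
  · rw [mul_zero]

theorem remoteSum_of_mem_starClass (h : Δ ∈ starClass Δ₀ V₀) (x : HalfEdge n 3) :
    remoteSum Δ V₀ 1 x =
      ∑ z ∈ freeSet Δ₀ V₀, sibling x z * leafSum Δ₀ V₀ 1 (Δ.1 z).1 := by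
  rw [remoteSum_eq_sum, sum_siblings_eq, freeSet_of_mem_starClass h]
  simp only [leafSum_of_mem_starClass h]

theorem closesOne_iff (h : Δ ∈ starClass Δ₀ V₀) (x : HalfEdge n 3) :
    ClosesOne Δ V₀ x ↔ x ∈ freeSet Δ₀ V₀ ∧ hub Δ₀ V₀ x.1 = hub Δ₀ V₀ (Δ.1 x).1 := by
  unfold ClosesOne
  rw [isFree_iff_of_mem_starClass h, mem_freeSet, hub_of_mem_starClass h, hub_of_mem_starClass h]
  rfl

theorem closesTwo_iff (h : Δ ∈ starClass Δ₀ V₀) (x z : HalfEdge n 3) :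
    ClosesTwo Δ V₀ x z ↔ x ∈ freeSet Δ₀ V₀ ∧ z ∈ freeSet Δ₀ V₀ ∧ z.1 = x.1 ∧ z ≠ x ∧
      hub Δ₀ V₀ (Δ.1 x).1 = hub Δ₀ V₀ (Δ.1 z).1 := by
  unfold ClosesTwo
  rw [isFree_iff_of_mem_starClass h, isFree_iff_of_mem_starClass h, mem_freeSet, mem_freeSet,
    hub_of_mem_starClass h, hub_of_mem_starClass h]
  rfl

theorem numClosesOne_eq (h : Δ ∈ starClass Δ₀ V₀) :
    (numClosesOne Δ V₀ : ℝ) = ∑ x ∈ freeSet Δ₀ V₀, sameHub Δ₀ V₀ x (Δ.1 x) := by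
  classical
  unfold numClosesOne
  rw [Finset.card_filter, Nat.cast_sum, ← Finset.sum_filter_add_sum_filter_not univ
    (fun x => x ∈ freeSet Δ₀ V₀), Finset.sum_eq_zero (s := {x | x ∉ freeSet Δ₀ V₀}), add_zero]
  · rw [Finset.filter_univ_mem]
    refine sum_congr rfl fun x hx => ?_
    unfold sameHub
    simp only [closesOne_iff h, hx, true_and]
    split_ifs <;> simp
  · intro x hx
    have := (mem_filter.1 hx).2
    simp [closesOne_iff h, this]

/-- The mate of `x` may be a sibling of `x`, but then `x` belongs to a loop; this is covered by the
last term. -/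
theorem sum_sibling_mul_le (Δ₀ Δ : Configuration n 3) (V₀ : Finset (Fin n)) (x : HalfEdge n 3)
    (f : HalfEdge n 3 → ℝ) (hf : ∀ z, 0 ≤ f z) (c : ℝ) (hc : ∀ z, f z ≤ c) :
    ∑ z ∈ freeSet Δ₀ V₀, sibling x z * f z ≤
      ∑ z ∈ freeSet Δ₀ V₀ \ {x, Δ.1 x}, sibling x z * f z + c * sameHub Δ₀ V₀ x (Δ.1 x) := by
  refine (sum_le_sum_add sdiff_subset _ (fun z => mul_nonneg (sibling_nonneg _ _) (hf z))
    (Δ.1 x) ?_).trans (add_le_add le_rfl ?_)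
  · intro z hz hz' hne
    have : z = x := by
      by_contra hzx
      exact hz' (by simp [hz, hzx, hne])
    simp [this, sibling]
  · have hc0 : 0 ≤ c := (hf x).trans (hc x)
    unfold sibling sameHub
    by_cases hs : (Δ.1 x).1 = x.1
    · rw [if_pos ⟨hs, Δ.2.2 x⟩, if_pos (by rw [hs])]
      linarith [hc (Δ.1 x)]
    · rw [if_neg fun h => hs h.1]
      split_ifs <;> linarith

/-- The half-edges that are counted lie on distinct edges, up to loops. -/
theorem numClosesTwo_le (h : Δ ∈ starClass Δ₀ V₀) :
    (numClosesTwo Δ V₀ : ℝ) ≤ ∑ x ∈ freeSet Δ₀ V₀, ∑ z ∈ freeSet Δ₀ V₀ \ {x, Δ.1 x},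
      sibling x z * sameHub Δ₀ V₀ (Δ.1 x) (Δ.1 z) + numClosesOne Δ V₀ := by
  classical
  have h1 : (numClosesTwo Δ V₀ : ℝ) = ∑ x ∈ freeSet Δ₀ V₀, ∑ z ∈ freeSet Δ₀ V₀,
      sibling x z * sameHub Δ₀ V₀ (Δ.1 x) (Δ.1 z) := by
    unfold numClosesTwo
    rw [Finset.card_filter, Nat.cast_sum, Fintype.sum_prod_type]
    rw [← Finset.sum_subset (subset_univ (freeSet Δ₀ V₀))]
    · refine sum_congr rfl fun x hx => ?_
      rw [← Finset.sum_subset (subset_univ (freeSet Δ₀ V₀))]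
      · refine sum_congr rfl fun z hz => ?_
        unfold sibling sameHub
        simp only [closesTwo_iff h, hx, hz, true_and]
        by_cases e1 : z.1 = x.1 <;> by_cases e2 : z = x <;>
          by_cases e3 : hub Δ₀ V₀ (Δ.1 x).1 = hub Δ₀ V₀ (Δ.1 z).1 <;> simp [e1, e2, e3]
      · intro z _ hz
        simp [closesTwo_iff h, hz]
    · intro x _ hx
      exact sum_eq_zero fun z _ => by simp [closesTwo_iff h, hx]
  rw [h1, numClosesOne_eq h, ← Finset.sum_add_distrib]
  refine sum_le_sum fun x hx => ?_
  have := sum_sibling_mul_le Δ₀ Δ V₀ x (fun z => sameHub Δ₀ V₀ (Δ.1 x) (Δ.1 z))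
    (fun z => sameHub_nonneg _ _ _ _) 1 fun z => by unfold sameHub; split_ifs <;> norm_num
  rwa [one_mul] at this

theorem numClosesThree_le (h : Δ ∈ starClass Δ₀ V₀) :
    (numClosesThree Δ V₀ : ℝ) ≤ ∑ x ∈ freeSet Δ₀ V₀, ∑ z ∈ freeSet Δ₀ V₀ \ {x, Δ.1 x},
      ∑ u ∈ (freeSet Δ₀ V₀ \ {x, Δ.1 x}) \ {z, Δ.1 z},
        sibling x z * sibling (Δ.1 x) u * sameHub Δ₀ V₀ (Δ.1 z) (Δ.1 u) := by
  classical
  have key : ∀ x z u, ClosesThree Δ V₀ x z u → x ∈ freeSet Δ₀ V₀ ∧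
      z ∈ freeSet Δ₀ V₀ \ {x, Δ.1 x} ∧ u ∈ (freeSet Δ₀ V₀ \ {x, Δ.1 x}) \ {z, Δ.1 z} ∧
      sibling x z * sibling (Δ.1 x) u * sameHub Δ₀ V₀ (Δ.1 z) (Δ.1 u) = 1 := by
    rintro x z u ⟨hx, hz, hu, e1, e2, e3, e4, hne, he⟩
    rw [isFree_iff_of_mem_starClass h, ← mem_freeSet] at hx hz hu
    have hv : x.1 ≠ (Δ.1 x).1 := fun h' => hne (congrArg _ h')
    have h1 : z ≠ Δ.1 x := fun h' => hv (by rw [← h', e1])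
    have h2 : u ≠ x := fun h' => hv (by rw [← congrArg Prod.fst h', e3]; rfl)
    have h3 : u ≠ z := fun h' => hv (by rw [← e1, ← h', e3]; rfl)
    have h4 : u ≠ Δ.1 z := by
      intro h'
      have e5 : Δ.target u = x.1 := by rw [h', Δ.target_apply, e1]
      have e6 : Δ.target z = Δ.target x := by rw [← e3, h']; rfl
      rw [e5, e6] at he
      exact hne he.symm
    refine ⟨hx, by simp [hz, e2, h1], by simp [hu, e4, h2, h3, h4], ?_⟩
    unfold sibling sameHub
    rw [hub_of_mem_starClass h, hub_of_mem_starClass h] at he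
    change hub Δ₀ V₀ (Δ.1 z).1 = hub Δ₀ V₀ (Δ.1 u).1 at he
    rw [if_pos ⟨e1, e2⟩, if_pos ⟨e3, e4⟩, if_pos he]
    norm_num
  have hnn : ∀ x z u, 0 ≤ sibling x z * sibling (Δ.1 x) u * sameHub Δ₀ V₀ (Δ.1 z) (Δ.1 u) :=
    fun x z u => mul_nonneg (mul_nonneg (sibling_nonneg _ _) (sibling_nonneg _ _))
      (sameHub_nonneg _ _ _ _)
  unfold numClosesThree
  rw [Finset.card_filter, Nat.cast_sum, Fintype.sum_prod_type]
  have hpair : ∀ f : HalfEdge n 3 × HalfEdge n 3 → ℝ, ∑ p, f p = ∑ z, ∑ u, f (z, u) :=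
    fun f => Fintype.sum_prod_type f
  simp only [hpair]
  rw [← Finset.sum_subset (subset_univ (freeSet Δ₀ V₀))]
  · refine sum_le_sum fun x hx => ?_
    rw [← Finset.sum_subset (subset_univ (freeSet Δ₀ V₀ \ {x, Δ.1 x}))]
    · refine sum_le_sum fun z hz => ?_
      rw [← Finset.sum_subset (subset_univ ((freeSet Δ₀ V₀ \ {x, Δ.1 x}) \ {z, Δ.1 z}))]
      · refine sum_le_sum fun u hu => ?_
        split_ifs with hc
        · rw [(key x z u hc).2.2.2]; simp
        · simpa using hnn x z u
      · intro u _ hu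
        rw [if_neg fun hc => hu (key x z u hc).2.2.1, Nat.cast_zero]
    · intro z _ hz
      exact sum_eq_zero fun u _ => by rw [if_neg fun hc => hz (key x z u hc).2.1, Nat.cast_zero]
  · intro x _ hx
    exact sum_eq_zero fun z _ => sum_eq_zero fun u _ => by
      rw [if_neg fun hc => hx (key x z u hc).1, Nat.cast_zero]

theorem sum_remoteWeight_mul_remoteSum_le (h : Δ ∈ starClass Δ₀ V₀) :
    ∑ x, remoteWeight Δ V₀ 1 x * remoteSum Δ V₀ 1 x ≤
      ∑ x ∈ freeSet Δ₀ V₀, ∑ z ∈ freeSet Δ₀ V₀ \ {x, Δ.1 x},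
        sibling x z * leafSum Δ₀ V₀ 1 (Δ.1 x).1 * leafSum Δ₀ V₀ 1 (Δ.1 z).1 +
      9 * numClosesOne Δ V₀ := by
  have h3 : ∀ w, leafSum Δ₀ V₀ (1 : Fin n → ℝ) w ≤ 3 := fun w => by
    have := leafSum_one_le Δ₀ V₀ w
    push_cast at this; exact this
  have h0 := leafSum_one_nonneg Δ₀ V₀
  simp only [mul_comm (remoteWeight Δ V₀ 1 _) (remoteSum Δ V₀ 1 _)]
  rw [sum_mul_remoteWeight h, numClosesOne_eq h, Finset.mul_sum, ← Finset.sum_add_distrib]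
  refine sum_le_sum fun x hx => ?_
  have := sum_sibling_mul_le Δ₀ Δ V₀ x
    (fun z => leafSum Δ₀ V₀ 1 (Δ.1 x).1 * leafSum Δ₀ V₀ 1 (Δ.1 z).1)
    (fun z => mul_nonneg (h0 _) (h0 _)) 9
    fun z => by nlinarith [h3 (Δ.1 x).1, h3 (Δ.1 z).1, h0 (Δ.1 x).1, h0 (Δ.1 z).1]
  rw [remoteSum_of_mem_starClass h, Finset.sum_mul]
  refine le_trans (le_of_eq (sum_congr rfl fun z _ => by ring)) (this.trans (le_of_eq ?_))
  congr 1
  exact sum_congr rfl fun z _ => by ring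

theorem sum_remoteSum_mul_remoteSum_le (h : Δ ∈ starClass Δ₀ V₀) :
    ∑ x with IsFree Δ V₀ x, remoteSum Δ V₀ 1 x * remoteSum Δ V₀ 1 (Δ.1 x) ≤
      ∑ x ∈ freeSet Δ₀ V₀, ∑ z ∈ freeSet Δ₀ V₀ \ {x, Δ.1 x},
        ∑ u ∈ (freeSet Δ₀ V₀ \ {x, Δ.1 x}) \ {z, Δ.1 z},
          sibling x z * sibling (Δ.1 x) u * leafSum Δ₀ V₀ 1 (Δ.1 z).1 *
            leafSum Δ₀ V₀ 1 (Δ.1 u).1 +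
      36 * numClosesOne Δ V₀ + 9 * numClosesTwo Δ V₀ := by
  classical
  set τ : HalfEdge n 3 → ℝ := fun z => leafSum Δ₀ V₀ 1 z.1 with hτ
  have h3 : ∀ w, τ w ≤ 3 := fun w => by
    have := leafSum_one_le Δ₀ V₀ w.1
    push_cast at this; exact this
  have h0 : ∀ w, 0 ≤ τ w := fun w => leafSum_one_nonneg Δ₀ V₀ w.1
  have hc2 : ∑ x ∈ freeSet Δ₀ V₀, ∑ z, (if ClosesTwo Δ V₀ x z then (1 : ℝ) else 0) ≤
      numClosesTwo Δ V₀ := by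
    unfold numClosesTwo
    rw [Finset.card_filter, Nat.cast_sum, Fintype.sum_prod_type]
    simp only [Nat.cast_ite, Nat.cast_one, Nat.cast_zero]
    exact sum_le_sum_of_subset_of_nonneg (subset_univ _) fun x _ _ =>
      sum_nonneg fun z _ => by split_ifs <;> norm_num
  have hx : ∀ x ∈ freeSet Δ₀ V₀, remoteSum Δ V₀ 1 x * remoteSum Δ V₀ 1 (Δ.1 x) ≤
      ∑ z ∈ freeSet Δ₀ V₀ \ {x, Δ.1 x}, ∑ u ∈ (freeSet Δ₀ V₀ \ {x, Δ.1 x}) \ {z, Δ.1 z},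
        sibling x z * sibling (Δ.1 x) u * τ (Δ.1 z) * τ (Δ.1 u) +
      36 * sameHub Δ₀ V₀ x (Δ.1 x) +
      9 * ∑ z, (if ClosesTwo Δ V₀ x z then (1 : ℝ) else 0) := by
    intro x hx
    have hn1 : 0 ≤ ∑ z ∈ freeSet Δ₀ V₀ \ {x, Δ.1 x},
        ∑ u ∈ (freeSet Δ₀ V₀ \ {x, Δ.1 x}) \ {z, Δ.1 z},
          sibling x z * sibling (Δ.1 x) u * τ (Δ.1 z) * τ (Δ.1 u) :=
      sum_nonneg fun z _ => sum_nonneg fun u _ => mul_nonneg (mul_nonneg (mul_nonneg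
        (sibling_nonneg _ _) (sibling_nonneg _ _)) (h0 _)) (h0 _)
    have hn2 : 0 ≤ ∑ z, (if ClosesTwo Δ V₀ x z then (1 : ℝ) else 0) :=
      sum_nonneg fun z _ => by split_ifs <;> norm_num
    by_cases hc : hub Δ₀ V₀ x.1 = hub Δ₀ V₀ (Δ.1 x).1
    · have e1 : sameHub Δ₀ V₀ x (Δ.1 x) = 1 := if_pos hc
      have e2 := remoteSum_one_le Δ V₀ x
      have e3 := remoteSum_one_le Δ V₀ (Δ.1 x)
      have e4 := remoteSum_one_nonneg Δ V₀ x
      have e5 := remoteSum_one_nonneg Δ V₀ (Δ.1 x)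
      rw [e1]
      nlinarith
    · have hv : x.1 ≠ (Δ.1 x).1 := fun h' => hc (congrArg _ h')
      have e1 : sameHub Δ₀ V₀ x (Δ.1 x) = 0 := if_neg hc
      rw [e1, mul_zero, add_zero, remoteSum_of_mem_starClass h, remoteSum_of_mem_starClass h]
      have e2 := sum_sibling_mul_le Δ₀ Δ V₀ x (fun z => τ (Δ.1 z)) (fun z => h0 _) 3 (fun z => h3 _)
      rw [e1, mul_zero, add_zero] at e2
      have hSnn : 0 ≤ ∑ u ∈ freeSet Δ₀ V₀, sibling (Δ.1 x) u * τ (Δ.1 u) :=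
        sum_nonneg fun u _ => mul_nonneg (sibling_nonneg _ _) (h0 _)
      refine (mul_le_mul_of_nonneg_right e2 hSnn).trans ?_
      have hsub : ∑ z ∈ freeSet Δ₀ V₀ \ {x, Δ.1 x}, (if ClosesTwo Δ V₀ x z then (1 : ℝ) else 0) ≤
          ∑ z, (if ClosesTwo Δ V₀ x z then (1 : ℝ) else 0) :=
        sum_le_sum_of_subset_of_nonneg (subset_univ _) fun z _ _ => by split_ifs <;> norm_num
      refine le_trans ?_ (add_le_add le_rfl (mul_le_mul_of_nonneg_left hsub (by norm_num)))
      rw [Finset.sum_mul, Finset.mul_sum, ← Finset.sum_add_distrib]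
      refine sum_le_sum fun z hz => ?_
      by_cases hs : z.1 = x.1 ∧ z ≠ x
      swap
      · have : sibling x z = 0 := if_neg hs
        rw [this]
        simp only [zero_mul, sum_const_zero, zero_add]
        split_ifs <;> norm_num
      have hs1 : sibling x z = 1 := if_pos hs
      have hzR : z ∈ freeSet Δ₀ V₀ := (mem_sdiff.1 hz).1
      simp only [hs1, one_mul]
      have e3 := sum_le_sum_add (R := freeSet Δ₀ V₀)
        (B := (freeSet Δ₀ V₀ \ {x, Δ.1 x}) \ {z, Δ.1 z})
        (sdiff_subset.trans sdiff_subset) (fun u => sibling (Δ.1 x) u * τ (Δ.1 u))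
        (fun u => mul_nonneg (sibling_nonneg _ _) (h0 _)) (Δ.1 z) (by
          intro u hu hu' hne
          have : u = x ∨ u = Δ.1 x ∨ u = z := by
            by_contra hcon
            push Not at hcon
            exact hu' (by simp [hu, hne, hcon])
          have h0' : sibling (Δ.1 x) u = 0 := by
            refine if_neg fun h' => ?_
            rcases this with rfl | rfl | rfl
            · exact hv h'.1
            · exact h'.2 rfl
            · exact hv (hs.1.symm.trans h'.1)
          change sibling (Δ.1 x) u * τ (Δ.1 u) = 0
          rw [h0', zero_mul])
      refine (mul_le_mul_of_nonneg_left e3 (h0 _)).trans ?_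
      rw [mul_add, Finset.mul_sum]
      refine add_le_add (le_of_eq (sum_congr rfl fun u _ => by ring)) ?_
      rw [Δ.2.1]
      by_cases hs2 : (Δ.1 z).1 = (Δ.1 x).1 ∧ Δ.1 z ≠ Δ.1 x
      · have : ClosesTwo Δ V₀ x z :=
          (closesTwo_iff h x z).2 ⟨hx, hzR, hs.1, hs.2, by rw [hs2.1]⟩
        rw [if_pos this]
        have : sibling (Δ.1 x) (Δ.1 z) = 1 := if_pos hs2
        rw [this]
        nlinarith [h3 z, h3 (Δ.1 z), h0 z, h0 (Δ.1 z)]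
      · have : sibling (Δ.1 x) (Δ.1 z) = 0 := if_neg hs2
        rw [this]
        split_ifs <;> norm_num
  have e0 : ({x : HalfEdge n 3 | IsFree Δ V₀ x} : Finset (HalfEdge n 3)) = freeSet Δ₀ V₀ :=
    freeSet_of_mem_starClass h
  rw [e0]
  refine (sum_le_sum hx).trans ?_
  rw [Finset.sum_add_distrib, Finset.sum_add_distrib, ← Finset.mul_sum, ← Finset.mul_sum,
    ← numClosesOne_eq h]
  linarith

end StarClass

section StarClassSums

variable {Δ₀ : Configuration n 3} {V₀ : Finset (Fin n)}

theorem sum_sibling_eq (Δ : Configuration n 3) (V₀ : Finset (Fin n)) :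
    ∑ x ∈ freeSet Δ V₀, ∑ z ∈ freeSet Δ V₀, sibling x z =
      2 * #(freeSet Δ V₀) - ∑ x ∈ freeSet Δ V₀, leafSum Δ V₀ (1 : Fin n → ℝ) x.1 := by
  rw [← sum_card_siblings]
  refine sum_congr rfl fun x _ => ?_
  have := sum_siblings_eq (freeSet Δ V₀) x fun _ => 1
  simpa using this.symm

theorem sum_sibling_le (Δ : Configuration n 3) (V₀ : Finset (Fin n)) :
    ∑ x ∈ freeSet Δ V₀, ∑ z ∈ freeSet Δ V₀, sibling x z ≤ 2 * #(freeSet Δ V₀) := by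
  rw [sum_sibling_eq]
  have : 0 ≤ ∑ x ∈ freeSet Δ V₀, leafSum Δ V₀ (1 : Fin n → ℝ) x.1 :=
    sum_nonneg fun x _ => leafSum_one_nonneg Δ V₀ x.1
  linarith

theorem sum_sameHub_le (Δ : Configuration n 3) (V₀ : Finset (Fin n)) :
    ∑ x ∈ freeSet Δ V₀, ∑ y ∈ freeSet Δ V₀, sameHub Δ V₀ x y ≤ 12 * #(freeSet Δ V₀) := by
  rw [mul_comm, ← nsmul_eq_mul, ← sum_const]
  refine sum_le_sum fun x _ => ?_
  have := card_hub_le Δ V₀ (hub Δ V₀ x.1) (freeSet Δ V₀)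
  unfold sameHub
  rw [← Finset.sum_filter, sum_const, nsmul_eq_mul, mul_one]
  exact_mod_cast this

/-- The mate of `x` is distributed uniformly over the other free half-edges. The bounds that follow
treat two and three edges in the same way. -/
theorem sum_leafSum_mul_remoteWeight_le (hr : 5 ≤ #(freeSet Δ₀ V₀)) :
    ((#(freeSet Δ₀ V₀) : ℝ) - 1) * ∑ Δ ∈ starClass Δ₀ V₀,
        ∑ x, leafSum Δ V₀ 1 x.1 * remoteWeight Δ V₀ 1 x ≤
      #(starClass Δ₀ V₀) * (∑ x ∈ freeSet Δ₀ V₀, leafSum Δ₀ V₀ 1 x.1) ^ 2 := by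
  have h := sum_one_edge_le (apply_mem_freeSet Δ₀ V₀) (by omega)
    (fun x y => leafSum Δ₀ V₀ 1 x.1 * leafSum Δ₀ V₀ 1 y.1)
    fun x y => mul_nonneg (leafSum_one_nonneg _ _ _) (leafSum_one_nonneg _ _ _)
  rw [sq, Finset.sum_mul_sum]
  refine le_trans (le_of_eq ?_) h
  congr 1
  refine sum_congr rfl fun Δ hΔ => ?_
  simp only [leafSum_of_mem_starClass hΔ]
  exact sum_mul_remoteWeight hΔ _

theorem sum_sibling_mul_leafSum_mul_leafSum_le (hr : 5 ≤ #(freeSet Δ₀ V₀)) :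
    ((#(freeSet Δ₀ V₀) : ℝ) - 1) * ((#(freeSet Δ₀ V₀) : ℝ) - 3) * ∑ Δ ∈ starClass Δ₀ V₀,
        ∑ x ∈ freeSet Δ₀ V₀, ∑ z ∈ freeSet Δ₀ V₀ \ {x, Δ.1 x},
          sibling x z * leafSum Δ₀ V₀ 1 (Δ.1 x).1 * leafSum Δ₀ V₀ 1 (Δ.1 z).1 ≤
      #(starClass Δ₀ V₀) * ((∑ x ∈ freeSet Δ₀ V₀, ∑ z ∈ freeSet Δ₀ V₀, sibling x z) *
        (∑ x ∈ freeSet Δ₀ V₀, leafSum Δ₀ V₀ 1 x.1) ^ 2) := by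
  have h := sum_two_edges_le (apply_mem_freeSet Δ₀ V₀) (by omega)
    (fun x y z w => sibling x z * leafSum Δ₀ V₀ 1 y.1 * leafSum Δ₀ V₀ 1 w.1)
    fun x y z w => mul_nonneg (mul_nonneg (sibling_nonneg _ _) (leafSum_one_nonneg _ _ _))
      (leafSum_one_nonneg _ _ _)
  refine h.trans (le_of_eq ?_)
  congr 1
  simp only [← Finset.mul_sum, ← Finset.sum_mul]
  ring

theorem sum_sibling_mul_sibling_mul_leafSum_le (hr : 5 ≤ #(freeSet Δ₀ V₀)) :
    ((#(freeSet Δ₀ V₀) : ℝ) - 1) * (((#(freeSet Δ₀ V₀) : ℝ) - 3) * ((#(freeSet Δ₀ V₀) : ℝ) - 5)) *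
      ∑ Δ ∈ starClass Δ₀ V₀, ∑ x ∈ freeSet Δ₀ V₀, ∑ z ∈ freeSet Δ₀ V₀ \ {x, Δ.1 x},
        ∑ u ∈ (freeSet Δ₀ V₀ \ {x, Δ.1 x}) \ {z, Δ.1 z},
          sibling x z * sibling (Δ.1 x) u * leafSum Δ₀ V₀ 1 (Δ.1 z).1 *
            leafSum Δ₀ V₀ 1 (Δ.1 u).1 ≤
      #(starClass Δ₀ V₀) * ((∑ x ∈ freeSet Δ₀ V₀, ∑ z ∈ freeSet Δ₀ V₀, sibling x z) ^ 2 *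
        (∑ x ∈ freeSet Δ₀ V₀, leafSum Δ₀ V₀ 1 x.1) ^ 2) := by
  have h := sum_three_edges_le (apply_mem_freeSet Δ₀ V₀) hr
    (fun x y z w u v => sibling x z * sibling y u * leafSum Δ₀ V₀ 1 w.1 * leafSum Δ₀ V₀ 1 v.1)
    fun x y z w u v => mul_nonneg (mul_nonneg (mul_nonneg (sibling_nonneg _ _)
      (sibling_nonneg _ _)) (leafSum_one_nonneg _ _ _)) (leafSum_one_nonneg _ _ _)
  refine h.trans (le_of_eq ?_)
  congr 1
  simp only [← Finset.mul_sum, ← Finset.sum_mul]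
  ring

theorem sum_numClosesOne_le (hr : 5 ≤ #(freeSet Δ₀ V₀)) :
    ((#(freeSet Δ₀ V₀) : ℝ) - 1) * ∑ Δ ∈ starClass Δ₀ V₀, (numClosesOne Δ V₀ : ℝ) ≤
      #(starClass Δ₀ V₀) * (12 * #(freeSet Δ₀ V₀)) := by
  have h := sum_one_edge_le (apply_mem_freeSet Δ₀ V₀) (by omega) (sameHub Δ₀ V₀)
    (sameHub_nonneg Δ₀ V₀)
  refine le_trans (le_of_eq ?_) (h.trans
    (mul_le_mul_of_nonneg_left (sum_sameHub_le Δ₀ V₀) (Nat.cast_nonneg _)))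
  congr 1
  exact sum_congr rfl fun Δ hΔ => numClosesOne_eq hΔ

theorem sum_sibling_mul_sameHub_le (hr : 5 ≤ #(freeSet Δ₀ V₀)) :
    ((#(freeSet Δ₀ V₀) : ℝ) - 1) * ((#(freeSet Δ₀ V₀) : ℝ) - 3) * ∑ Δ ∈ starClass Δ₀ V₀,
        ∑ x ∈ freeSet Δ₀ V₀, ∑ z ∈ freeSet Δ₀ V₀ \ {x, Δ.1 x},
          sibling x z * sameHub Δ₀ V₀ (Δ.1 x) (Δ.1 z) ≤
      #(starClass Δ₀ V₀) * (24 * (#(freeSet Δ₀ V₀) : ℝ) ^ 2) := by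
  have h := sum_two_edges_le (apply_mem_freeSet Δ₀ V₀) (by omega)
    (fun x y z w => sibling x z * sameHub Δ₀ V₀ y w)
    fun x y z w => mul_nonneg (sibling_nonneg _ _) (sameHub_nonneg _ _ _ _)
  refine h.trans (mul_le_mul_of_nonneg_left ?_ (Nat.cast_nonneg _))
  have e : ∑ x ∈ freeSet Δ₀ V₀, ∑ y ∈ freeSet Δ₀ V₀, ∑ z ∈ freeSet Δ₀ V₀, ∑ w ∈ freeSet Δ₀ V₀,
      sibling x z * sameHub Δ₀ V₀ y w =
      (∑ x ∈ freeSet Δ₀ V₀, ∑ z ∈ freeSet Δ₀ V₀, sibling x z) *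
        ∑ y ∈ freeSet Δ₀ V₀, ∑ w ∈ freeSet Δ₀ V₀, sameHub Δ₀ V₀ y w := by
    simp only [← Finset.mul_sum, ← Finset.sum_mul]
  rw [e]
  have h1 := sum_sibling_le Δ₀ V₀
  have h2 := sum_sameHub_le Δ₀ V₀
  have h3 : 0 ≤ ∑ y ∈ freeSet Δ₀ V₀, ∑ w ∈ freeSet Δ₀ V₀, sameHub Δ₀ V₀ y w :=
    sum_nonneg fun _ _ => sum_nonneg fun _ _ => sameHub_nonneg _ _ _ _
  refine (mul_le_mul h1 h2 h3 (by positivity)).trans (le_of_eq ?_)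
  ring

theorem sum_numClosesThree_le (hr : 5 ≤ #(freeSet Δ₀ V₀)) :
    ((#(freeSet Δ₀ V₀) : ℝ) - 1) * (((#(freeSet Δ₀ V₀) : ℝ) - 3) * ((#(freeSet Δ₀ V₀) : ℝ) - 5)) *
      ∑ Δ ∈ starClass Δ₀ V₀, (numClosesThree Δ V₀ : ℝ) ≤
      #(starClass Δ₀ V₀) * (48 * (#(freeSet Δ₀ V₀) : ℝ) ^ 3) := by
  have h := sum_three_edges_le (apply_mem_freeSet Δ₀ V₀) hr
    (fun x y z w u v => sibling x z * sibling y u * sameHub Δ₀ V₀ w v)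
    fun x y z w u v => mul_nonneg (mul_nonneg (sibling_nonneg _ _) (sibling_nonneg _ _))
      (sameHub_nonneg _ _ _ _)
  have hr' : (5 : ℝ) ≤ #(freeSet Δ₀ V₀) := by exact_mod_cast hr
  refine le_trans (mul_le_mul_of_nonneg_left (sum_le_sum fun Δ hΔ => numClosesThree_le hΔ)
    (mul_nonneg (by linarith) (mul_nonneg (by linarith) (by linarith)))) (h.trans
    (mul_le_mul_of_nonneg_left ?_ (Nat.cast_nonneg _)))
  have e : ∑ x ∈ freeSet Δ₀ V₀, ∑ y ∈ freeSet Δ₀ V₀, ∑ z ∈ freeSet Δ₀ V₀, ∑ w ∈ freeSet Δ₀ V₀,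
      ∑ u ∈ freeSet Δ₀ V₀, ∑ v ∈ freeSet Δ₀ V₀, sibling x z * sibling y u * sameHub Δ₀ V₀ w v =
      (∑ x ∈ freeSet Δ₀ V₀, ∑ z ∈ freeSet Δ₀ V₀, sibling x z) ^ 2 *
        ∑ y ∈ freeSet Δ₀ V₀, ∑ w ∈ freeSet Δ₀ V₀, sameHub Δ₀ V₀ y w := by
    simp only [← Finset.mul_sum, ← Finset.sum_mul]
    ring
  rw [e]
  have h1 := sum_sibling_le Δ₀ V₀
  have h2 := sum_sameHub_le Δ₀ V₀
  have h3 : 0 ≤ ∑ y ∈ freeSet Δ₀ V₀, ∑ w ∈ freeSet Δ₀ V₀, sameHub Δ₀ V₀ y w :=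
    sum_nonneg fun _ _ => sum_nonneg fun _ _ => sameHub_nonneg _ _ _ _
  have h4 : 0 ≤ ∑ y ∈ freeSet Δ₀ V₀, ∑ w ∈ freeSet Δ₀ V₀, sibling y w :=
    sum_nonneg fun _ _ => sum_nonneg fun _ _ => sibling_nonneg _ _
  refine (mul_le_mul (pow_le_pow_left₀ h4 h1 2) h2 h3 (by positivity)).trans (le_of_eq ?_)
  ring

end StarClassSums

/-- The expected values of the three sums in `mainTerm` differ by bounded multiples of `1 + i` from
their values for regular stars: `r` is the number of free half-edges, `A` and `L` are the sums over
them of `leafSum` and of the number of free siblings (other free half-edges at the same vertex), and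
`i` is the number of irregular stars. -/
theorem moment_bounds {n k i r A L x : ℝ} (hn : 20 ≤ n) (hk : 0 ≤ k) (hkn : 4 * k ≤ n) (hi : 0 ≤ i)
    (hik : i ≤ k) (hr : 3 * n - 6 * k ≤ r) (hA : 0 ≤ A) (hAk : A ≤ 6 * k) (hL : 0 ≤ L)
    (hLn : L ≤ 6 * n - 18 * k + 30 * i) (hx : x = (r - 5)⁻¹) :
    A ^ 2 * x ≤ 36 * k ^ 2 / (3 * n - 6 * k) + 10 ∧
    L * A ^ 2 * x ^ 2 ≤ (6 * n - 18 * k) * (36 * k ^ 2) / (3 * n - 6 * k) ^ 2 + 120 + 120 * i ∧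
    L ^ 2 * A ^ 2 * x ^ 3 ≤
      (6 * n - 18 * k) ^ 2 * (36 * k ^ 2) / (3 * n - 6 * k) ^ 3 + 1120 + 6720 * i ∧
    r * x ≤ 2 := by
  set ρ := 3 * n - 6 * k with hρ
  set l := 6 * n - 18 * k with hl
  have hρn : 3 / 2 * n ≤ ρ := by linarith
  have hρ0 : 0 < ρ := by linarith
  have hr5 : 0 < r - 5 := by linarith
  have hx0 : 0 < x := hx ▸ inv_pos.2 hr5
  set y := ρ⁻¹ with hy
  have hy0 : 0 < y := inv_pos.2 hρ0
  have hρy : ρ * y = 1 := mul_inv_cancel₀ hρ0.ne'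
  have hy1 : y ≤ 1 / 10 := by nlinarith
  have hny : n * y ≤ 2 / 3 := by nlinarith
  have hky : k * y ≤ 1 / 6 := by nlinarith
  have hky0 : 0 ≤ k * y := by positivity
  have hl0 : 0 ≤ l := by linarith
  have hly : l * y ≤ 4 := by nlinarith
  have hly0 : 0 ≤ l * y := by positivity
  have hxy : x ≤ y + 10 * y ^ 2 := by
    rw [hx]
    refine inv_le_of_inv_le₀ (by positivity) ?_
    rw [inv_le_iff_one_le_mul₀ (by positivity)]
    nlinarith
  have hx2 : x ^ 2 ≤ y ^ 2 + 30 * y ^ 3 := by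
    refine (pow_le_pow_left₀ hx0.le hxy 2).trans ?_
    nlinarith [pow_pos hy0 3]
  have hx3 : x ^ 3 ≤ y ^ 3 + 70 * y ^ 4 := by
    refine (pow_le_pow_left₀ hx0.le hxy 3).trans ?_
    nlinarith [pow_pos hy0 4, mul_nonneg (pow_pos hy0 4).le hy0.le,
      mul_le_mul_of_nonneg_left hy1 (pow_pos hy0 4).le,
      mul_le_mul_of_nonneg_left hy1 (pow_pos hy0 5).le]
  have hx2y : x ≤ 2 * y := by nlinarith
  have hx4 : x ^ 2 ≤ 4 * y ^ 2 := by
    refine (pow_le_pow_left₀ hx0.le hx2y 2).trans (le_of_eq (by ring))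
  have hx8 : x ^ 3 ≤ 8 * y ^ 3 := by
    refine (pow_le_pow_left₀ hx0.le hx2y 3).trans (le_of_eq (by ring))
  have hA2 : A ^ 2 ≤ 36 * k ^ 2 := (pow_le_pow_left₀ hA hAk 2).trans (le_of_eq (by ring))
  have hky2 : (k * y) ^ 2 ≤ 1 / 36 := by nlinarith
  have hL2 : L ^ 2 ≤ l ^ 2 + 1260 * n * i := by
    refine (pow_le_pow_left₀ hL hLn 2).trans ?_
    nlinarith [mul_nonneg hi hk, mul_nonneg hi (show 0 ≤ n - i by linarith)]
  refine ⟨?_, ?_, ?_, ?_⟩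
  · calc A ^ 2 * x ≤ 36 * k ^ 2 * (y + 10 * y ^ 2) := mul_le_mul hA2 hxy hx0.le (by positivity)
      _ = 36 * k ^ 2 * y + 360 * (k * y) ^ 2 := by ring
      _ ≤ 36 * k ^ 2 / ρ + 10 := by rw [div_eq_mul_inv]; linarith
  · calc L * A ^ 2 * x ^ 2 ≤ (l + 30 * i) * (36 * k ^ 2) * x ^ 2 :=
          mul_le_mul_of_nonneg_right (mul_le_mul hLn hA2 (by positivity) (by positivity))
            (by positivity)
      _ = l * (36 * k ^ 2) * x ^ 2 + 30 * i * (36 * k ^ 2) * x ^ 2 := by ring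
      _ ≤ l * (36 * k ^ 2) * (y ^ 2 + 30 * y ^ 3) + 30 * i * (36 * k ^ 2) * (4 * y ^ 2) :=
          add_le_add (mul_le_mul_of_nonneg_left hx2 (by positivity))
            (mul_le_mul_of_nonneg_left hx4 (by positivity))
      _ = l * (36 * k ^ 2) * y ^ 2 + 1080 * ((l * y) * (k * y) ^ 2) +
          4320 * (i * (k * y) ^ 2) := by ring
      _ ≤ l * (36 * k ^ 2) * y ^ 2 + 1080 * (4 * (1 / 36)) + 4320 * (i * (1 / 36)) := by
          have h1 := mul_le_mul hly hky2 (by positivity) (by norm_num)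
          have h2 := mul_le_mul_of_nonneg_left hky2 hi
          linarith
      _ = l * (36 * k ^ 2) / ρ ^ 2 + 120 + 120 * i := by
          rw [div_eq_mul_inv _ (ρ ^ 2), ← inv_pow]; ring
  · calc L ^ 2 * A ^ 2 * x ^ 3 ≤ (l ^ 2 + 1260 * n * i) * (36 * k ^ 2) * x ^ 3 :=
          mul_le_mul_of_nonneg_right (mul_le_mul hL2 hA2 (by positivity) (by positivity))
            (by positivity)
      _ = l ^ 2 * (36 * k ^ 2) * x ^ 3 + 1260 * n * i * (36 * k ^ 2) * x ^ 3 := by ring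
      _ ≤ l ^ 2 * (36 * k ^ 2) * (y ^ 3 + 70 * y ^ 4) +
          1260 * n * i * (36 * k ^ 2) * (8 * y ^ 3) :=
          add_le_add (mul_le_mul_of_nonneg_left hx3 (by positivity))
            (mul_le_mul_of_nonneg_left hx8 (by positivity))
      _ = l ^ 2 * (36 * k ^ 2) * y ^ 3 + 2520 * ((l * y) ^ 2 * (k * y) ^ 2) +
          362880 * (i * ((n * y) * (k * y) ^ 2)) := by ring
      _ ≤ l ^ 2 * (36 * k ^ 2) * y ^ 3 + 2520 * (4 ^ 2 * (1 / 36)) +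
          362880 * (i * (2 / 3 * (1 / 36))) := by
          have h1 := mul_le_mul (pow_le_pow_left₀ hly0 hly 2) hky2 (by positivity) (by norm_num)
          have h2 := mul_le_mul_of_nonneg_left
            (mul_le_mul hny hky2 (by positivity) (by norm_num)) hi
          linarith
      _ = l ^ 2 * (36 * k ^ 2) / ρ ^ 3 + 1120 + 6720 * i := by
          rw [div_eq_mul_inv _ (ρ ^ 3), ← inv_pow]; ring
  · rw [hx, ← div_eq_mul_inv, div_le_iff₀ hr5]
    linarith

/-- The leading term of the expected gain of a set of size `k`: there are `3 n - 6 k` free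
half-edges, `6 k` of them at leaves, and `6 n - 18 k` ordered pairs of free half-edges at the same
vertex, if all stars are regular. -/
def leadingTerm (n k : ℝ) : ℝ :=
  5 / 72 * (36 * k ^ 2 / (3 * n - 6 * k)) +
    Real.sin optimalAngle / 36 * ((6 * n - 18 * k) * (36 * k ^ 2) / (3 * n - 6 * k) ^ 2) +
    1 / 486 * ((6 * n - 18 * k) ^ 2 * (36 * k ^ 2) / (3 * n - 6 * k) ^ 3)

/-- The expected gain within a star class. In expectation the numbers of paths in `mainTerm` are
those for independent uniform mates, and the number of short cycles is bounded. -/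
theorem sum_starClass_le {Δ₀ : Configuration n 3} {V₀ : Finset (Fin n)} (hS : IsSeparated Δ₀ V₀)
    (hn : 20 ≤ n) (hk : 4 * #V₀ ≤ n) :
    ∑ Δ ∈ starClass Δ₀ V₀, (mainTerm Δ V₀ + 200 * numDefects Δ V₀) ≤
      ∑ Δ ∈ starClass Δ₀ V₀, (leadingTerm n #V₀ + 200000 + 300 * #(irregular Δ V₀)) := by
  have hn' : (20 : ℝ) ≤ n := by exact_mod_cast hn
  have hk' : 4 * (#V₀ : ℝ) ≤ n := by exact_mod_cast hk
  have hk0 : (0 : ℝ) ≤ #V₀ := Nat.cast_nonneg _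
  have hi0 : (0 : ℝ) ≤ #(irregular Δ₀ V₀) := Nat.cast_nonneg _
  have hik : (#(irregular Δ₀ V₀) : ℝ) ≤ #V₀ := by
    exact_mod_cast card_le_card fun v hv => (mem_irregular.1 hv).1
  have hb0 : (0 : ℝ) ≤ #{x : HalfEdge n 3 | x.1 ∈ V₀ ∧ Δ₀.target x ∈ V₀} := Nat.cast_nonneg _
  have hb : (#{x : HalfEdge n 3 | x.1 ∈ V₀ ∧ Δ₀.target x ∈ V₀} : ℝ) ≤
      3 * #(irregular Δ₀ V₀) := by exact_mod_cast card_mem_target_mem_le hS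
  have hcr := card_freeSet Δ₀ V₀
  have hAk := sum_leafSum_freeSet_le Δ₀ V₀
  have hA' := le_sum_leafSum_freeSet hS
  have hLeq := sum_sibling_eq Δ₀ V₀
  have hA0 : 0 ≤ ∑ x ∈ freeSet Δ₀ V₀, leafSum Δ₀ V₀ (1 : Fin n → ℝ) x.1 :=
    sum_nonneg fun x _ => leafSum_one_nonneg Δ₀ V₀ x.1
  have hL0 : 0 ≤ ∑ x ∈ freeSet Δ₀ V₀, ∑ z ∈ freeSet Δ₀ V₀, sibling x z :=
    sum_nonneg fun _ _ => sum_nonneg fun _ _ => sibling_nonneg _ _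
  have hr5 : 5 ≤ #(freeSet Δ₀ V₀) := by
    have : (5 : ℝ) ≤ #(freeSet Δ₀ V₀) := by rw [hcr]; linarith
    exact_mod_cast this
  have e1 := sum_leafSum_mul_remoteWeight_le hr5
  have e2 := sum_sibling_mul_leafSum_mul_leafSum_le hr5
  have e3 := sum_sibling_mul_sibling_mul_leafSum_le hr5
  have e4 := sum_numClosesOne_le hr5
  have e5 := sum_sibling_mul_sameHub_le hr5
  have e6 := sum_numClosesThree_le hr5
  have hr30 : (30 : ℝ) ≤ #(freeSet Δ₀ V₀) := by rw [hcr]; linarith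
  set F : ℝ := ((#(starClass Δ₀ V₀) : ℕ) : ℝ) with hF
  have hF0 : 0 ≤ F := Nat.cast_nonneg _
  set r : ℝ := ((#(freeSet Δ₀ V₀) : ℕ) : ℝ) with hr
  set A := ∑ x ∈ freeSet Δ₀ V₀, leafSum Δ₀ V₀ (1 : Fin n → ℝ) x.1 with hA
  set L := ∑ x ∈ freeSet Δ₀ V₀, ∑ z ∈ freeSet Δ₀ V₀, sibling x z with hL
  set i : ℝ := ((#(irregular Δ₀ V₀) : ℕ) : ℝ) with hi
  obtain ⟨m1, m2, m3, m4⟩ := moment_bounds (x := (r - 5)⁻¹) hn' hk0 hk' hi0 hik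
    (by rw [hcr]; linarith) hA0 hAk hL0 (by rw [hLeq, hcr]; linarith) rfl
  set x := (r - 5)⁻¹ with hx
  have hx0 : 0 < x := inv_pos.2 (by linarith)
  have hrx0 : 0 ≤ r * x := by positivity
  have hxr : (r - 5) * x = 1 := mul_inv_cancel₀ (by linarith)
  -- division by `r - 1`, `r - 3`, `r - 5`
  have d1 : ∀ S B, 0 ≤ S → (r - 1) * S ≤ F * B → S ≤ F * (B * x) := by
    intro S B hS0 h
    have h1 : (r - 5) * S ≤ (r - 1) * S := mul_le_mul_of_nonneg_right (by linarith) hS0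
    calc S = ((r - 5) * S) * x := by linear_combination -S * hxr
      _ ≤ F * B * x := mul_le_mul_of_nonneg_right (h1.trans h) hx0.le
      _ = F * (B * x) := by ring
  have d2 : ∀ S B, 0 ≤ S → (r - 1) * (r - 3) * S ≤ F * B → S ≤ F * (B * x ^ 2) := by
    intro S B hS0 h
    have h1 : (r - 3) * S ≤ F * (B * x) :=
      d1 _ _ (mul_nonneg (by linarith) hS0) (by rw [← mul_assoc]; exact h)
    have h2 : (r - 5) * S ≤ (r - 3) * S := mul_le_mul_of_nonneg_right (by linarith) hS0
    calc S = ((r - 5) * S) * x := by linear_combination -S * hxr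
      _ ≤ F * (B * x) * x := mul_le_mul_of_nonneg_right (h2.trans h1) hx0.le
      _ = F * (B * x ^ 2) := by ring
  have d3 : ∀ S B, 0 ≤ S → (r - 1) * ((r - 3) * (r - 5)) * S ≤ F * B → S ≤ F * (B * x ^ 3) := by
    intro S B hS0 h
    have h1 : (r - 5) * S ≤ F * (B * x ^ 2) :=
      d2 _ _ (mul_nonneg (by linarith) hS0) (le_trans (le_of_eq (by ring)) h)
    calc S = ((r - 5) * S) * x := by linear_combination -S * hxr
      _ ≤ F * (B * x ^ 2) * x := mul_le_mul_of_nonneg_right h1 hx0.le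
      _ = F * (B * x ^ 3) := by ring
  have hl0 := leafSum_one_nonneg Δ₀ V₀
  have f1 := d1 _ _ (sum_nonneg fun Δ _ => sum_nonneg fun z _ =>
    mul_nonneg (leafSum_one_nonneg _ _ _) (remoteWeight_one_nonneg _ _ _)) e1
  have f2 := d2 _ _ (sum_nonneg fun Δ _ => sum_nonneg fun _ _ => sum_nonneg fun _ _ =>
    mul_nonneg (mul_nonneg (sibling_nonneg _ _) (hl0 _)) (hl0 _)) e2
  have f3 := d3 _ _ (sum_nonneg fun Δ _ => sum_nonneg fun _ _ => sum_nonneg fun _ _ =>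
    sum_nonneg fun _ _ => mul_nonneg (mul_nonneg (mul_nonneg (sibling_nonneg _ _)
      (sibling_nonneg _ _)) (hl0 _)) (hl0 _)) e3
  have f4 := d1 _ _ (sum_nonneg fun Δ _ => Nat.cast_nonneg _) e4
  have f5 := d2 _ _ (sum_nonneg fun Δ _ => sum_nonneg fun _ _ => sum_nonneg fun _ _ =>
    mul_nonneg (sibling_nonneg _ _) (sameHub_nonneg _ _ _ _)) e5
  have f6 := d3 _ _ (sum_nonneg fun Δ _ => Nat.cast_nonneg _) e6
  have g1 := f1.trans (mul_le_mul_of_nonneg_left m1 hF0)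
  have g2 := f2.trans (mul_le_mul_of_nonneg_left m2 hF0)
  have g3 := f3.trans (mul_le_mul_of_nonneg_left m3 hF0)
  have g4 : ∑ Δ ∈ starClass Δ₀ V₀, (numClosesOne Δ V₀ : ℝ) ≤ F * 24 :=
    f4.trans (mul_le_mul_of_nonneg_left (by linarith) hF0)
  have g5 := f5.trans (mul_le_mul_of_nonneg_left (show 24 * r ^ 2 * x ^ 2 ≤ 96 by
    have := pow_le_pow_left₀ hrx0 m4 2
    rw [mul_assoc, ← mul_pow]; linarith) hF0)
  have g6 := f6.trans (mul_le_mul_of_nonneg_left (show 48 * r ^ 3 * x ^ 3 ≤ 384 by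
    have := pow_le_pow_left₀ hrx0 m4 3
    rw [mul_assoc, ← mul_pow]; linarith) hF0)
  have g7 := sum_le_sum fun Δ (hΔ : Δ ∈ starClass Δ₀ V₀) => sum_remoteWeight_mul_remoteSum_le hΔ
  have g8 := sum_le_sum fun Δ (hΔ : Δ ∈ starClass Δ₀ V₀) => sum_remoteSum_mul_remoteSum_le hΔ
  have g9 := sum_le_sum fun Δ (hΔ : Δ ∈ starClass Δ₀ V₀) => numClosesTwo_le hΔ
  simp only [Finset.sum_add_distrib, ← Finset.mul_sum] at g7 g8 g9
  have hirr : ∑ Δ ∈ starClass Δ₀ V₀, (#(irregular Δ V₀) : ℝ) = F * i := by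
    rw [hF, ← nsmul_eq_mul, ← sum_const]
    exact sum_congr rfl fun Δ hΔ => by rw [irregular_of_mem_starClass hΔ]
  unfold mainTerm numDefects leadingTerm
  push_cast
  simp only [Finset.sum_add_distrib, ← Finset.mul_sum, mul_add, sum_const, nsmul_eq_mul, hirr]
  rw [← hF]
  have hs0 := sin_optimalAngle_nonneg
  have hs1 := sin_optimalAngle_le
  have p2 := g7.trans (add_le_add g2 (mul_le_mul_of_nonneg_left g4 (show (0:ℝ) ≤ 9 by norm_num)))
  have q2 := mul_le_mul_of_nonneg_left p2 (show 0 ≤ Real.sin optimalAngle / 36 by positivity)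
  have hFi : 0 ≤ F * i := by positivity
  have hs1' : Real.sin optimalAngle ≤ 1 := hs1.trans (by norm_num)
  have hsF : Real.sin optimalAngle * F ≤ F := mul_le_of_le_one_left hF0 hs1'
  have hsFi : Real.sin optimalAngle * (F * i) ≤ F * i := mul_le_of_le_one_left hFi hs1'
  linarith only [q2, g1, g3, g4, g5, g6, g8, g9, hsF, hsFi, hF0, hFi]

/-! ### Irregular stars -/

/-- The vertices outside all the stars. -/
def freeVertices (Δ : Configuration n d) (V₀ : Finset (Fin n)) : Finset (Fin n) :=
  {c | c ∉ V₀ ∧ ∀ j, Δ.target (c, j) ∉ V₀}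

theorem mem_freeVertices {Δ : Configuration n d} {V₀ : Finset (Fin n)} {c : Fin n} :
    c ∈ freeVertices Δ V₀ ↔ c ∉ V₀ ∧ ∀ j, Δ.target (c, j) ∉ V₀ := by simp [freeVertices]

/-- The half-edges at `V₀` that lead back to `V₀`; they belong to loops. -/
def loops (Δ : Configuration n d) (V₀ : Finset (Fin n)) : Finset (HalfEdge n d) :=
  {x | x.1 ∈ V₀ ∧ Δ.target x ∈ V₀}

/-- Pairs of half-edges at a vertex of `V₀` that lead to the same vertex outside `V₀`. -/
def doubleEdges (Δ : Configuration n d) (V₀ : Finset (Fin n)) : Finset (HalfEdge n d × Fin d) :=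
  {p | p.1.1 ∈ V₀ ∧ p.2 ≠ p.1.2 ∧ Δ.target (p.1.1, p.2) = Δ.target p.1 ∧ Δ.target p.1 ∉ V₀}

/-- A star is irregular because of a loop or of a double edge. -/
theorem card_irregular_le (Δ : Configuration n d) (V₀ : Finset (Fin n)) :
    #(irregular Δ V₀) ≤ #(loops Δ V₀) + #(doubleEdges Δ V₀) := by
  classical
  have hsub : irregular Δ V₀ ⊆
      (loops Δ V₀).image Prod.fst ∪ (doubleEdges Δ V₀).image fun p => p.1.1 := by
    intro v hv
    obtain ⟨hv, hr⟩ := mem_irregular.1 hv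
    by_contra hcon
    simp only [mem_union, mem_image, not_or] at hcon
    obtain ⟨h1, h2⟩ := hcon
    refine hr ⟨fun i j hij => ?_, fun i hi => h1 ⟨(v, i), ?_, rfl⟩⟩
    · by_contra hne
      by_cases ht : Δ.target (v, j) ∈ V₀
      · exact h1 ⟨(v, j), by simp [loops, hv, ht], rfl⟩
      · exact h2 ⟨((v, j), i), by simpa [doubleEdges, hv, ht, hne] using hij, rfl⟩
    · simp [loops, hi, hv]
  exact (card_le_card hsub).trans ((card_union_le _ _).trans
    (add_le_add card_image_le card_image_le))

/-- The stars cover at most four vertices each, and an irregular star covers at most three. -/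
theorem le_card_freeVertices (Δ : Configuration n 3) (V₀ : Finset (Fin n)) :
    n + #(irregular Δ V₀) ≤ #(freeVertices Δ V₀) + 4 * #V₀ := by
  classical
  set E : Fin n → Finset (Fin n) := fun v =>
    ((univ : Finset (Fin 3)).image fun j => Δ.target (v, j)).erase v with hE
  have hcard : ∀ v ∈ V₀, #(E v) + (if v ∈ irregular Δ V₀ then 1 else 0) ≤ 3 := by
    intro v hv
    have h3 : #((univ : Finset (Fin 3)).image fun j => Δ.target (v, j)) ≤ 3 := card_image_le
    by_cases hi : v ∈ irregular Δ V₀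
    · rw [if_pos hi]
      have hr := (mem_irregular.1 hi).2
      by_cases hloop : ∃ i, Δ.target (v, i) = v
      · obtain ⟨i, hi⟩ := hloop
        have hm : v ∈ (univ : Finset (Fin 3)).image fun j => Δ.target (v, j) :=
          mem_image.2 ⟨i, mem_univ _, hi⟩
        have := card_erase_add_one hm
        exact this.le.trans h3
      · push Not at hloop
        have hinj : ¬ Function.Injective fun j => Δ.target (v, j) := fun h => hr ⟨h, hloop⟩
        have hlt : #((univ : Finset (Fin 3)).image fun j => Δ.target (v, j)) < 3 := by
          refine lt_of_le_of_ne h3 fun h => hinj ?_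
          have := (Finset.card_image_iff (s := univ) (f := fun j => Δ.target (v, j))).1
            (h.trans (by simp))
          exact fun a b hab => this (mem_coe.2 (mem_univ a)) (mem_coe.2 (mem_univ b)) hab
        have := card_erase_le (a := v) (s := (univ : Finset (Fin 3)).image fun j => Δ.target (v, j))
        exact (Nat.add_le_add_right this 1).trans hlt
    · rw [if_neg hi, add_zero]
      exact card_erase_le.trans h3
  have hcover : (univ : Finset (Fin n)) ⊆ freeVertices Δ V₀ ∪ (V₀ ∪ V₀.biUnion E) := by
    intro w _
    by_contra hcon
    simp only [mem_union, not_or, mem_biUnion, not_exists, not_and] at hcon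
    obtain ⟨h1, h2, h3⟩ := hcon
    refine h1 (mem_freeVertices.2 ⟨h2, fun j hj => h3 _ hj (mem_erase.2 ⟨?_, ?_⟩)⟩)
    · exact fun h => h2 (h ▸ hj)
    · exact mem_image.2 ⟨(Δ.1 (w, j)).2, mem_univ _, Δ.target_apply (w, j)⟩
  have h1 := (card_le_card hcover).trans ((card_union_le _ _).trans
    (add_le_add le_rfl ((card_union_le _ _).trans (add_le_add le_rfl card_biUnion_le))))
  rw [card_univ, Fintype.card_fin] at h1
  have h2 := sum_le_sum hcard
  rw [Finset.sum_add_distrib, Finset.sum_ite_mem, sum_const, sum_const, smul_eq_mul,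
    smul_eq_mul, mul_one, inter_eq_right.2 fun v hv => (mem_irregular.1 hv).1] at h2
  omega

/-- Moving some edges of one star to free vertices preserves the separation. -/
theorem isSeparated_of_target {Δ Δ' : Configuration n d} {V₀ : Finset (Fin n)}
    (hS : IsSeparated Δ V₀) (v : Fin n)
    (h : ∀ z : HalfEdge n d, z.1 ∈ V₀ → Δ'.target z = Δ.target z ∨
      (z.1 = v ∧ Δ'.target z ∈ freeVertices Δ V₀)) : IsSeparated Δ' V₀ := by
  have hfree : ∀ z : HalfEdge n d, z.1 ∈ V₀ → Δ.target z ∉ freeVertices Δ V₀ := by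
    intro z hz hf
    refine (mem_freeVertices.1 hf).2 (Δ.1 z).2 ?_
    change Δ.target (Δ.1 z) ∈ V₀
    rwa [Δ.target_apply]
  constructor
  · intro x hx ht
    rcases h x hx with h' | h'
    · rw [h'] at ht ⊢
      exact hS.1 x hx ht
    · exact absurd ht (mem_freeVertices.1 h'.2).1
  · intro x y hx hy hxy
    rcases h x hx with h1 | h1 <;> rcases h y hy with h2 | h2
    · exact hS.2 x y hx hy (by rw [← h1, ← h2, hxy])
    · exact absurd (by rw [← h1, hxy]; exact h2.2) (hfree x hx)
    · exact absurd (by rw [← h2, ← hxy]; exact h1.2) (hfree y hy)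
    · rw [h1.1, h2.1]

/-- The half-edges at the free vertices. -/
def freeVertexEdges (Δ : Configuration n 3) (V₀ : Finset (Fin n)) : Finset (HalfEdge n 3) :=
  freeVertices Δ V₀ ×ˢ univ

theorem card_freeVertexEdges (Δ : Configuration n 3) (V₀ : Finset (Fin n)) :
    #(freeVertexEdges Δ V₀) = 3 * #(freeVertices Δ V₀) := by
  rw [freeVertexEdges, card_product, card_univ, Fintype.card_fin, mul_comm]

theorem mem_freeVertexEdges {Δ : Configuration n 3} {V₀ : Finset (Fin n)} {c : HalfEdge n 3} :
    c ∈ freeVertexEdges Δ V₀ ↔ c.1 ∈ freeVertices Δ V₀ := by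
  simp [freeVertexEdges]

theorem notMem_of_freeVertexEdges {Δ : Configuration n 3} {V₀ : Finset (Fin n)} {c : HalfEdge n 3}
    (hc : c ∈ freeVertexEdges Δ V₀) : c.1 ∉ V₀ ∧ (Δ.1 c).1 ∉ V₀ := by
  have := mem_freeVertices.1 (mem_freeVertexEdges.1 hc)
  exact ⟨this.1, this.2 c.2⟩

theorem conjSwap_apply (Δ : Configuration n d) {y z x : HalfEdge n d} (h1 : x ≠ y) (h2 : x ≠ z) :
    (Δ.conjSwap y z).1 x = Equiv.swap y z (Δ.1 x) := by
  change Equiv.swap y z (Δ.1 (Equiv.swap y z x)) = _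
  rw [Equiv.swap_apply_of_ne_of_ne h1 h2]

/-- A switching moves one edge of a double edge at `V₀` to a free vertex. Few configurations and
half-edges lead to the same result, so double edges are rare. -/
theorem sum_doubleEdges_mul_le (V₀ : Finset (Fin n)) (A : Finset (Configuration n 3))
    (hA : ∀ Δ, Δ ∈ A ↔ IsSeparated Δ V₀) :
    ∑ Δ ∈ A, #(doubleEdges Δ V₀) * (3 * #(freeVertices Δ V₀)) ≤ #A * (27 * #V₀) := by
  classical
  set S : Finset (Σ _ : Configuration n 3, (HalfEdge n 3 × Fin 3) × HalfEdge n 3) :=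
    A.sigma fun Δ => doubleEdges Δ V₀ ×ˢ freeVertexEdges Δ V₀ with hSdef
  set T : Finset (Configuration n 3 × ((Fin n × Fin 3) × Fin 3 × Fin 3)) :=
    A ×ˢ ((V₀ ×ˢ univ) ×ˢ univ ×ˢ univ) with hT
  have hcS : #S = ∑ Δ ∈ A, #(doubleEdges Δ V₀) * (3 * #(freeVertices Δ V₀)) := by
    rw [hSdef, card_sigma]
    exact sum_congr rfl fun Δ _ => by rw [card_product, card_freeVertexEdges]
  have hcT : #T = #A * (27 * #V₀) := by
    rw [hT]
    simp only [card_product, card_univ, Fintype.card_fin]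
    ring
  have hV : ∀ {u w : HalfEdge n 3}, u.1 ∈ V₀ → w.1 ∉ V₀ → u ≠ w := fun hu hw h => hw (h ▸ hu)
  rw [← hcS, ← hcT]
  let f : (Σ _ : Configuration n 3, (HalfEdge n 3 × Fin 3) × HalfEdge n 3) →
      Configuration n 3 × ((Fin n × Fin 3) × Fin 3 × Fin 3) := fun s =>
    (s.1.conjSwap (s.1.1 s.2.1.1) s.2.2, (s.2.1.1, s.2.1.2, (s.1.1 s.2.1.1).2))
  let g : Configuration n 3 × ((Fin n × Fin 3) × Fin 3 × Fin 3) →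
      (Σ _ : Configuration n 3, (HalfEdge n 3 × Fin 3) × HalfEdge n 3) := fun t =>
    ⟨t.1.conjSwap ((t.1.1 (t.2.1.1, t.2.2.1)).1, t.2.2.2) (t.1.1 t.2.1),
      (t.2.1, t.2.2.1), t.1.1 t.2.1⟩
  refine card_le_card_of_injOn f ?_ (Set.LeftInvOn.injOn (f₁' := g) ?_)
  · rintro ⟨Δ, ⟨y, i⟩, c⟩ hs
    obtain ⟨hΔ, hp⟩ := mem_sigma.1 hs
    obtain ⟨hp, hc⟩ := mem_product.1 hp
    obtain ⟨h1, h2, h3, h4⟩ := (mem_filter.1 hp).2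
    simp only at h1 h2 h3 h4 hc hΔ
    obtain ⟨hc1, hc2⟩ := notMem_of_freeVertexEdges hc
    refine mem_product.2 ⟨(hA _).2 (isSeparated_of_target ((hA _).1 hΔ) y.1 fun z hz => ?_),
      mem_product.2 ⟨mem_product.2 ⟨h1, mem_univ _⟩, mem_univ _⟩⟩
    have hzb : z ≠ Δ.1 y := hV hz h4
    have hzc : z ≠ c := hV hz hc1
    unfold Configuration.target
    rw [conjSwap_apply Δ hzb hzc]
    by_cases hzy : z = y
    · right
      rw [hzy, Equiv.swap_apply_left]
      exact ⟨rfl, mem_freeVertexEdges.1 hc⟩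
    · left
      rw [Equiv.swap_apply_of_ne_of_ne]
      · exact fun h => hzy (Δ.2.1.injective h)
      · intro h
        exact hc2 (by rw [← h, Δ.2.1]; exact hz)
  · rintro ⟨Δ, ⟨y, i⟩, c⟩ hs
    obtain ⟨hΔ, hp⟩ := mem_sigma.1 hs
    obtain ⟨hp, hc⟩ := mem_product.1 hp
    obtain ⟨h1, h2, h3, h4⟩ := (mem_filter.1 hp).2
    simp only at h1 h2 h3 h4 hc hΔ
    obtain ⟨hc1, hc2⟩ := notMem_of_freeVertexEdges hc
    have hy : (Δ.conjSwap (Δ.1 y) c).1 y = c := by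
      rw [conjSwap_apply Δ (hV h1 h4) (hV h1 hc1), Equiv.swap_apply_left]
    have hi : ((Δ.conjSwap (Δ.1 y) c).1 (y.1, i)).1 = (Δ.1 y).1 := by
      rw [conjSwap_apply Δ (x := (y.1, i)) (hV (u := (y.1, i)) h1 h4)
        (hV (u := (y.1, i)) h1 hc1), Equiv.swap_apply_of_ne_of_ne]
      · exact h3
      · intro h
        exact h2 (Prod.ext_iff.1 (Δ.2.1.injective h)).2
      · intro h
        exact hc2 (by rw [← h, Δ.2.1]; exact h1)
    simp only [f, g, hy, hi, Prod.mk.eta, conjSwap_conjSwap]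

/-- A switching moves the two ends of a loop at `V₀` to free vertices. -/
theorem sum_loops_mul_le (V₀ : Finset (Fin n)) (A : Finset (Configuration n 3))
    (hA : ∀ Δ, Δ ∈ A ↔ IsSeparated Δ V₀) :
    ∑ Δ ∈ A, #(loops Δ V₀) * (3 * #(freeVertices Δ V₀) * (3 * #(freeVertices Δ V₀) - 2)) ≤
      #A * (27 * #V₀ * n) := by
  classical
  set S : Finset (Σ _ : Configuration n 3, HalfEdge n 3 × (Σ _ : HalfEdge n 3, HalfEdge n 3)) :=
    A.sigma fun Δ => loops Δ V₀ ×ˢ (freeVertexEdges Δ V₀).sigma fun a =>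
      freeVertexEdges Δ V₀ \ {a, Δ.1 a} with hSdef
  set T : Finset (Configuration n 3 × ((Fin n × Fin 3) × Fin 3 × HalfEdge n 3)) :=
    A ×ˢ ((V₀ ×ˢ univ) ×ˢ univ ×ˢ univ) with hT
  have hcS : ∑ Δ ∈ A, #(loops Δ V₀) *
      (3 * #(freeVertices Δ V₀) * (3 * #(freeVertices Δ V₀) - 2)) ≤ #S := by
    rw [hSdef, card_sigma]
    refine sum_le_sum fun Δ _ => ?_
    rw [card_product, card_sigma, ← card_freeVertexEdges, ← smul_eq_mul #(freeVertexEdges Δ V₀),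
      ← sum_const]
    refine Nat.mul_le_mul_left _ (sum_le_sum fun a _ => ?_)
    have h1 := le_card_sdiff {a, Δ.1 a} (freeVertexEdges Δ V₀)
    have h2 := card_le_two (a := a) (b := Δ.1 a)
    omega
  have hcT : #T = #A * (27 * #V₀ * n) := by
    rw [hT]
    simp only [card_product, card_univ, Fintype.card_fin, Fintype.card_prod]
    ring
  have hV : ∀ {u w : HalfEdge n 3}, u.1 ∈ V₀ → w.1 ∉ V₀ → u ≠ w := fun hu hw h => hw (h ▸ hu)
  rw [← hcT]
  refine hcS.trans ?_
  let f : (Σ _ : Configuration n 3, HalfEdge n 3 × (Σ _ : HalfEdge n 3, HalfEdge n 3)) →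
      Configuration n 3 × ((Fin n × Fin 3) × Fin 3 × HalfEdge n 3) := fun s =>
    ((s.1.conjSwap (s.1.1 s.2.1) s.2.2.1).conjSwap (s.1.1 s.2.2.1) s.2.2.2,
      (s.2.1, (s.1.1 s.2.1).2, s.1.1 s.2.2.1))
  let g : Configuration n 3 × ((Fin n × Fin 3) × Fin 3 × HalfEdge n 3) →
      (Σ _ : Configuration n 3, HalfEdge n 3 × (Σ _ : HalfEdge n 3, HalfEdge n 3)) := fun t =>
    ⟨(t.1.conjSwap t.2.2.2 (t.1.1 (t.2.1.1, t.2.2.1))).conjSwap (t.2.1.1, t.2.2.1) (t.1.1 t.2.1),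
      t.2.1, ⟨t.1.1 t.2.1, t.1.1 (t.2.1.1, t.2.2.1)⟩⟩
  -- the new configuration at the half-edges of `V₀`
  have key : ∀ Δ x a c, Δ ∈ A → x ∈ loops Δ V₀ → a ∈ freeVertexEdges Δ V₀ →
      c ∈ freeVertexEdges Δ V₀ \ {a, Δ.1 a} → ∀ z : HalfEdge n 3, z.1 ∈ V₀ →
      ((Δ.conjSwap (Δ.1 x) a).conjSwap (Δ.1 a) c).1 z =
        if z = x then a else if z = Δ.1 x then c else Δ.1 z := by
    intro Δ x a c hΔ hx ha hc z hz
    obtain ⟨hc, hc'⟩ := mem_sdiff.1 hc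
    simp only [mem_insert, mem_singleton, not_or] at hc'
    obtain ⟨ha1, ha2⟩ := notMem_of_freeVertexEdges ha
    obtain ⟨hc1, hc2⟩ := notMem_of_freeVertexEdges hc
    have hx2 := (mem_filter.1 hx).2
    have hy : (Δ.1 x).1 ∈ V₀ := hx2.2
    rw [conjSwap_apply _ (hV hz ha2) (hV hz hc1)]
    by_cases hzx : z = x
    · rw [if_pos hzx, hzx, conjSwap_apply _ (Δ.2.2 x).symm (hV hx2.1 ha1), Equiv.swap_apply_left,
        Equiv.swap_apply_of_ne_of_ne (Δ.2.2 a).symm (Ne.symm hc'.1)]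
    · rw [if_neg hzx]
      by_cases hzy : z = Δ.1 x
      · rw [if_pos hzy, hzy]
        have : (Δ.conjSwap (Δ.1 x) a).1 (Δ.1 x) = Δ.1 a := by
          change Equiv.swap (Δ.1 x) a (Δ.1 (Equiv.swap (Δ.1 x) a (Δ.1 x))) = _
          rw [Equiv.swap_apply_left, Equiv.swap_apply_of_ne_of_ne (hV hy ha2).symm (Δ.2.2 a)]
        rw [this, Equiv.swap_apply_left]
      · rw [if_neg hzy, conjSwap_apply _ hzy (hV hz ha1)]
        have e1 : Δ.1 z ≠ Δ.1 x := fun h => hzx (Δ.2.1.injective h)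
        have e2 : Δ.1 z ≠ a := fun h => ha2 (by rw [← h, Δ.2.1]; exact hz)
        have e3 : Δ.1 z ≠ Δ.1 a := fun h => hV hz ha1 (Δ.2.1.injective h)
        have e4 : Δ.1 z ≠ c := fun h => hc2 (by rw [← h, Δ.2.1]; exact hz)
        rw [Equiv.swap_apply_of_ne_of_ne e1 e2, Equiv.swap_apply_of_ne_of_ne e3 e4]
  have hloop : ∀ Δ x, Δ ∈ A → x ∈ loops Δ V₀ → (Δ.1 x).1 = x.1 := fun Δ x hΔ hx =>
    ((hA Δ).1 hΔ).1 x (mem_filter.1 hx).2.1 (mem_filter.1 hx).2.2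
  refine card_le_card_of_injOn f ?_ (Set.LeftInvOn.injOn (f₁' := g) ?_)
  · rintro ⟨Δ, x, ⟨a, c⟩⟩ hs
    obtain ⟨hΔ, hp⟩ := mem_sigma.1 hs
    obtain ⟨hx, hp⟩ := mem_product.1 hp
    obtain ⟨ha, hc⟩ := mem_sigma.1 hp
    simp only at hx ha hc hΔ
    refine mem_product.2 ⟨(hA _).2 (isSeparated_of_target ((hA _).1 hΔ) x.1 fun z hz => ?_),
      mem_product.2 ⟨mem_product.2 ⟨(mem_filter.1 hx).2.1, mem_univ _⟩, mem_univ _⟩⟩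
    unfold Configuration.target
    rw [key Δ x a c hΔ hx ha hc z hz]
    by_cases hzx : z = x
    · rw [if_pos hzx, hzx]
      exact Or.inr ⟨rfl, mem_freeVertexEdges.1 ha⟩
    · rw [if_neg hzx]
      by_cases hzy : z = Δ.1 x
      · rw [if_pos hzy, hzy]
        exact Or.inr ⟨hloop Δ x hΔ hx, mem_freeVertexEdges.1 (mem_sdiff.1 hc).1⟩
      · rw [if_neg hzy]
        exact Or.inl rfl
  · rintro ⟨Δ, x, ⟨a, c⟩⟩ hs
    obtain ⟨hΔ, hp⟩ := mem_sigma.1 hs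
    obtain ⟨hx, hp⟩ := mem_product.1 hp
    obtain ⟨ha, hc⟩ := mem_sigma.1 hp
    simp only at hx ha hc hΔ
    have hxV := (mem_filter.1 hx).2.1
    have e0 : (x.1, (Δ.1 x).2) = Δ.1 x := Prod.ext (hloop Δ x hΔ hx).symm rfl
    have e1 := key Δ x a c hΔ hx ha hc x hxV
    have e2 := key Δ x a c hΔ hx ha hc (Δ.1 x) (mem_filter.1 hx).2.2
    rw [if_pos rfl] at e1
    rw [if_neg (Δ.2.2 x), if_pos rfl] at e2
    simp only [f, g, e0, e1, e2, conjSwap_conjSwap]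

/-- Irregular stars are rare: `t` is a lower bound for the number of free vertices, except that
the last term takes over if there may be fewer of them. -/
theorem sum_irregular_le (V₀ : Finset (Fin n)) (A : Finset (Configuration n 3))
    (hA : ∀ Δ, Δ ∈ A ↔ IsSeparated Δ V₀) (hk : 4 * #V₀ ≤ n) {t : ℝ}
    (ht : 1 ≤ t) :
    ∑ Δ ∈ A, (#(irregular Δ V₀) : ℝ) ≤ #A * (9 * #V₀ / t + 9 * #V₀ * n / t ^ 2 +
      if (n : ℝ) - 4 * #V₀ < t then t else 0) := by
  have ht0 : 0 < t := by linarith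
  have h2 : (∑ Δ ∈ A, (#(doubleEdges Δ V₀) : ℝ) * (3 * #(freeVertices Δ V₀))) ≤
      #A * (27 * #V₀) := by exact_mod_cast sum_doubleEdges_mul_le V₀ A hA
  have h1 : (∑ Δ ∈ A, (#(loops Δ V₀) : ℝ) *
      ((3 * #(freeVertices Δ V₀) * (3 * #(freeVertices Δ V₀) - 2) : ℕ) : ℝ)) ≤
      #A * (27 * #V₀ * n) := by exact_mod_cast sum_loops_mul_le V₀ A hA
  have hpt : ∀ Δ ∈ A, (#(irregular Δ V₀) : ℝ) ≤
      (#(doubleEdges Δ V₀) : ℝ) * (3 * #(freeVertices Δ V₀)) * (1 / (3 * t)) +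
      (#(loops Δ V₀) : ℝ) * ((3 * #(freeVertices Δ V₀) * (3 * #(freeVertices Δ V₀) - 2) : ℕ) : ℝ) *
        (1 / (3 * t ^ 2)) + if (n : ℝ) - 4 * #V₀ < t then t else 0 := by
    intro Δ hΔ
    have hS := (hA Δ).1 hΔ
    have e1 : (#(irregular Δ V₀) : ℝ) ≤ #(loops Δ V₀) + #(doubleEdges Δ V₀) := by
      exact_mod_cast card_irregular_le Δ V₀
    have e4 : (n : ℝ) + #(irregular Δ V₀) ≤ #(freeVertices Δ V₀) + 4 * #V₀ := by
      exact_mod_cast le_card_freeVertices Δ V₀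
    have hi0 : (0 : ℝ) ≤ #(irregular Δ V₀) := Nat.cast_nonneg _
    have hl0 : (0 : ℝ) ≤ #(loops Δ V₀) := Nat.cast_nonneg _
    have hd0 : (0 : ℝ) ≤ #(doubleEdges Δ V₀) := Nat.cast_nonneg _
    have hif : (0 : ℝ) ≤ if (n : ℝ) - 4 * #V₀ < t then t else 0 := by
      split_ifs <;> linarith
    by_cases hF : t ≤ #(freeVertices Δ V₀)
    · have hF1 : 1 ≤ #(freeVertices Δ V₀) := by exact_mod_cast ht.trans hF
      have hc : (3 * t ^ 2 : ℝ) ≤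
          ((3 * #(freeVertices Δ V₀) * (3 * #(freeVertices Δ V₀) - 2) : ℕ) : ℝ) := by
        have hm : 3 * #(freeVertices Δ V₀) * #(freeVertices Δ V₀) ≤
            3 * #(freeVertices Δ V₀) * (3 * #(freeVertices Δ V₀) - 2) :=
          Nat.mul_le_mul_left _ (by omega)
        have hm' : (3 * #(freeVertices Δ V₀) * #(freeVertices Δ V₀) : ℝ) ≤
          ((3 * #(freeVertices Δ V₀) * (3 * #(freeVertices Δ V₀) - 2) : ℕ) : ℝ) := by
          exact_mod_cast hm
        nlinarith
      have g1 : (#(loops Δ V₀) : ℝ) ≤ (#(loops Δ V₀) : ℝ) *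
          ((3 * #(freeVertices Δ V₀) * (3 * #(freeVertices Δ V₀) - 2) : ℕ) : ℝ) *
          (1 / (3 * t ^ 2)) := by
        rw [mul_one_div, le_div_iff₀ (by positivity)]
        exact mul_le_mul_of_nonneg_left hc hl0
      have g2 : (#(doubleEdges Δ V₀) : ℝ) ≤
          (#(doubleEdges Δ V₀) : ℝ) * (3 * #(freeVertices Δ V₀)) * (1 / (3 * t)) := by
        rw [mul_one_div, le_div_iff₀ (by positivity)]
        exact mul_le_mul_of_nonneg_left (by linarith) hd0
      linarith
    · push Not at hF
      have hlt : (n : ℝ) - 4 * #V₀ < t := by linarith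
      have hk' : 4 * (#V₀ : ℝ) ≤ n := by exact_mod_cast hk
      rw [if_pos hlt]
      have g1 : 0 ≤ (#(loops Δ V₀) : ℝ) *
          ((3 * #(freeVertices Δ V₀) * (3 * #(freeVertices Δ V₀) - 2) : ℕ) : ℝ) *
          (1 / (3 * t ^ 2)) := by positivity
      have g2 : 0 ≤ (#(doubleEdges Δ V₀) : ℝ) * (3 * #(freeVertices Δ V₀)) * (1 / (3 * t)) := by
        positivity
      linarith
  refine (sum_le_sum hpt).trans ?_
  rw [Finset.sum_add_distrib, Finset.sum_add_distrib, ← Finset.sum_mul, ← Finset.sum_mul, sum_const,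
    nsmul_eq_mul]
  have g1 := mul_le_mul_of_nonneg_right h1 (show 0 ≤ 1 / (3 * t ^ 2) by positivity)
  have g2 := mul_le_mul_of_nonneg_right h2 (show 0 ≤ 1 / (3 * t) by positivity)
  have q1 : (#A * (27 * #V₀ * n) : ℝ) * (1 / (3 * t ^ 2)) = #A * (9 * #V₀ * n / t ^ 2) := by
    field_simp; ring
  have q2 : (#A * (27 * #V₀) : ℝ) * (1 / (3 * t)) = #A * (9 * #V₀ / t) := by
    field_simp; ring
  rw [q1] at g1
  rw [q2] at g2
  rw [mul_add, mul_add]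
  linarith

/-! ### The conditional expectation -/

theorem alphaStar_le (d : ℕ) : alphaStar d ≤ 1 / ((d : ℝ) + 1) :=
  Real.sSup_le (fun _ h => h.2.1.le) (by positivity)

theorem improvement_le (Δ : Configuration n 3) {V₀ : Finset (Fin n)} (hS : IsSeparated Δ V₀) :
    improvement Δ V₀ ≤ mainTerm Δ V₀ + 200 * numDefects Δ V₀ :=
  sup'_le _ _ fun σ _ => gain_le Δ hS σ

theorem improvement_le_three_halves_mul (Δ : Configuration n 3) {V₀ : Finset (Fin n)}
    (hS : IsSeparated Δ V₀) : improvement Δ V₀ ≤ 3 / 2 * n := by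
  refine sup'_le _ _ fun σ _ => ?_
  change gain Δ (qaoaState (-(Real.pi / 4)) optimalAngle Δ) V₀ σ ≤ _
  rw [gain_eq_sum _ Δ hS σ]
  have h := sum_le_sum fun x (_ : x ∈ univ) => edgeGain_le_one optimalAngle Δ hS σ x
  rw [sum_const, card_univ, Fintype.card_prod, Fintype.card_fin, Fintype.card_fin, nsmul_eq_mul,
    mul_one, Nat.cast_mul] at h
  norm_num at h
  linarith

/-- The claimed bound exceeds the leading term by a small positive multiple of `n`. This slack
absorbs the irregular stars when `V₀` is so large that few vertices remain outside the stars. -/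
theorem leadingTerm_le {α m : ℝ} (h1 : α ≤ 1 / 4) (hm : 0 < m) :
    leadingTerm m (α * m) + 0.0006 * (α ^ 2 / (0.5 - α) ^ 3) * m ≤
      α ^ 2 * (0.18125 - 0.83875 * α + 0.99 * α ^ 2) / (0.5 - α) ^ 3 * m := by
  have hh : 0 < 0.5 - α := by norm_num; linarith
  have e : leadingTerm m (α * m) = α ^ 2 / (0.5 - α) ^ 3 * m *
      (5 / 12 * (0.5 - α) ^ 2 + Real.sin optimalAngle / 6 * ((1 - 3 * α) * (0.5 - α)) +
        (1 - 3 * α) ^ 2 / 81) := by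
    have h3 : 3 * m - 6 * (α * m) = 6 * (0.5 - α) * m := by ring
    rw [leadingTerm, h3]
    field_simp
    ring
  have hs : Real.sin optimalAngle / 6 * ((1 - 3 * α) * (0.5 - α)) ≤
      0.57736 / 6 * ((1 - 3 * α) * (0.5 - α)) := by
    refine mul_le_mul_of_nonneg_right ?_ (mul_nonneg (by linarith) hh.le)
    linarith [sin_optimalAngle_le]
  have hp : 5 / 12 * (0.5 - α) ^ 2 + Real.sin optimalAngle / 6 * ((1 - 3 * α) * (0.5 - α)) +
      (1 - 3 * α) ^ 2 / 81 + 0.0006 ≤ 0.18125 - 0.83875 * α + 0.99 * α ^ 2 := by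
    nlinarith
  have hc : 0 ≤ α ^ 2 / (0.5 - α) ^ 3 * m := by positivity
  have := mul_le_mul_of_nonneg_left hp hc
  rw [e]
  calc _ = _ := by ring
    _ ≤ _ := this
    _ = _ := by ring

/-- Rematching the free half-edges while the stars are kept fixed. -/
theorem sum_improvement_le (V₀ : Finset (Fin n)) (A : Finset (Configuration n 3))
    (hA : ∀ Δ, Δ ∈ A ↔ IsSeparated Δ V₀) (hn : 20 ≤ n) (hk : 4 * #V₀ ≤ n) :
    ∑ Δ ∈ A, improvement Δ V₀ ≤
      ∑ Δ ∈ A, (leadingTerm n #V₀ + 200000 + 300 * #(irregular Δ V₀)) :=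
  (sum_le_sum fun Δ hΔ => improvement_le Δ ((hA Δ).1 hΔ)).trans
    (sum_le_sum_of_starClass V₀ _ _ A hA fun _ hS => sum_starClass_le hS hn hk)

/-- The bound for large `n`. Irregular stars are rare if at least `n / 10 ^ 6` vertices are free; if
there are fewer, then `#V₀ ≥ n / 5`, and the slack in `leadingTerm_le` exceeds `300 n / 10 ^ 6`. -/
theorem sum_improvement_le_card_mul (V₀ : Finset (Fin n)) (A : Finset (Configuration n 3))
    (hA : ∀ Δ, Δ ∈ A ↔ IsSeparated Δ V₀) (hn : 10 ^ 6 ≤ n) (hk : 4 * #V₀ ≤ n) {α : ℝ}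
    (hα : α = #V₀ / n) :
    ∑ Δ ∈ A, improvement Δ V₀ ≤
      #A * (α ^ 2 * (0.18125 - 0.83875 * α + 0.99 * α ^ 2) / (0.5 - α) ^ 3 * n + 10 ^ 15) := by
  have hn' : (10 ^ 6 : ℝ) ≤ n := by exact_mod_cast hn
  have hn0 : (0 : ℝ) < n := lt_of_lt_of_le (by norm_num) hn'
  have hk' : 4 * (#V₀ : ℝ) ≤ n := by exact_mod_cast hk
  have hV : (#V₀ : ℝ) = α * n := by rw [hα]; field_simp
  have h0 : 0 ≤ α := by rw [hα]; exact div_nonneg (Nat.cast_nonneg _) hn0.le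
  have h1 : α ≤ 1 / 4 := by rw [hα, div_le_iff₀ hn0]; linarith
  have hh : 0 < 0.5 - α := by norm_num; linarith
  have key := sum_improvement_le V₀ A hA (le_trans (by norm_num) hn) hk
  have hI := sum_irregular_le V₀ A hA hk (t := n / 10 ^ 6) (by rw [one_le_div] <;> linarith)
  rw [Finset.sum_add_distrib, sum_const, nsmul_eq_mul, ← Finset.mul_sum] at key
  have hL := leadingTerm_le h1 hn0
  have t1 : 9 * (#V₀ : ℝ) / (n / 10 ^ 6) ≤ 10 ^ 7 := by
    rw [div_le_iff₀ (by positivity)]; linarith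
  have t2 : 9 * (#V₀ : ℝ) * n / (n / 10 ^ 6) ^ 2 ≤ 9 / 4 * 10 ^ 12 := by
    rw [div_le_iff₀ (by positivity)]; nlinarith
  have t3 : 300 * (if (n : ℝ) - 4 * #V₀ < n / 10 ^ 6 then (n : ℝ) / 10 ^ 6 else 0) ≤
      0.0006 * (α ^ 2 / (0.5 - α) ^ 3) * n := by
    split_ifs with h
    · have h2 : 0.2 ≤ α := by
        by_contra hc
        push Not at hc
        have : α * n ≤ 0.2 * n := mul_le_mul_of_nonneg_right hc.le hn0.le
        norm_num at this
        linarith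
      have : 1 ≤ α ^ 2 / (0.5 - α) ^ 3 := by
        rw [one_le_div (by positivity)]
        calc (0.5 - α) ^ 3 ≤ 0.3 ^ 3 := pow_le_pow_left₀ hh.le (by linarith) 3
          _ ≤ 0.2 ^ 2 := by norm_num
          _ ≤ α ^ 2 := pow_le_pow_left₀ (by norm_num) h2 2
      have := mul_le_mul_of_nonneg_right this hn0.le
      linarith
    · have : 0 ≤ α ^ 2 / (0.5 - α) ^ 3 := by positivity
      rw [mul_zero]
      positivity
  have hA0 : (0 : ℝ) ≤ #A := Nat.cast_nonneg _
  rw [← hV] at hL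
  refine key.trans (le_trans (add_le_add le_rfl (mul_le_mul_of_nonneg_left hI (by norm_num))) ?_)
  rw [mul_left_comm, ← mul_add]
  refine mul_le_mul_of_nonneg_left ?_ hA0
  linarith

end QAOA

end

theorem mainTheorem1 :
    ∃ C : ℝ, ∀ (n : ℕ) (V₀ : Finset (Fin n)) (α : ℝ), Even n →
      α = (V₀.card : ℝ) / (n : ℝ) → 0 < α → α < QAOA.alphaStar 3 →
      QAOA.condExpectation (fun Δ : QAOA.Configuration n 3 => QAOA.improvement Δ V₀)
          (fun Δ => QAOA.IsKIndependent Δ.graph 2 V₀) ≤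
        α ^ 2 * (0.18125 - 0.83875 * α + 0.99 * α ^ 2) / (0.5 - α) ^ 3 * n + C := by
  classical
  refine ⟨10 ^ 15, fun n V₀ α _ hα h0 h1 => ?_⟩
  have h14 : α ≤ 1 / 4 := (h1.trans_le (QAOA.alphaStar_le 3)).le.trans (by norm_num)
  have hn0 : (0 : ℝ) < n := by
    rcases Nat.eq_zero_or_pos n with h | h
    · simp [hα, h] at h0
    · exact_mod_cast h
  have hk : 4 * V₀.card ≤ n := by
    rw [hα, div_le_iff₀ hn0] at h14
    have : 4 * (V₀.card : ℝ) ≤ n := by linarith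
    exact_mod_cast this
  have hh : 0 < 0.5 - α := by norm_num; linarith
  have hp : 0 ≤ 0.18125 - 0.83875 * α + 0.99 * α ^ 2 := by nlinarith
  have hB : 0 ≤ α ^ 2 * (0.18125 - 0.83875 * α + 0.99 * α ^ 2) / (0.5 - α) ^ 3 * n := by
    positivity
  unfold QAOA.condExpectation
  set A : Finset (QAOA.Configuration n 3) :=
    Finset.univ.filter fun Δ => QAOA.IsKIndependent Δ.graph 2 V₀ with hAdef
  have hA : ∀ Δ, Δ ∈ A ↔ QAOA.IsSeparated Δ V₀ := fun Δ => by
    rw [hAdef, Finset.mem_filter, QAOA.isKIndependent_two_iff]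
    exact and_iff_right (Finset.mem_univ Δ)
  have key : ∑ Δ ∈ A, QAOA.improvement Δ V₀ ≤ A.card *
      (α ^ 2 * (0.18125 - 0.83875 * α + 0.99 * α ^ 2) / (0.5 - α) ^ 3 * n + 10 ^ 15) := by
    by_cases hn : 10 ^ 6 ≤ n
    · exact QAOA.sum_improvement_le_card_mul V₀ A hA hn hk hα
    · rw [← nsmul_eq_mul]
      refine Finset.sum_le_card_nsmul _ _ _ fun Δ hΔ =>
        (QAOA.improvement_le_three_halves_mul Δ ((hA Δ).1 hΔ)).trans ?_
      have : (n : ℝ) ≤ 10 ^ 6 := by exact_mod_cast (not_le.1 hn).le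
      linarith
  -- if `A` is empty, the conditional expectation is `0 / 0 = 0`, and the bound is nonnegative
  exact div_le_of_le_mul₀ (Nat.cast_nonneg _) (by positivity) (by rw [mul_comm]; exact key)
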